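/- **Theorem 3 (Size Reduction).** Write $x=(1\pm\epsilon)y$ for $(1-\epsilon)y\le x\le(1+\epsilon)y$, $\mathrm{dist}$ for Euclidean distance, $\mathrm{dist}(x,S)=\inf_{s\in S}\|x-s\|_2$, $\mathbb P_P$ for the orthogonal projection onto a linear subspace $P$, $\mathrm{nnz}(A)$ for the number of nonzero entries of $A$, and $\tilde O(f)$ for $O(f\cdot\mathrm{polylog}(f))$. A *$k$-dimensional shape* is a nonempty set $S\subseteq\mathbb R^d$ whose linear span has dimension at most $k$. Fix a constant $c\in(0,1)$. There is a single randomized real-RAM algorithm (unit-cost arithmetic on integers and exact reals, square roots, comparisons, indirect addressing and fair coin flips; no rounding) with the following property. Let $n,d,k\ge 1$ and $0<\epsilon<1$, let $A\in\mathbb R^{n\times d}$ have rows $a_1,\dots,a_n$, and let $P\subseteq\mathbb R^d$ be a linear subspace of dimension $r=\tilde O(k^3/\epsilon^6)$ such that for every $k$-dimensional shape $S$ $$\sum_i\sqrt{\mathrm{dist}(\mathbb P_Pa_i,S)^2+\mathrm{dist}(a_i,P)^2}=(1\pm c\,\epsilon)\sum_i\mathrm{dist}(a_i,S).$$ Given $n,d,k,r,\epsilon$,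 the list (in any order) of the nonzero entries of $A$ with their positions, and a matrix $B\in\mathbb R^{d\times r}$ whose columns are an orthonormal basis of $P$, the algorithm always halts within time $\tilde O\big(\mathrm{nnz}(A)+(n+d)\,\mathrm{poly}(k/\epsilon)\big)$ and outputs vectors $a_i^B\in\mathbb R^r$ and values $v_i\ge 0$ $(1\le i\le n)$ such that, with probability at least $9/10$, simultaneously for every $k$-dimensional shape $S$, $$\sum_i\sqrt{\mathrm{dist}(Ba_i^B,S)^2+v_i^2}=(1\pm\epsilon)\sum_i\mathrm{dist}(a_i,S).$$ The constants and exponents hidden in the time bound depend only on $c$ and on those hidden in $r=\tilde O(k^3/\epsilon^6)$. The numbers to be stored ($B$, all $a_i^B$ and all $v_i$) are $n(r+1)+dr=(n+d)\cdot\tilde O(k^3/\epsilon^6)$ many. -/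

import Mathlib

open MeasureTheory
open scoped ENNReal

/-! ## A randomized real RAM -/

namespace RealRAM

/-- A memory state.  The memory consists of arrays of natural numbers and arrays of real numbers;
an array has a name (a numeral fixed in the program text) and cells indexed by `ℕ`.
`flips` is the number of random bits that have been consumed. -/
structure State where
  ints : ℕ → ℕ → ℕ
  reals : ℕ → ℕ → ℝ
  flips : ℕ

/-- Natural number expressions: constants, array cells (indices can be computed, which gives
indirect addressing), addition, truncated subtraction, multiplication. -/
inductive IExp where
  | lit (c : ℕ)
  | get (a : ℕ) (i : IExp)
  | add (e f : IExp)
  | sub (e f : IExp)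
  | mul (e f : IExp)

/-- Real expressions: integers read as reals, array cells, the four arithmetic operations and the
square root.  There are no real constants other than those obtained from natural numbers and no
conversion from reals to integers (no rounding). -/
inductive RExp where
  | ofInt (e : IExp)
  | get (a : ℕ) (i : IExp)
  | add (e f : RExp)
  | sub (e f : RExp)
  | mul (e f : RExp)
  | div (e f : RExp)
  | sqrt (e : RExp)

/-- Tests: comparison of two natural numbers or of two reals. -/
inductive Test where
  | ilt (e f : IExp)
  | rlt (e f : RExp)

/-- Programs.  A program is a finite piece of text and does not depend on the input. -/
inductive Prog where
  | skip
  | iset (a : ℕ) (i e : IExp)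
  | rset (a : ℕ) (i : IExp) (e : RExp)
  | flip (a : ℕ) (i : IExp)
  | seq (p q : Prog)
  | ite (b : Test) (p q : Prog)
  | while (b : Test) (p : Prog)

/-- Value of a natural number expression. -/
def IExp.eval (s : State) : IExp → ℕ
  | .lit c => c
  | .get a i => s.ints a (i.eval s)
  | .add e f => e.eval s + f.eval s
  | .sub e f => e.eval s - f.eval s
  | .mul e f => e.eval s * f.eval s

/-- Every constant, memory access and operation costs one step. -/
def IExp.cost : IExp → ℕ
  | .lit _ => 1
  | .get _ i => i.cost + 1
  | .add e f => e.cost + f.cost + 1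
  | .sub e f => e.cost + f.cost + 1
  | .mul e f => e.cost + f.cost + 1

/-- Value of a real expression (exact real arithmetic; division by `0` and the square root of a
negative number return `0`). -/
noncomputable def RExp.eval (s : State) : RExp → ℝ
  | .ofInt e => (e.eval s : ℝ)
  | .get a i => s.reals a (i.eval s)
  | .add e f => e.eval s + f.eval s
  | .sub e f => e.eval s - f.eval s
  | .mul e f => e.eval s * f.eval s
  | .div e f => e.eval s / f.eval s
  | .sqrt e => Real.sqrt (e.eval s)

/-- Every conversion, memory access and operation costs one step. -/
def RExp.cost : RExp → ℕ
  | .ofInt e => e.cost + 1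
  | .get _ i => i.cost + 1
  | .add e f => e.cost + f.cost + 1
  | .sub e f => e.cost + f.cost + 1
  | .mul e f => e.cost + f.cost + 1
  | .div e f => e.cost + f.cost + 1
  | .sqrt e => e.cost + 1

/-- The test succeeds. -/
def Test.holds (s : State) : Test → Prop
  | .ilt e f => e.eval s < f.eval s
  | .rlt e f => e.eval s < f.eval s

/-- A comparison costs one step more than the evaluation of its two sides. -/
def Test.cost : Test → ℕ
  | .ilt e f => e.cost + f.cost + 1
  | .rlt e f => e.cost + f.cost + 1

/-- Write `x` to cell `i` of the integer array `a`. -/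
def State.setInt (s : State) (a i x : ℕ) : State :=
  { s with ints := Function.update s.ints a (Function.update (s.ints a) i x) }

/-- Write `x` to cell `i` of the real array `a`. -/
def State.setReal (s : State) (a i : ℕ) (x : ℝ) : State :=
  { s with reals := Function.update s.reals a (Function.update (s.reals a) i x) }

/-- `Exec ω p s t s'`: with the random bits `ω 0, ω 1, …`, the program `p` started in state `s`
halts in state `s'` after exactly `t` steps. -/
inductive Exec (ω : ℕ → Bool) : Prog → State → ℕ → State → Prop
  | skip (s : State) : Exec ω .skip s 1 s
  | iset (s : State) (a : ℕ) (i e : IExp) :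
      Exec ω (.iset a i e) s (i.cost + e.cost + 1) (s.setInt a (i.eval s) (e.eval s))
  | rset (s : State) (a : ℕ) (i : IExp) (e : RExp) :
      Exec ω (.rset a i e) s (i.cost + e.cost + 1) (s.setReal a (i.eval s) (e.eval s))
  | flip (s : State) (a : ℕ) (i : IExp) :
      Exec ω (.flip a i) s (i.cost + 1)
        { s.setInt a (i.eval s) (ω s.flips).toNat with flips := s.flips + 1 }
  | seq {p q : Prog} {s s₁ s₂ : State} {t₁ t₂ : ℕ} :
      Exec ω p s t₁ s₁ → Exec ω q s₁ t₂ s₂ → Exec ω (.seq p q) s (t₁ + t₂) s₂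
  | ite_true {b : Test} {p q : Prog} {s s' : State} {t : ℕ} :
      b.holds s → Exec ω p s t s' → Exec ω (.ite b p q) s (b.cost + t) s'
  | ite_false {b : Test} {p q : Prog} {s s' : State} {t : ℕ} :
      ¬ b.holds s → Exec ω q s t s' → Exec ω (.ite b p q) s (b.cost + t) s'
  | while_true {b : Test} {p : Prog} {s s₁ s₂ : State} {t₁ t₂ : ℕ} :
      b.holds s → Exec ω p s t₁ s₁ → Exec ω (.while b p) s₁ t₂ s₂ →
        Exec ω (.while b p) s (b.cost + t₁ + t₂) s₂
  | while_false {b : Test} {p : Prog} {s : State} :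
      ¬ b.holds s → Exec ω (.while b p) s b.cost s

/-- The law of an infinite sequence of independent fair coin flips. -/
noncomputable def coinMeasure : Measure (ℕ → Bool) :=
  Measure.infinitePi fun _ => (PMF.uniformOfFintype Bool).toMeasure

end RealRAM

/-! ## Shapes and sums of distances -/

namespace SizeReduction

/-- `x = (1 ± ε) y`. -/
def Approx (ε x y : ℝ) : Prop :=
  (1 - ε) * y ≤ x ∧ x ≤ (1 + ε) * y

/-- A `k`-dimensional shape: a (nonempty) set of points of `ℝ^d` that spans a linear subspace of
dimension at most `k`. -/
def IsShape {d : ℕ} (k : ℕ) (S : Set (EuclideanSpace ℝ (Fin d))) : Prop :=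
  S.Nonempty ∧ Module.finrank ℝ (Submodule.span ℝ S) ≤ k

/-- The `i`-th row of `A`, as a point of Euclidean space. -/
def row {n d : ℕ} (A : Matrix (Fin n) (Fin d) ℝ) (i : Fin n) : EuclideanSpace ℝ (Fin d) :=
  WithLp.toLp 2 (A i)

/-- The exact projections of the rows of `A` to `P` together with their distances to `P` give a
`(1 ± ε)`-approximation of the sum of distances to every `k`-dimensional shape. -/
def PreservesShapes {n d : ℕ} (A : Matrix (Fin n) (Fin d) ℝ)
    (P : Submodule ℝ (EuclideanSpace ℝ (Fin d))) (k : ℕ) (ε : ℝ) : Prop :=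
  ∀ S : Set (EuclideanSpace ℝ (Fin d)), IsShape k S →
    Approx ε
      (∑ i, Real.sqrt (Metric.infDist (P.starProjection (row A i)) S ^ 2 +
        Metric.infDist (row A i) (P : Set (EuclideanSpace ℝ (Fin d))) ^ 2))
      (∑ i, Metric.infDist (row A i) S)

/-- The vectors `B xᵢ` (with `B` an orthonormal basis of `P` and `xᵢ ∈ ℝ^r`) together with the
numbers `vᵢ` give a `(1 ± ε)`-approximation of the sum of distances to every `k`-dimensional
shape. -/
def ReducedPreservesShapes {n d r : ℕ} (A : Matrix (Fin n) (Fin d) ℝ)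
    {P : Submodule ℝ (EuclideanSpace ℝ (Fin d))} (B : OrthonormalBasis (Fin r) ℝ P)
    (k : ℕ) (ε : ℝ) (x : Fin n → Fin r → ℝ) (v : Fin n → ℝ) : Prop :=
  ∀ S : Set (EuclideanSpace ℝ (Fin d)), IsShape k S →
    Approx ε
      (∑ i, Real.sqrt (Metric.infDist
        (∑ l, x i l • (B l : EuclideanSpace ℝ (Fin d))) S ^ 2 + v i ^ 2))
      (∑ i, Metric.infDist (row A i) S)

/-- `f · polylog(f)` with explicit constants; `2` is added to keep the logarithm away from `0`. -/
noncomputable def softO (C : ℝ) (q : ℕ) (f : ℝ) : ℝ :=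
  C * f * Real.log (f + 2) ^ q

/-- Number of nonzero entries. -/
noncomputable def nnz {n d : ℕ} (A : Matrix (Fin n) (Fin d) ℝ) : ℕ :=
  Set.ncard {p : Fin n × Fin d | A p.1 p.2 ≠ 0}

/-- `L` lists the positions of the nonzero entries of `A`, in any order, each of them once. -/
def ListsSupport {n d : ℕ} (A : Matrix (Fin n) (Fin d) ℝ) (L : List (Fin n × Fin d)) : Prop :=
  L.Nodup ∧ ∀ p : Fin n × Fin d, p ∈ L ↔ A p.1 p.2 ≠ 0

/-- The initial memory.  Integer array `0` holds `n, d, k, r` and the number of nonzero entries,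
real array `0` holds `ε`.  The matrix `A` is given in sparse form: the `m`-th listed nonzero entry
has its row in integer array `1`, its column in integer array `2` and its value in real array `1`.
Real array `2` holds the `d × r` matrix with columns `B 0, …, B (r-1)` in row-major order.
All other cells are `0`. -/
noncomputable def input {n d r : ℕ} (k : ℕ) (ε : ℝ) (A : Matrix (Fin n) (Fin d) ℝ)
    (L : List (Fin n × Fin d)) {P : Submodule ℝ (EuclideanSpace ℝ (Fin d))}
    (B : OrthonormalBasis (Fin r) ℝ P) : RealRAM.State where
  ints a := match a with
    | 0 => fun i => [n, d, k, r, L.length].getD i 0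
    | 1 => fun i => (L.map fun p => (p.1 : ℕ)).getD i 0
    | 2 => fun i => (L.map fun p => (p.2 : ℕ)).getD i 0
    | _ => fun _ => 0
  reals a := match a with
    | 0 => fun i => [ε].getD i 0
    | 1 => fun i => (L.map fun p => A p.1 p.2).getD i 0
    | 2 => fun i => if h : i < d * r then
        (B (Fin.modNat ⟨i, h⟩) : EuclideanSpace ℝ (Fin d)) (Fin.divNat ⟨i, h⟩) else 0
    | _ => fun _ => 0
  flips := 0

/-- The output vectors `xᵢ ∈ ℝ^r` are read off row by row from real array `3`. -/
def outVec (n r : ℕ) (s : RealRAM.State) (i : Fin n) (l : Fin r) : ℝ :=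
  s.reals 3 (i * r + l)

/-- The output values `vᵢ` are read off from real array `4`. -/
def outVal (n : ℕ) (s : RealRAM.State) (i : Fin n) : ℝ :=
  s.reals 4 i

end SizeReduction

/-! For a row `a` put `w = a - P.starProjection a`. It is enough to know the coordinates of the
projection of `a` in the basis `B`, together with `‖w‖`, up to a joint error `δ‖w‖` where `δ = (1 -
c)ε/2`. Both `Metric.infDist · S` and `(s, t) ↦ √(s² + t²)` are 1-Lipschitz, so the summand of this
row moves by at most `δ‖w‖`, and `‖w‖` is itself at most the exact summand. Hence the whole sum
changes by a factor `1 ± δ`, for all shapes at once, and the hypothesis on `P` leaves room for this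
because `cε + 2δ = ε` (`reducedPreservesShapes_of_close`).

Computing the coordinates exactly would cost about `nnz(A) · r`. Instead a least squares problem is
solved after a CountSketch `S` with `2 ^ b` buckets, which is applied to all of `A` with one
addition per nonzero entry. As `S` is linear, the part of `a` inside `P` is reproduced without error
and only `w` acts as noise, so the error scales with `‖w‖` and not with `‖a‖`. If `S` nearly
preserves all inner products among the basis vectors and `w/‖w‖`, the normal equations bound the
errors of both the solution and the residual norm (`least_squares_error`, `sketch_estimate`). The
mean squared error of one inner product of unit vectors is at most `2 / 2 ^ b` (`second_moment`), so
by Markov a sketch is bad for a given row with probability at most `1/15` once `2 ^ b` is of order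
`(r + 1)⁴ / ε²`.

To serve all rows simultaneously, `T ≈ log₂ (10 n)` independent sketches are used. For a fixed row
at least half of them are bad with probability at most `2⁻ᵀ` (`card_majority_bad`), and a union
bound over the rows leaves total failure probability `1/10` (`most_sketches_good`). Whenever most
estimates are good, every coordinatewise median is good too (`median_mem`, `medians_close`).

On the machine, the least squares problem is solved by unnormalized modified Gram–Schmidt, where
coefficients stored below each column record the column operations (`IsGramSchmidt`). All real
computations are loop nests around one instruction `x ← x + e` that never reads the array it writes.
Such a nest adds an explicit function to its array (`Nest.runs`), so its correctness is an identity
of finite sums and its cost is a constant times the product of its loop lengths. The text of the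
program depends on `c` only; it finds `b` and `T` from `r`, `ε` and `n` by repeated doubling. -/

namespace RealRAM

/-! ## Running programs with a time bound -/

/-- With the random bits `ω`, the program `p` takes the state `s` to `s'` in at most `B` steps. -/
def Runs (ω : ℕ → Bool) (p : Prog) (s s' : State) (B : ℕ) : Prop :=
  ∃ t, Exec ω p s t s' ∧ t ≤ B

theorem Runs.mono {ω : ℕ → Bool} {p : Prog} {s s' : State} {B B' : ℕ}
    (h : Runs ω p s s' B) (hB : B ≤ B') : Runs ω p s s' B' := by
  obtain ⟨t, h, ht⟩ := h
  exact ⟨t, h, ht.trans hB⟩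

theorem Runs.seq {ω : ℕ → Bool} {p q : Prog} {s s₁ s₂ : State} {B₁ B₂ : ℕ}
    (h₁ : Runs ω p s s₁ B₁) (h₂ : Runs ω q s₁ s₂ B₂) : Runs ω (.seq p q) s s₂ (B₁ + B₂) := by
  obtain ⟨t₁, h₁, ht₁⟩ := h₁
  obtain ⟨t₂, h₂, ht₂⟩ := h₂
  exact ⟨_, .seq h₁ h₂, by omega⟩

theorem Runs.iset (ω : ℕ → Bool) (s : State) (a : ℕ) (i e : IExp) :
    Runs ω (.iset a i e) s (s.setInt a (i.eval s) (e.eval s)) (i.cost + e.cost + 1) :=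
  ⟨_, .iset s a i e, le_rfl⟩

@[simp] theorem State.setInt_reals (s : State) (a i x : ℕ) : (s.setInt a i x).reals = s.reals := rfl

@[simp] theorem State.setInt_flips (s : State) (a i x : ℕ) : (s.setInt a i x).flips = s.flips := rfl

theorem State.setInt_ints (s : State) (a i x b : ℕ) :
    (s.setInt a i x).ints b = if b = a then Function.update (s.ints a) i x else s.ints b := by
  simp only [State.setInt, Function.update_apply]

theorem State.setInt_ints_of_ne (s : State) {a b : ℕ} (i x : ℕ) (h : b ≠ a) :
    (s.setInt a i x).ints b = s.ints b := by
  simp [State.setInt_ints, h]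

@[simp] theorem State.setInt_same (s : State) (a i x : ℕ) : (s.setInt a i x).ints a i = x := by
  simp [State.setInt_ints]

theorem State.setInt_self (s : State) (a i : ℕ) : s.setInt a i (s.ints a i) = s := by
  simp [State.setInt]

@[simp] theorem State.setInt_setInt (s : State) (a i x y : ℕ) :
    (s.setInt a i x).setInt a i y = s.setInt a i y := by
  simp [State.setInt]

/-- A loop in which the counter `ints c 0` runs from `0` to `N - 1`; it is `0` again at the end. -/
def Prog.forLoop (c : ℕ) (N : IExp) (p : Prog) : Prog :=
  .seq (.while (.ilt (.get c (.lit 0)) N)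
    (.seq p (.iset c (.lit 0) (.add (.get c (.lit 0)) (.lit 1))))) (.iset c (.lit 0) (.lit 0))

/-- The states `f i` carry the counter value `0`, so descriptions of a loop nest never mention its
counters; the true value is put back by `setInt`. The `9` pays for the comparison and the increment.
-/
theorem Runs.forLoop {ω : ℕ → Bool} {c : ℕ} {N : IExp} {p : Prog} {n B : ℕ} (f : ℕ → State)
    (h0 : ∀ i ≤ n, (f i).ints c 0 = 0) (hN : ∀ i ≤ n, N.eval ((f i).setInt c 0 i) = n)
    (hp : ∀ i < n, Runs ω p ((f i).setInt c 0 i) ((f (i + 1)).setInt c 0 i) B) :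
    Runs ω (Prog.forLoop c N p) (f 0) (f n) ((n + 1) * (B + N.cost + 9)) := by
  -- The induction is on the number `j` of remaining iterations, because unfolding `while` splits
  -- off the first one.
  have key : ∀ j ≤ n, Runs ω (.while (.ilt (.get c (.lit 0)) N)
      (.seq p (.iset c (.lit 0) (.add (.get c (.lit 0)) (.lit 1)))))
      ((f (n - j)).setInt c 0 (n - j)) ((f n).setInt c 0 n) (j * (B + N.cost + 9) + N.cost + 3) := by
    intro j
    induction j with
    | zero =>
      intro _
      refine ⟨_, .while_false ?_, ?_⟩
      · simp only [Test.holds, IExp.eval, Nat.sub_zero, State.setInt_same, hN n le_rfl]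
        omega
      · simp only [Test.cost, IExp.cost]; omega
    | succ j ih =>
      intro hj
      obtain ⟨t₁, h₁, ht₁⟩ := hp (n - (j + 1)) (by omega)
      obtain ⟨t₂, h₂, ht₂⟩ := ih (by omega)
      have e1 : n - (j + 1) + 1 = n - j := by omega
      rw [e1] at h₁
      refine ⟨_, .while_true (t₂ := t₂) ?_ (.seq h₁ (.iset _ _ _ _)) ?_, ?_⟩
      · simp only [Test.holds, IExp.eval, State.setInt_same, hN (n - (j + 1)) (by omega)]
        omega
      · simp only [IExp.eval, State.setInt_same, State.setInt_setInt, e1]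
        exact h₂
      · simp only [Test.cost, IExp.cost]
        nlinarith
  obtain ⟨t, h, ht⟩ := key n le_rfl
  have hs : (f (n - n)).setInt c 0 (n - n) = f 0 := by
    conv_rhs => rw [← State.setInt_self (f 0) c 0]
    rw [Nat.sub_self, h0 0 (Nat.zero_le _)]
  rw [hs] at h
  have hf : ((f n).setInt c 0 n).setInt c 0 0 = f n := by
    rw [State.setInt_setInt]
    conv_rhs => rw [← State.setInt_self (f n) c 0]
    rw [h0 n le_rfl]
  have h2 := Exec.iset (ω := ω) ((f n).setInt c 0 n) c (.lit 0) (.lit 0)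
  simp only [IExp.eval, hf] at h2
  refine ⟨_, .seq h h2, ?_⟩
  simp only [IExp.cost]
  nlinarith

/-! ## Loop nests around a single addition to a real array -/

/-- The state after adding the function `g` to the real array `a`. -/
def State.addReal (s : State) (a : ℕ) (g : ℕ → ℝ) : State :=
  { s with reals := Function.update s.reals a (s.reals a + g) }

@[simp] theorem State.addReal_ints (s : State) (a : ℕ) (g : ℕ → ℝ) :
    (s.addReal a g).ints = s.ints := rfl

theorem State.addReal_reals (s : State) (a : ℕ) (g : ℕ → ℝ) (b : ℕ) :
    (s.addReal a g).reals b = if b = a then s.reals a + g else s.reals b := by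
  simp only [State.addReal, Function.update_apply]

theorem State.addReal_addReal (s : State) (a : ℕ) (g h : ℕ → ℝ) :
    (s.addReal a g).addReal a h = s.addReal a (g + h) := by
  simp [State.addReal, add_assoc]

theorem State.addReal_setInt (s : State) (a : ℕ) (g : ℕ → ℝ) (b i x : ℕ) :
    (s.addReal a g).setInt b i x = (s.setInt b i x).addReal a g := rfl

@[simp] theorem State.addReal_zero (s : State) (a : ℕ) : s.addReal a 0 = s := by
  simp [State.addReal]

/-- The expression does not read the integer array `c`. -/
def IExp.avoids (c : ℕ) : IExp → Bool
  | .lit _ => true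
  | .get a i => a != c && i.avoids c
  | .add e f => e.avoids c && f.avoids c
  | .sub e f => e.avoids c && f.avoids c
  | .mul e f => e.avoids c && f.avoids c

/-- The expression does not read the real array `a`. -/
def RExp.avoids (a : ℕ) : RExp → Bool
  | .ofInt _ => true
  | .get b _ => b != a
  | .add e f => e.avoids a && f.avoids a
  | .sub e f => e.avoids a && f.avoids a
  | .mul e f => e.avoids a && f.avoids a
  | .div e f => e.avoids a && f.avoids a
  | .sqrt e => e.avoids a

/-- The test does not read the real array `a`. -/
def Test.avoids (a : ℕ) : Test → Bool
  | .ilt _ _ => true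
  | .rlt e f => e.avoids a && f.avoids a

theorem IExp.eval_addReal (s : State) (a : ℕ) (g : ℕ → ℝ) (e : IExp) :
    e.eval (s.addReal a g) = e.eval s := by
  induction e with
  | lit c => rfl
  | get b i ih => simp [IExp.eval, ih]
  | add e f ihe ihf => simp [IExp.eval, ihe, ihf]
  | sub e f ihe ihf => simp [IExp.eval, ihe, ihf]
  | mul e f ihe ihf => simp [IExp.eval, ihe, ihf]

theorem IExp.eval_setInt (s : State) (c i x : ℕ) {e : IExp} (h : e.avoids c = true) :
    e.eval (s.setInt c i x) = e.eval s := by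
  induction e with
  | lit c => rfl
  | get b j ih =>
    simp only [IExp.avoids, Bool.and_eq_true, bne_iff_ne] at h
    simp [IExp.eval, ih h.2, State.setInt_ints, h.1]
  | add e f ihe ihf =>
    simp only [IExp.avoids, Bool.and_eq_true] at h
    simp [IExp.eval, ihe h.1, ihf h.2]
  | sub e f ihe ihf =>
    simp only [IExp.avoids, Bool.and_eq_true] at h
    simp [IExp.eval, ihe h.1, ihf h.2]
  | mul e f ihe ihf =>
    simp only [IExp.avoids, Bool.and_eq_true] at h
    simp [IExp.eval, ihe h.1, ihf h.2]

theorem RExp.eval_addReal (s : State) {a : ℕ} (g : ℕ → ℝ) {e : RExp} (h : e.avoids a = true) :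
    e.eval (s.addReal a g) = e.eval s := by
  induction e with
  | ofInt e => simp [RExp.eval, IExp.eval_addReal]
  | get b i =>
    simp only [RExp.avoids, bne_iff_ne] at h
    simp [RExp.eval, IExp.eval_addReal, State.addReal_reals, h]
  | add e f ihe ihf =>
    simp only [RExp.avoids, Bool.and_eq_true] at h
    simp [RExp.eval, ihe h.1, ihf h.2]
  | sub e f ihe ihf =>
    simp only [RExp.avoids, Bool.and_eq_true] at h
    simp [RExp.eval, ihe h.1, ihf h.2]
  | mul e f ihe ihf =>
    simp only [RExp.avoids, Bool.and_eq_true] at h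
    simp [RExp.eval, ihe h.1, ihf h.2]
  | div e f ihe ihf =>
    simp only [RExp.avoids, Bool.and_eq_true] at h
    simp [RExp.eval, ihe h.1, ihf h.2]
  | sqrt e ih =>
    simp only [RExp.avoids] at h
    simp [RExp.eval, ih h]

theorem Test.holds_addReal (s : State) {a : ℕ} (g : ℕ → ℝ) {b : Test} (h : b.avoids a = true) :
    b.holds (s.addReal a g) ↔ b.holds s := by
  cases b with
  | ilt e f => simp [Test.holds, IExp.eval_addReal]
  | rlt e f =>
    simp only [Test.avoids, Bool.and_eq_true] at h
    simp [Test.holds, RExp.eval_addReal s g h.1, RExp.eval_addReal s g h.2]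

/-- A nest of loops and tests around one instruction `x ← x + e` on a cell of a real array. -/
inductive Nest where
  | add (i : IExp) (e : RExp)
  | guard (b : Test) (p : Nest)
  | loop (c : ℕ) (N : IExp) (p : Nest)

namespace Nest

/-- The program of a nest whose instruction acts on the real array `a`. -/
def toProg (a : ℕ) : Nest → Prog
  | .add i e => .rset a i (.add (.get a i) e)
  | .guard b p => .ite b (p.toProg a) .skip
  | .loop c N p => Prog.forLoop c N (p.toProg a)

open Classical in
/-- What a nest adds to its real array. -/
noncomputable def delta : Nest → State → ℕ → ℝ
  | .add i e, s => Pi.single (i.eval s) (e.eval s)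
  | .guard b p, s => if b.holds s then p.delta s else 0
  | .loop c N p, s => ∑ i ∈ Finset.range (N.eval s), p.delta (s.setInt c 0 i)

/-- `c` is different from all loop counters and is not used by the bounds of the loops. -/
def fresh (c : ℕ) : Nest → Bool
  | .add _ _ => true
  | .guard _ p => p.fresh c
  | .loop c' N p => c' != c && N.avoids c && p.fresh c

/-- The array `a` is not read and the counters are used properly. -/
def ok (a : ℕ) : Nest → Bool
  | .add _ e => e.avoids a
  | .guard b p => b.avoids a && p.ok a
  | .loop c N p => N.avoids c && p.fresh c && p.ok a

/-- All loop counters are `0`. -/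
def ZeroCounters (s : State) : Nest → Prop
  | .add _ _ => True
  | .guard _ p => p.ZeroCounters s
  | .loop c _ p => s.ints c 0 = 0 ∧ p.ZeroCounters s

/-- A bound for the running time. -/
def time : Nest → State → ℕ
  | .add i e, _ => 2 * i.cost + e.cost + 3
  | .guard b p, s => b.cost + p.time s + 1
  | .loop _ N p, s => (N.eval s + 1) * (p.time s + N.cost + 9)

/-- The product of the lengths of the loops (each plus one). -/
def dims : Nest → State → ℕ
  | .add _ _, _ => 1
  | .guard _ p, s => p.dims s
  | .loop _ N p, s => (N.eval s + 1) * p.dims s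

/-- The total length of the text. -/
def weight : Nest → ℕ
  | .add i e => 2 * i.cost + e.cost + 3
  | .guard b p => b.cost + p.weight + 1
  | .loop _ N p => p.weight + N.cost + 9

theorem dims_pos (p : Nest) (s : State) : 1 ≤ p.dims s := by
  induction p with
  | add => exact le_rfl
  | guard b p ih => exact ih
  | loop c N p ih => exact Nat.mul_pos (Nat.succ_pos _) ih

/-- Separates the running time into a constant of the program text and a factor depending on the
input. All asymptotic estimates then concern `dims` only. -/
theorem time_le (p : Nest) (s : State) : p.time s ≤ p.weight * p.dims s := by
  induction p with
  | add => simp [time, weight, dims]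
  | guard b p ih =>
    have := p.dims_pos s
    simp only [time, weight, dims]
    nlinarith [Nat.zero_le b.cost]
  | loop c N p ih =>
    have h1 := p.dims_pos s
    have h2 : p.time s + N.cost + 9 ≤ (p.weight + N.cost + 9) * p.dims s := by
      nlinarith [Nat.zero_le N.cost]
    calc (N.eval s + 1) * (p.time s + N.cost + 9)
        ≤ (N.eval s + 1) * ((p.weight + N.cost + 9) * p.dims s) := Nat.mul_le_mul_left _ h2
      _ = _ := by simp only [weight, dims]; ring

theorem time_addReal (p : Nest) (s : State) (a : ℕ) (g : ℕ → ℝ) :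
    p.time (s.addReal a g) = p.time s := by
  induction p with
  | add => rfl
  | guard b p ih => simp [time, ih]
  | loop c N p ih => simp [time, ih, IExp.eval_addReal]

theorem time_setInt {p : Nest} {c : ℕ} (h : p.fresh c = true) (s : State) (i x : ℕ) :
    p.time (s.setInt c i x) = p.time s := by
  induction p with
  | add => rfl
  | guard b p ih => simp [time, ih h]
  | loop c N p ih =>
    simp only [fresh, Bool.and_eq_true] at h
    simp [time, ih h.2, IExp.eval_setInt _ _ _ _ h.1.2]

/-- This is why a nest must not read its own array: partial results already written there do not
influence later contributions, so the contributions of all iterations can be evaluated in the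
initial state. -/
theorem delta_addReal {p : Nest} {a : ℕ} (h : p.ok a = true) (s : State) (g : ℕ → ℝ) :
    p.delta (s.addReal a g) = p.delta s := by
  induction p generalizing s with
  | add => simp only [ok] at h; simp [delta, IExp.eval_addReal, RExp.eval_addReal s g h]
  | guard b p ih =>
    simp only [ok, Bool.and_eq_true] at h
    have hb := Test.holds_addReal s g h.1
    by_cases hs : b.holds s
    · simp only [delta, ih h.2, if_pos hs, if_pos (hb.2 hs)]
    · simp only [delta, if_neg hs, if_neg (fun h' => hs (hb.1 h'))]
  | loop c N p ih =>
    simp only [ok, Bool.and_eq_true] at h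
    simp [delta, ih h.2, IExp.eval_addReal, State.addReal_setInt]

theorem zeroCounters_setInt {p : Nest} {c : ℕ} (h : p.fresh c = true) {s : State} (i x : ℕ)
    (hs : p.ZeroCounters s) : p.ZeroCounters (s.setInt c i x) := by
  induction p with
  | add => trivial
  | guard b p ih => exact ih h hs
  | loop c' N p ih =>
    simp only [fresh, Bool.and_eq_true, bne_iff_ne] at h
    exact ⟨by rw [State.setInt_ints_of_ne _ _ _ h.1.1]; exact hs.1, ih h.2 hs.2⟩

theorem zeroCounters_congr {p : Nest} {s s' : State} (h : s'.ints = s.ints)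
    (hs : p.ZeroCounters s) : p.ZeroCounters s' := by
  induction p with
  | add => trivial
  | guard b p ih => exact ih hs
  | loop c' N p ih => exact ⟨by rw [h]; exact hs.1, ih hs.2⟩

/-- Replaces loop invariants throughout: after `i` iterations the array has received the `i`-th
partial sum of contributions, each computed in the starting state. -/
theorem runs (ω : ℕ → Bool) {a : ℕ} {p : Nest} (hp : p.ok a = true) {s : State}
    (hs : p.ZeroCounters s) :
    Runs ω (p.toProg a) s (s.addReal a (p.delta s)) (p.time s) := by
  induction p generalizing s with
  | add i e =>
    simp only [ok] at hp
    refine ⟨i.cost + (RExp.add (.get a i) e).cost + 1, ?_, ?_⟩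
    · have h : s.addReal a (Pi.single (i.eval s) (e.eval s)) =
          s.setReal a (i.eval s) (s.reals a (i.eval s) + e.eval s) := by
        simp only [State.addReal, State.setReal]
        congr 2
        ext j
        by_cases hj : j = i.eval s
        · subst hj; simp
        · simp [hj]
      rw [delta, h]
      exact Exec.rset s a i (.add (.get a i) e)
    · simp only [RExp.cost, time]; omega
  | guard b p ih =>
    simp only [ok, Bool.and_eq_true] at hp
    by_cases hb : b.holds s
    · obtain ⟨t, h, ht⟩ := ih hp.2 hs
      refine ⟨b.cost + t, ?_, ?_⟩
      · simp only [delta, if_pos hb]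
        exact .ite_true hb h
      · simp only [time]; omega
    · refine ⟨b.cost + 1, ?_, ?_⟩
      · simp only [delta, if_neg hb, State.addReal_zero]
        exact .ite_false hb (.skip s)
      · simp only [time]; omega
  | loop c N p ih =>
    simp only [ok, Bool.and_eq_true] at hp
    have hN : ∀ (g : ℕ → ℝ) (i : ℕ), N.eval ((s.addReal a g).setInt c 0 i) = N.eval s := by
      intro g i
      rw [IExp.eval_setInt _ _ _ _ hp.1.1, IExp.eval_addReal]
    have := Runs.forLoop (ω := ω) (c := c) (N := N) (p := p.toProg a) (n := N.eval s)
      (B := p.time s)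
      (fun i => s.addReal a (∑ j ∈ Finset.range i, p.delta (s.setInt c 0 j)))
      (fun i _ => hs.1) (fun i _ => hN _ _) ?_
    · simpa [delta, time, toProg] using this
    · intro i _
      have h := ih hp.2 (s := (s.addReal a (∑ j ∈ Finset.range i,
        p.delta (s.setInt c 0 j))).setInt c 0 i)
        (zeroCounters_setInt hp.1.2 _ _ (zeroCounters_congr (s := s) rfl hs.2))
      rw [time_setInt hp.1.2, time_addReal] at h
      simp only [State.addReal_setInt, delta_addReal hp.2, State.addReal_addReal] at h ⊢
      rwa [Finset.sum_range_succ]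

end Nest

end RealRAM

/-! ## The CountSketch transform -/

namespace CountSketch

/-- The random data of a sketch: every coordinate has a bucket and a sign. -/
abbrev Hash (d m : ℕ) : Type := Fin d → Fin m × Bool

/-- The real number `±1` belonging to a random bit. -/
def sign (b : Bool) : ℝ := 1 - 2 * (b.toNat : ℝ)

@[simp] theorem sign_false : sign false = 1 := by simp [sign]

@[simp] theorem sign_true : sign true = -1 := by norm_num [sign]

/-- The sketch of a vector. -/
def sketch {d m : ℕ} (H : Hash d m) (u : Fin d → ℝ) (h : Fin m) : ℝ :=
  ∑ j, if (H j).1 = h then sign (H j).2 * u j else 0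

theorem sketch_add {d m : ℕ} (H : Hash d m) (u v : Fin d → ℝ) (h : Fin m) :
    sketch H (u + v) h = sketch H u h + sketch H v h := by
  simp only [sketch, ← Finset.sum_add_distrib, Pi.add_apply]
  refine Finset.sum_congr rfl fun j _ => ?_
  split_ifs <;> ring

theorem sketch_smul {d m : ℕ} (H : Hash d m) (c : ℝ) (u : Fin d → ℝ) (h : Fin m) :
    sketch H (c • u) h = c * sketch H u h := by
  simp only [sketch, Finset.mul_sum, Pi.smul_apply, smul_eq_mul]
  refine Finset.sum_congr rfl fun j _ => ?_
  split_ifs <;> ring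

theorem sketch_zero {d m : ℕ} (H : Hash d m) (h : Fin m) : sketch H 0 h = 0 := by
  simp [sketch]

theorem sketch_sum {d m : ℕ} {ι : Type*} (s : Finset ι) (H : Hash d m) (u : ι → Fin d → ℝ)
    (h : Fin m) : sketch H (∑ l ∈ s, u l) h = ∑ l ∈ s, sketch H (u l) h := by
  classical
  induction s using Finset.induction_on with
  | empty => simp [sketch_zero]
  | insert a s ha ih => rw [Finset.sum_insert ha, Finset.sum_insert ha, sketch_add, ih]

theorem sketch_cons {d m : ℕ} (x : Fin m × Bool) (H : Hash d m) (u : Fin (d + 1) → ℝ)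
    (h : Fin m) : sketch (d := d + 1) (Fin.cons x H) u h =
      (if x.1 = h then sign x.2 * u 0 else 0) + sketch H (Fin.tail u) h := by
  simp [sketch, Fin.sum_univ_succ, Fin.tail]

/-- Expectations over hash functions are computed by induction on the dimension. Both signs of the
separated coordinate are kept together so that terms odd in the sign cancel. -/
theorem sum_hash_succ {d m : ℕ} (F : Hash (d + 1) m → ℝ) :
    ∑ H, F H = ∑ H : Hash d m, ∑ h : Fin m,
      (F (Fin.cons (h, false) H) + F (Fin.cons (h, true) H)) := by
  rw [← (Fin.consEquiv fun _ : Fin (d + 1) => Fin m × Bool).sum_comp F, Fintype.sum_prod_type,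
    Finset.sum_comm]
  refine Finset.sum_congr rfl fun H _ => ?_
  rw [Fintype.sum_prod_type]
  refine Finset.sum_congr rfl fun h _ => ?_
  rw [Fintype.sum_bool, add_comm]
  rfl

theorem sum_add_single_mul {m : ℕ} (a b : ℝ) (x : Fin m) (p q : Fin m → ℝ) :
    ∑ h, ((if x = h then a else 0) + p h) * ((if x = h then b else 0) + q h) =
      a * b + a * q x + b * p x + ∑ h, p h * q h := by
  have : ∀ h, ((if x = h then a else 0) + p h) * ((if x = h then b else 0) + q h) =
      (if x = h then a * b + a * q h + b * p h else 0) + p h * q h := by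
    intro h; split_ifs <;> ring
  simp only [this, Finset.sum_add_distrib, Finset.sum_ite_eq, Finset.mem_univ, if_true]

/-- The squared norm is preserved in expectation: two coordinates in a common bucket interact
through independent signs, which average to zero. -/
theorem sum_sq_sketch {d m : ℕ} (u : Fin d → ℝ) :
    ∑ H : Hash d m, ∑ h, sketch H u h * sketch H u h = (2 * m : ℝ) ^ d * ∑ j, u j ^ 2 := by
  induction d with
  | zero => simp [sketch]
  | succ d ih =>
    rw [sum_hash_succ]
    have : ∀ (H : Hash d m) (x : Fin m),
        (∑ h, sketch (d := d + 1) (Fin.cons (x, false) H) u h *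
          sketch (d := d + 1) (Fin.cons (x, false) H) u h) +
        (∑ h, sketch (d := d + 1) (Fin.cons (x, true) H) u h *
          sketch (d := d + 1) (Fin.cons (x, true) H) u h) =
        2 * u 0 ^ 2 + 2 * ∑ h, sketch H (Fin.tail u) h * sketch H (Fin.tail u) h := by
      intro H x
      simp only [sketch_cons, sum_add_single_mul, sign_false, sign_true]
      ring
    simp only [this, Finset.sum_const, Finset.card_univ, Fintype.card_fin, nsmul_eq_mul,
      Finset.sum_add_distrib, mul_add, ← Finset.mul_sum, ih, Fin.sum_univ_succ, Fintype.card_pi,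
      Fintype.card_prod, Fintype.card_bool, Finset.prod_const, Nat.cast_pow, Nat.cast_mul,
      Nat.cast_ofNat, Fin.tail]
    ring

/-- The second moment of the error of an inner product of sketches. -/
theorem second_moment {d m : ℕ} (u v : Fin d → ℝ) :
    m * ∑ H : Hash d m, (∑ h, sketch H u h * sketch H v h - ∑ j, u j * v j) ^ 2 ≤
      2 * (2 * m : ℝ) ^ d * ((∑ j, u j ^ 2) * ∑ j, v j ^ 2) := by
  induction d with
  | zero => simp [sketch]
  | succ d ih =>
    set su : Hash d m → Fin m → ℝ := fun H => sketch H (Fin.tail u) with hsu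
    set sv : Hash d m → Fin m → ℝ := fun H => sketch H (Fin.tail v) with hsv
    set Y : Hash d m → ℝ := fun H =>
      ∑ h, su H h * sv H h - ∑ j, Fin.tail u j * Fin.tail v j with hY
    set U := ∑ j, Fin.tail u j ^ 2 with hU
    set V := ∑ j, Fin.tail v j ^ 2 with hV
    have hU0 : 0 ≤ U := Finset.sum_nonneg fun _ _ => sq_nonneg _
    have hV0 : 0 ≤ V := Finset.sum_nonneg fun _ _ => sq_nonneg _
    -- Coordinate `0` changes the sketched inner product by `u₀v₀ ± (u₀ · sv x + v₀ · su x)`. The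
    -- first term is exact, and summing over the sign kills the product of the second with the old
    -- error.
    have hstep : ∀ (H : Hash d m) (x : Fin m),
        (∑ h, sketch (d := d + 1) (Fin.cons (x, false) H) u h *
          sketch (d := d + 1) (Fin.cons (x, false) H) v h - ∑ j, u j * v j) ^ 2 +
        (∑ h, sketch (d := d + 1) (Fin.cons (x, true) H) u h *
          sketch (d := d + 1) (Fin.cons (x, true) H) v h - ∑ j, u j * v j) ^ 2 =
        2 * Y H ^ 2 + 2 * (u 0 * sv H x + v 0 * su H x) ^ 2 := by
      intro H x
      simp only [sketch_cons, sum_add_single_mul, sign_false, sign_true, hY, hsu, hsv,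
        Fin.sum_univ_succ, Fin.tail]
      ring
    have hcross : ∑ H : Hash d m, ∑ x : Fin m, (u 0 * sv H x + v 0 * su H x) ^ 2 ≤
        2 * (2 * m : ℝ) ^ d * (u 0 ^ 2 * V + v 0 ^ 2 * U) := by
      calc ∑ H : Hash d m, ∑ x : Fin m, (u 0 * sv H x + v 0 * su H x) ^ 2
          ≤ ∑ H : Hash d m, ∑ x : Fin m,
            (2 * u 0 ^ 2 * (sv H x * sv H x) + 2 * v 0 ^ 2 * (su H x * su H x)) := by
            refine Finset.sum_le_sum fun H _ => Finset.sum_le_sum fun x _ => ?_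
            nlinarith [sq_nonneg (u 0 * sv H x - v 0 * su H x)]
        _ = 2 * u 0 ^ 2 * (∑ H : Hash d m, ∑ x, sv H x * sv H x) +
            2 * v 0 ^ 2 * (∑ H : Hash d m, ∑ x, su H x * su H x) := by
            simp only [Finset.sum_add_distrib, ← Finset.mul_sum]
        _ = _ := by
            rw [hsv, hsu, sum_sq_sketch, sum_sq_sketch]; ring
    have hih := ih (Fin.tail u) (Fin.tail v)
    change (m : ℝ) * ∑ H : Hash d m, Y H ^ 2 ≤ 2 * (2 * m : ℝ) ^ d * (U * V) at hih
    rw [sum_hash_succ]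
    simp only [hstep, Finset.sum_add_distrib, ← Finset.mul_sum, Finset.sum_const,
      Finset.card_univ, Fintype.card_fin, nsmul_eq_mul]
    have e1 : ∑ j, u j ^ 2 = u 0 ^ 2 + U := by simp [Fin.sum_univ_succ, hU, Fin.tail]
    have e2 : ∑ j, v j ^ 2 = v 0 ^ 2 + V := by simp [Fin.sum_univ_succ, hV, Fin.tail]
    rw [e1, e2, pow_succ]
    have hm : (0 : ℝ) ≤ m := Nat.cast_nonneg m
    have hK : 0 ≤ (2 * m : ℝ) ^ d := by positivity
    have h1 := mul_le_mul_of_nonneg_left hih (mul_nonneg zero_le_two hm)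
    have h2 := mul_le_mul_of_nonneg_left hcross (mul_nonneg zero_le_two hm)
    -- The bound obtained so far lacks exactly this term of the expanded product `(u₀² + U)(v₀² +
    -- V)`.
    have h3 : 0 ≤ 4 * m * (2 * m : ℝ) ^ d * (u 0 ^ 2 * v 0 ^ 2) := by positivity
    nlinarith

theorem card_hash (d m : ℕ) : (Fintype.card (Hash d m) : ℝ) = (2 * m : ℝ) ^ d := by
  simp [mul_comm]

/-- The sum of the squared errors of all inner products of sketches of the vectors `z`. -/
noncomputable def gramError {d m : ℕ} {ι : Type*} [Fintype ι] (z : ι → Fin d → ℝ)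
    (H : Hash d m) : ℝ :=
  ∑ a, ∑ b, (∑ h, sketch H (z a) h * sketch H (z b) h - ∑ j, z a j * z b j) ^ 2

/-- Markov's inequality for `gramError`. -/
theorem card_gramError_gt {d m : ℕ} {ι : Type*} [Fintype ι] (z : ι → Fin d → ℝ)
    (hz : ∀ a, ∑ j, z a j ^ 2 ≤ 1) {θ : ℝ} (hθ : 0 < θ)
    (hm : 30 * (Fintype.card ι : ℝ) ^ 2 ≤ m * θ ^ 2) (hm0 : 0 < m) :
    15 * (Set.ncard {H : Hash d m | θ ^ 2 < gramError z H} : ℝ) ≤ Fintype.card (Hash d m) := by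
  classical
  have hsum : m * ∑ H : Hash d m, gramError z H ≤
      2 * (2 * m : ℝ) ^ d * (Fintype.card ι : ℝ) ^ 2 := by
    simp only [gramError]
    rw [Finset.sum_comm, Finset.mul_sum]
    calc ∑ a, (m : ℝ) * ∑ H : Hash d m, ∑ b,
          (∑ h, sketch H (z a) h * sketch H (z b) h - ∑ j, z a j * z b j) ^ 2
        ≤ ∑ a : ι, ∑ b : ι, 2 * (2 * m : ℝ) ^ d := by
          refine Finset.sum_le_sum fun a _ => ?_
          rw [Finset.sum_comm, Finset.mul_sum]
          refine Finset.sum_le_sum fun b _ => ?_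
          refine (second_moment (z a) (z b)).trans ?_
          refine mul_le_of_le_one_right (by positivity) ?_
          exact mul_le_one₀ (hz a) (Finset.sum_nonneg fun _ _ => sq_nonneg _) (hz b)
      _ = _ := by simp; ring
  have hmark : (Set.ncard {H : Hash d m | θ ^ 2 < gramError z H} : ℝ) * θ ^ 2 ≤
      ∑ H : Hash d m, gramError z H := by
    rw [Set.ncard_eq_toFinset_card', ← nsmul_eq_mul]
    refine (Finset.card_nsmul_le_sum _ (gramError z) _ ?_).trans
      (Finset.sum_le_sum_of_subset_of_nonneg (Finset.subset_univ _) ?_)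
    · intro H hH
      simp only [Set.mem_toFinset, Set.mem_ofPred_eq] at hH
      exact hH.le
    · intro H _ _
      exact Finset.sum_nonneg fun _ _ => Finset.sum_nonneg fun _ _ => sq_nonneg _
  rw [card_hash]
  have hmpos : (0 : ℝ) < m := by exact_mod_cast hm0
  have hK : (0 : ℝ) < (2 * m : ℝ) ^ d := by positivity
  have hc : (0 : ℝ) < m * θ ^ 2 := by positivity
  have h1 := mul_le_mul_of_nonneg_left hmark hmpos.le
  have h2 := mul_le_mul_of_nonneg_left hm hK.le
  refine le_of_mul_le_mul_right ?_ hc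
  nlinarith

/-- Independent repetition: a property that fails with probability at most `1 / 15` holds in more
than half of `T` independent trials, up to probability `2⁻ᵀ`. -/
theorem card_majority_bad {X : Type*} [Fintype X] (bad : Set X)
    (hbad : 15 * (bad.ncard : ℝ) ≤ Fintype.card X) (T : ℕ) :
    (2 : ℝ) ^ T * Set.ncard {x : Fin T → X | T ≤ 2 * Set.ncard {t | x t ∈ bad}} ≤
      (Fintype.card X : ℝ) ^ T := by
  classical
  -- An exponential moment argument: the weight `16` has mean at most `1 + 15 · (1/15) = 2`, while a
  -- bad half contributes at least `16 ^ (T/2) = 4 ^ T`. Markov's inequality for the product gives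
  -- `(2/4) ^ T`.
  set f : X → ℝ := fun x => if x ∈ bad then 16 else 1 with hf
  have hf1 : ∀ x, 1 ≤ f x := fun x => by simp only [hf]; split_ifs <;> norm_num
  have hsum : ∑ x, f x ≤ 2 * Fintype.card X := by
    have : ∀ x, f x = 1 + 15 * (if x ∈ bad then 1 else 0) := fun x => by
      simp only [hf]; split_ifs <;> norm_num
    simp only [this, Finset.sum_add_distrib, ← Finset.mul_sum, Finset.sum_boole]
    rw [Set.ncard_eq_toFinset_card'] at hbad
    have e : (Finset.univ.filter fun x => x ∈ bad) = bad.toFinset := by ext; simp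
    rw [e]
    simp only [Finset.sum_const, Finset.card_univ, nsmul_eq_mul, mul_one]
    linarith
  have hpow : ∑ x : Fin T → X, ∏ t, f (x t) = (∑ x, f x) ^ T := by
    rw [Finset.sum_pow']
    simp
  have hmark : (Set.ncard {x : Fin T → X | T ≤ 2 * Set.ncard {t | x t ∈ bad}} : ℝ) * 4 ^ T ≤
      ∑ x : Fin T → X, ∏ t, f (x t) := by
    rw [Set.ncard_eq_toFinset_card', ← nsmul_eq_mul]
    refine (Finset.card_nsmul_le_sum _ (fun x : Fin T → X => ∏ t, f (x t)) _ ?_).trans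
      (Finset.sum_le_sum_of_subset_of_nonneg (Finset.subset_univ _) ?_)
    · intro x hx
      simp only [Set.mem_toFinset, Set.mem_ofPred_eq] at hx
      simp only [hf, Finset.prod_ite, Finset.prod_const, one_pow, mul_one]
      rw [Set.ncard_eq_toFinset_card'] at hx
      have e : ({t | x t ∈ bad} : Set (Fin T)).toFinset =
          Finset.univ.filter fun t => x t ∈ bad := by ext; simp
      rw [e] at hx
      calc (4 : ℝ) ^ T ≤ 4 ^ (2 * (Finset.univ.filter fun t => x t ∈ bad).card) :=
            pow_le_pow_right₀ (by norm_num) hx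
        _ = _ := by rw [pow_mul]; norm_num
    · intro x _ _
      exact Finset.prod_nonneg fun t _ => zero_le_one.trans (hf1 _)
  rw [hpow] at hmark
  have h2 : (∑ x, f x) ^ T ≤ (2 * Fintype.card X : ℝ) ^ T :=
    pow_le_pow_left₀ (Finset.sum_nonneg fun x _ => zero_le_one.trans (hf1 x)) hsum T
  have h3 := hmark.trans h2
  rw [mul_pow, show (4 : ℝ) = 2 * 2 by norm_num, mul_pow] at h3
  have h4 : (0 : ℝ) < 2 ^ T := by positivity
  refine le_of_mul_le_mul_left ?_ h4
  linarith

end CountSketch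

/-! ### Events depending on finitely many coin flips -/

namespace RealRAM

instance : IsProbabilityMeasure coinMeasure := by
  unfold coinMeasure; infer_instance

theorem uniform_bool_singleton (b : Bool) :
    (PMF.uniformOfFintype Bool).toMeasure {b} = 2⁻¹ := by
  rw [PMF.toMeasure_apply_singleton _ _ (MeasurableSet.singleton b)]
  simp

theorem coinMeasure_cylinder (N : ℕ) (z : Fin N → Bool) :
    coinMeasure {ω | (fun q : Fin N => ω q) = z} = (2⁻¹ : ℝ≥0∞) ^ N := by
  classical
  have h : {ω : ℕ → Bool | (fun q : Fin N => ω q) = z} = Set.pi (Finset.range N : Set ℕ)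
      (fun q => if h : q < N then {z ⟨q, h⟩} else Set.univ) := by
    ext ω
    simp only [Set.mem_ofPred_eq, Set.mem_pi, Finset.coe_range, Set.mem_Iio]
    constructor
    · rintro rfl q hq
      simp [hq]
    · intro h
      funext q
      have := h q q.2
      simpa using this
  rw [h, coinMeasure, Measure.infinitePi_pi]
  · rw [Finset.prod_congr rfl (g := fun _ => (2⁻¹ : ℝ≥0∞))]
    · simp
    · intro q hq
      have hq' := Finset.mem_range.1 hq
      simp only [hq', dif_pos]
      exact uniform_bool_singleton _
  · intro q _
    split_ifs
    · exact MeasurableSet.singleton _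
    · exact MeasurableSet.univ

/-- An event that depends on the first `N` coin flips only. -/
theorem coinMeasure_finite (N : ℕ) (E : Set (Fin N → Bool)) :
    coinMeasure {ω | (fun q : Fin N => ω q) ∈ E} = E.ncard * (2⁻¹ : ℝ≥0∞) ^ N := by
  classical
  have h : {ω : ℕ → Bool | (fun q : Fin N => ω q) ∈ E} =
      ⋃ z ∈ E.toFinset, {ω | (fun q : Fin N => ω q) = z} := by
    ext ω; simp
  rw [h, measure_biUnion_finset]
  · simp only [coinMeasure_cylinder, Finset.sum_const, nsmul_eq_mul,
      Set.ncard_eq_toFinset_card']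
  · intro z _ z' _ hzz'
    refine Set.disjoint_left.2 fun ω h1 h2 => hzz' ?_
    exact h1.symm.trans h2
  · intro z _
    have : Measurable fun (ω : ℕ → Bool) (q : Fin N) => ω q := by fun_prop
    exact this (MeasurableSet.singleton z)

end RealRAM

/-! ### Independent uniform hash functions from coin flips -/

namespace RealRAM

/-- The number with binary digits `ω p, ω (p + 1), …, ω (p + b - 1)`. -/
def bitsValue (ω : ℕ → Bool) (p b : ℕ) : ℕ :=
  ∑ x ∈ Finset.range b, 2 ^ x * (ω (p + x)).toNat

theorem bitsValue_succ (ω : ℕ → Bool) (p b : ℕ) :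
    bitsValue ω p (b + 1) = (ω p).toNat + 2 * bitsValue ω (p + 1) b := by
  simp only [bitsValue, Finset.sum_range_succ', Finset.mul_sum]
  rw [add_comm]
  congr 1
  · simp
  · refine Finset.sum_congr rfl fun x _ => ?_
    rw [pow_succ, show p + (x + 1) = p + 1 + x by ring]; ring

theorem bitsValue_lt (ω : ℕ → Bool) (p b : ℕ) : bitsValue ω p b < 2 ^ b := by
  induction b generalizing p with
  | zero => simp [bitsValue]
  | succ b ih =>
    have h1 := ih (p + 1)
    have h2 := Bool.toNat_le (ω p)
    rw [bitsValue_succ, pow_succ]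
    omega

theorem eq_of_bitsValue_eq {ω ω' : ℕ → Bool} {p b : ℕ} (h : bitsValue ω p b = bitsValue ω' p b) :
    ∀ x < b, ω (p + x) = ω' (p + x) := by
  induction b generalizing p with
  | zero => intro x hx; omega
  | succ b ih =>
    rw [bitsValue_succ, bitsValue_succ] at h
    have h1 := Bool.toNat_le (ω p)
    have h2 := Bool.toNat_le (ω' p)
    intro x hx
    rcases x with _ | x
    · have : (ω p).toNat = (ω' p).toNat := by omega
      rw [add_zero]
      revert this
      cases ω p <;> cases ω' p <;> simp
    · have := ih (p := p + 1) (by omega) x (by omega)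
      rwa [show p + (x + 1) = p + 1 + x by ring]

/-- The hash functions read off from the coin flips: coordinate `j` of the `t`-th sketch uses `b`
bits for the bucket and one bit for the sign. -/
def hashOf (ω : ℕ → Bool) (b d t : ℕ) : CountSketch.Hash d (2 ^ b) := fun j =>
  (⟨bitsValue ω ((t * d + j) * (b + 1)) b, bitsValue_lt _ _ _⟩, ω ((t * d + j) * (b + 1) + b))

/-- An infinite extension of finitely many bits. -/
def extendBits {N : ℕ} (z : Fin N → Bool) (q : ℕ) : Bool := if h : q < N then z ⟨q, h⟩ else false

theorem hashIndex_lt {T d b t j x : ℕ} (ht : t < T) (hj : j < d) (hx : x < b + 1) :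
    (t * d + j) * (b + 1) + x < T * d * (b + 1) := by
  have h1 : t * d + j + 1 ≤ T * d := by nlinarith
  nlinarith

theorem hashOf_congr {T d b : ℕ} {ω ω' : ℕ → Bool} (h : ∀ q < T * d * (b + 1), ω q = ω' q)
    {t : ℕ} (ht : t < T) : hashOf ω b d t = hashOf ω' b d t := by
  funext j
  simp only [hashOf, bitsValue, Prod.mk.injEq, Fin.mk.injEq]
  constructor
  · refine Finset.sum_congr rfl fun x hx => ?_
    rw [h _ (hashIndex_lt ht j.2 ((Finset.mem_range.1 hx).trans (Nat.lt_succ_self b)))]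
  · exact h _ (hashIndex_lt ht j.2 (Nat.lt_succ_self b))

/-- Every bit is used: division with remainder of its index, first by `b + 1` and then by `d`, tells
which sketch, coordinate and digit it determines. -/
theorem hashOf_injective (T d b : ℕ) : Function.Injective
    fun (z : Fin (T * d * (b + 1)) → Bool) (t : Fin T) => hashOf (extendBits z) b d t := by
  intro z z' h
  funext q
  set x := (q : ℕ) % (b + 1) with hx
  set y := (q : ℕ) / (b + 1) with hy
  have hq : y * (b + 1) + x = q := Nat.div_add_mod' _ _
  have hxb : x < b + 1 := Nat.mod_lt _ (Nat.succ_pos b)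
  have hyT : y < T * d := Nat.div_lt_of_lt_mul (q.2.trans_eq (mul_comm _ _))
  have hd : 0 < d := Nat.pos_of_ne_zero (by rintro rfl; omega)
  have hyt : y / d < T := Nat.div_lt_of_lt_mul (by rw [mul_comm]; exact hyT)
  have hyj : y % d < d := Nat.mod_lt _ hd
  have h1 := congrFun (congrFun h ⟨y / d, hyt⟩) ⟨y % d, hyj⟩
  simp only [hashOf, Prod.mk.injEq, Fin.mk.injEq, Nat.div_add_mod'] at h1
  have key : extendBits z (y * (b + 1) + x) = extendBits z' (y * (b + 1) + x) := by
    rcases Nat.lt_succ_iff_lt_or_eq.1 hxb with hlt | heq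
    · exact eq_of_bitsValue_eq h1.1 x hlt
    · rw [heq]; exact h1.2
  rw [hq] at key
  simpa [extendBits, q.2] using key

/-- The hash functions are independent and uniformly distributed. -/
theorem coinMeasure_hashOf (T d b : ℕ) (E : Set (Fin T → CountSketch.Hash d (2 ^ b))) :
    coinMeasure {ω | (fun t : Fin T => hashOf ω b d t) ∈ E} =
      E.ncard * (2⁻¹ : ℝ≥0∞) ^ (T * d * (b + 1)) := by
  have hbij : Function.Bijective
      fun (z : Fin (T * d * (b + 1)) → Bool) (t : Fin T) => hashOf (extendBits z) b d t := by
    -- Both sides have `2 ^ (T * d * (b + 1))` elements, so injectivity suffices and uniform bits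
    -- give uniform, independent hash functions.
    rw [Fintype.bijective_iff_injective_and_card]
    refine ⟨hashOf_injective T d b, ?_⟩
    simp only [Fintype.card_pi, Fintype.card_prod, Fintype.card_bool, Fintype.card_fin,
      Finset.prod_const, Finset.card_univ, ← pow_succ, ← pow_mul]
    congr 1; ring
  rw [← Set.ncard_preimage_of_injective_subset_range hbij.injective (s := E)
    (by rw [hbij.surjective.range_eq]; exact Set.subset_univ _), ← coinMeasure_finite]
  congr 1
  ext ω
  simp only [Set.mem_ofPred_eq, Set.mem_preimage]
  have : (fun t : Fin T => hashOf ω b d t) = fun t : Fin T =>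
      hashOf (extendBits fun q : Fin (T * d * (b + 1)) => ω q) b d t := by
    funext t
    exact hashOf_congr (fun q hq => by simp [extendBits, hq]) t.2
  rw [this]

/-- With probability at least `9 / 10`, for each of `n` given families most of the sketches
preserve all inner products up to a small error. -/
theorem most_sketches_good {n d b T : ℕ} {ι : Type*} [Fintype ι] (z : Fin n → ι → Fin d → ℝ)
    (hz : ∀ i a, ∑ j, z i a j ^ 2 ≤ 1) {θ : ℝ} (hθ : 0 < θ)
    (hm : 30 * (Fintype.card ι : ℝ) ^ 2 ≤ (2 ^ b : ℕ) * θ ^ 2) (hT : 10 * n ≤ 2 ^ T) :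
    9 / 10 ≤ coinMeasure {ω | ∀ i, 2 * Set.ncard {t : Fin T |
      θ ^ 2 < CountSketch.gramError (z i) (hashOf ω b d t)} < T} := by
  classical
  set X := CountSketch.Hash d (2 ^ b) with hX
  set bad : Fin n → Set X := fun i => {H | θ ^ 2 < CountSketch.gramError (z i) H} with hbad
  set E : Fin n → Set (Fin T → X) := fun i => {x | T ≤ 2 * Set.ncard {t | x t ∈ bad i}} with hE
  have hcard : (Fintype.card X : ℝ) ^ T = 2 ^ (T * d * (b + 1)) := by
    simp only [hX, Fintype.card_pi, Fintype.card_prod, Fintype.card_bool, Fintype.card_fin,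
      Finset.prod_const, Finset.card_univ, ← pow_succ, ← pow_mul, Nat.cast_pow, Nat.cast_ofNat]
    congr 1; ring
  have hEi : ∀ i, (2 : ℝ) ^ T * (E i).ncard ≤ 2 ^ (T * d * (b + 1)) := by
    intro i
    rw [← hcard]
    exact CountSketch.card_majority_bad (bad i)
      (CountSketch.card_gramError_gt (z i) (hz i) hθ hm (by positivity)) T
  -- Union bound over the rows: each `E i` has proportion at most `2⁻ᵀ`, and `10 n ≤ 2ᵀ`.
  have hU : ((⋃ i, E i).ncard : ℝ) * 10 ≤ 2 ^ (T * d * (b + 1)) := by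
    have h1 : ((⋃ i, E i).ncard : ℝ) ≤ ∑ i, ((E i).ncard : ℝ) := by
      have : (⋃ i, E i).ncard ≤ ∑ i, (E i).ncard := by
        simp only [Set.ncard_eq_toFinset_card']
        refine le_trans (Finset.card_le_card (t := Finset.univ.biUnion fun i => (E i).toFinset) ?_)
          Finset.card_biUnion_le
        intro x; simp
      exact_mod_cast this
    have h2 : (2 : ℝ) ^ T * ∑ i, ((E i).ncard : ℝ) ≤ n * 2 ^ (T * d * (b + 1)) := by
      rw [Finset.mul_sum]
      refine (Finset.sum_le_sum fun i _ => hEi i).trans ?_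
      simp
    have hT' : (10 : ℝ) * n ≤ 2 ^ T := by exact_mod_cast hT
    rcases Nat.eq_zero_or_pos n with rfl | hn
    · simp
    · have hn' : (0 : ℝ) < n := by exact_mod_cast hn
      have h3 : (0 : ℝ) ≤ ((⋃ i, E i).ncard : ℝ) := Nat.cast_nonneg _
      refine le_of_mul_le_mul_left ?_ hn'
      nlinarith
  have hcompl : coinMeasure {ω | (fun t : Fin T => hashOf ω b d t) ∈ ⋃ i, E i} ≤ 1 / 10 := by
    rw [coinMeasure_hashOf]
    have h1 : ((⋃ i, E i).ncard : ℝ≥0∞) * 10 ≤ 2 ^ (T * d * (b + 1)) := by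
      have : (⋃ i, E i).ncard * 10 ≤ 2 ^ (T * d * (b + 1)) := by exact_mod_cast hU
      exact_mod_cast this
    rw [← ENNReal.inv_pow, ← div_eq_mul_inv]
    refine ENNReal.div_le_of_le_mul ?_
    rw [mul_comm, mul_one_div]
    rw [ENNReal.le_div_iff_mul_le (Or.inl (by norm_num)) (Or.inl (by norm_num))]
    exact h1
  have hset : {ω | ∀ i, 2 * Set.ncard {t : Fin T |
      θ ^ 2 < CountSketch.gramError (z i) (hashOf ω b d t)} < T} =
      {ω | (fun t : Fin T => hashOf ω b d t) ∈ ⋃ i, E i}ᶜ := by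
    ext ω
    simp only [hE, hbad, Set.mem_ofPred_eq, Set.mem_compl_iff, Set.mem_iUnion, not_exists]
    exact forall_congr' fun i => not_le.symm
  -- Passing to the complement needs measurability, which holds because only finitely many bits
  -- enter.
  have hmeas : MeasurableSet {ω | (fun t : Fin T => hashOf ω b d t) ∈ ⋃ i, E i} := by
    have h1 : {ω : ℕ → Bool | (fun t : Fin T => hashOf ω b d t) ∈ ⋃ i, E i} =
        (fun (ω : ℕ → Bool) (q : Fin (T * d * (b + 1))) => ω q) ⁻¹'
          {z | (fun t : Fin T => hashOf (extendBits z) b d t) ∈ ⋃ i, E i} := by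
      ext ω
      simp only [Set.mem_ofPred_eq, Set.mem_preimage]
      have : (fun t : Fin T => hashOf ω b d t) = fun t : Fin T =>
          hashOf (extendBits fun q : Fin (T * d * (b + 1)) => ω q) b d t := by
        funext t
        exact hashOf_congr (fun q hq => by simp [extendBits, hq]) t.2
      rw [this]
    rw [h1]
    have : Measurable fun (ω : ℕ → Bool) (q : Fin (T * d * (b + 1))) => ω q := by fun_prop
    exact this (Set.toFinite _).measurableSet
  rw [hset, prob_compl_eq_one_sub hmeas]
  have h9 : (9 / 10 : ℝ≥0∞) = 1 - 1 / 10 := by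
    rw [eq_comm, ENNReal.sub_eq_of_eq_add (by norm_num)]
    rw [← ENNReal.add_div]
    norm_num
    exact (ENNReal.div_self (by norm_num) (by norm_num)).symm
  rw [h9]
  exact tsub_le_tsub_left hcompl 1

end RealRAM

namespace SizeReduction

/-! ## Successive orthogonalization -/

/-- `V p` is the result of `p` steps of the modified Gram–Schmidt process with the columns
`z 0, …, z r` of length `m`; below a column its coefficients in terms of `z 0, …, z r` are
stored. -/
structure IsGramSchmidt (m r : ℕ) (z : ℕ → ℕ → ℝ) (V : ℕ → ℕ → ℕ → ℝ) : Prop where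
  zero_top : ∀ l ≤ r, ∀ h < m, V 0 l h = z l h
  zero_coeff : ∀ l ≤ r, ∀ s ≤ r, V 0 l (m + s) = if s = l then 1 else 0
  step : ∀ p < r, ∀ l ≤ r, ∀ h < m + r + 1, V (p + 1) l h = V p l h -
    if p < l then (∑ x ∈ Finset.range m, V p l x * V p p x) /
      (∑ x ∈ Finset.range m, V p p x * V p p x) * V p p h else 0

namespace IsGramSchmidt

variable {m r : ℕ} {z : ℕ → ℕ → ℝ} {V : ℕ → ℕ → ℕ → ℝ}

/-- Only earlier columns are ever subtracted, so the coefficient matrix stays triangular; with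
`coeff_self` it is unitriangular. -/
theorem coeff_of_gt (hV : IsGramSchmidt m r z V) {p : ℕ} (hp : p ≤ r) :
    ∀ l ≤ r, ∀ s ≤ r, l < s → V p l (m + s) = 0 := by
  induction p with
  | zero => intro l hl s hs hls; rw [hV.zero_coeff l hl s hs, if_neg (by omega)]
  | succ p ih =>
    intro l hl s hs hls
    rw [hV.step p (by omega) l hl _ (by omega), ih (by omega) l hl s hs hls]
    split_ifs with hpl
    · rw [ih (by omega) p (by omega) s hs (by omega)]; simp
    · simp

theorem coeff_self (hV : IsGramSchmidt m r z V) {p : ℕ} (hp : p ≤ r) :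
    ∀ l ≤ r, V p l (m + l) = 1 := by
  induction p with
  | zero => intro l hl; rw [hV.zero_coeff l hl l hl, if_pos rfl]
  | succ p ih =>
    intro l hl
    rw [hV.step p (by omega) l hl _ (by omega), ih (by omega) l hl]
    split_ifs with hpl
    · rw [hV.coeff_of_gt (by omega) p (by omega) l hl hpl]; simp
    · simp

/-- The coefficients start as the identity matrix and undergo the same column operations as the
entries above them, hence they record the combination reached so far. -/
theorem top_eq (hV : IsGramSchmidt m r z V) {p : ℕ} (hp : p ≤ r) :
    ∀ l ≤ r, ∀ h < m, V p l h = ∑ s ∈ Finset.range (r + 1), V p l (m + s) * z s h := by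
  induction p with
  | zero =>
    intro l hl h hh
    rw [hV.zero_top l hl h hh, Finset.sum_eq_single_of_mem l (Finset.mem_range.2 (by omega))]
    · rw [hV.zero_coeff l hl l hl]; simp
    · intro s hs hsl
      rw [hV.zero_coeff l hl s (by have := Finset.mem_range.1 hs; omega), if_neg hsl, zero_mul]
  | succ p ih =>
    intro l hl h hh
    rw [hV.step p (by omega) l hl _ (by omega), ih (by omega) l hl h hh]
    have : ∀ s ∈ Finset.range (r + 1), V (p + 1) l (m + s) * z s h =
        V p l (m + s) * z s h - if p < l then (∑ x ∈ Finset.range m, V p l x * V p p x) /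
          (∑ x ∈ Finset.range m, V p p x * V p p x) * (V p p (m + s) * z s h) else 0 := by
      intro s hs
      have := Finset.mem_range.1 hs
      rw [hV.step p (by omega) l hl _ (by omega)]
      split_ifs <;> ring
    rw [Finset.sum_congr rfl this, Finset.sum_sub_distrib]
    split_ifs
    · rw [← Finset.mul_sum, ih (by omega) p (by omega) h hh]
    · simp

theorem orthogonal (hV : IsGramSchmidt m r z V) {p : ℕ} (hp : p ≤ r) :
    ∀ j < p, ∀ l ≤ r, l ≠ j → ∑ h ∈ Finset.range m, V p j h * V p l h = 0 := by
  induction p with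
  | zero => intro j hj; omega
  | succ p ih =>
    have hstep : ∀ l ≤ r, ∀ h ∈ Finset.range m, V (p + 1) l h = V p l h -
        (if p < l then (∑ x ∈ Finset.range m, V p l x * V p p x) /
          (∑ x ∈ Finset.range m, V p p x * V p p x) else 0) * V p p h := by
      intro l hl h hh
      have := Finset.mem_range.1 hh
      rw [hV.step p (by omega) l hl _ (by omega)]
      split_ifs <;> ring
    have hle : ∀ l ≤ p, ∀ h ∈ Finset.range m, V (p + 1) l h = V p l h := by
      intro l hl h hh
      rw [hstep l (by omega) h hh, if_neg (by omega)]; ring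
    intro j hj l hl hlj
    have hsum : ∑ h ∈ Finset.range m, V (p + 1) j h * V (p + 1) l h =
        (∑ h ∈ Finset.range m, V p j h * V p l h) -
        (if p < l then (∑ x ∈ Finset.range m, V p l x * V p p x) /
          (∑ x ∈ Finset.range m, V p p x * V p p x) else 0) *
            ∑ h ∈ Finset.range m, V p j h * V p p h := by
      rw [Finset.mul_sum, ← Finset.sum_sub_distrib]
      refine Finset.sum_congr rfl fun h hh => ?_
      rw [hle j (by omega) h hh, hstep l hl h hh]; ring
    rw [hsum]
    rcases Nat.lt_succ_iff_lt_or_eq.1 hj with hjp | rfl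
    · rw [ih (by omega) j hjp l hl hlj, ih (by omega) j hjp p (by omega) (by omega)]; simp
    · rcases lt_or_gt_of_ne hlj with hlt | hgt
      · rw [if_neg (by omega)]
        have := ih (by omega) l hlt j (by omega) (by omega)
        simp only [mul_comm (V j l _)] at this
        rw [this]; simp
      · rw [if_pos hgt]
        by_cases h0 : ∑ x ∈ Finset.range m, V j j x * V j j x = 0
        · have hz := (Finset.sum_eq_zero_iff_of_nonneg (fun x _ => mul_self_nonneg (V j j x))).1 h0
          rw [h0, Finset.sum_eq_zero]
          · simp
          · intro x hx
            rw [mul_self_eq_zero.1 (hz x hx), zero_mul]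
        · rw [div_mul_cancel₀ _ h0, sub_eq_zero]
          exact Finset.sum_congr rfl fun x _ => mul_comm _ _

theorem residual_eq (hV : IsGramSchmidt m r z V) {h : ℕ} (hh : h < m) :
    V r r h = z r h + ∑ s ∈ Finset.range r, V r r (m + s) * z s h := by
  rw [hV.top_eq le_rfl r le_rfl h hh, Finset.sum_range_succ, hV.coeff_self le_rfl r le_rfl]
  ring

/-- These are the normal equations of the least squares problem. The process makes the last column
orthogonal to the transformed columns; unitriangularity carries this over to the original ones by
strong induction. -/
theorem residual_orthogonal (hV : IsGramSchmidt m r z V) :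
    ∀ s < r, ∑ h ∈ Finset.range m, z s h * V r r h = 0 := by
  intro s
  induction s using Nat.strong_induction_on with
  | _ s ih =>
    intro hs
    have h1 := hV.orthogonal le_rfl s hs r le_rfl (by omega)
    have h2 : ∀ h ∈ Finset.range m, V r s h =
        z s h + ∑ s' ∈ Finset.range s, V r s (m + s') * z s' h := by
      intro h hh
      rw [hV.top_eq le_rfl s hs.le h (Finset.mem_range.1 hh)]
      rw [← Finset.sum_subset (Finset.range_mono (show s + 1 ≤ r + 1 by omega)),
        Finset.sum_range_succ, hV.coeff_self le_rfl s hs.le]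
      · ring
      · intro s' hs' hs''
        simp only [Finset.mem_range] at hs' hs''
        rw [hV.coeff_of_gt le_rfl s hs.le s' (by omega) (by omega), zero_mul]
    rw [Finset.sum_congr rfl fun h hh => by rw [h2 h hh, add_mul], Finset.sum_add_distrib] at h1
    simp only [Finset.sum_mul] at h1
    rw [Finset.sum_comm (s := Finset.range m)] at h1
    rw [Finset.sum_eq_zero (s := Finset.range s)] at h1
    · simpa using h1
    · intro s' hs'
      have hs'' := Finset.mem_range.1 hs'
      simp only [mul_assoc]
      rw [← Finset.mul_sum, ih s' hs'' (by omega), mul_zero]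

end IsGramSchmidt

/-! ## Least squares in the sketched space -/

/-- Cauchy–Schwarz over pairs of indices: a quadratic form is controlled by the Frobenius norm of
its matrix. -/
theorem sq_sum_sum_mul_le {r : ℕ} (e : Fin r → ℝ) (D : Fin r → Fin r → ℝ) :
    (∑ a, ∑ b, e a * e b * D a b) ^ 2 ≤ (∑ a, e a ^ 2) ^ 2 * ∑ a, ∑ b, D a b ^ 2 := by
  have h := Finset.sum_mul_sq_le_sq_mul_sq (Finset.univ : Finset (Fin r × Fin r))
    (fun x => e x.1 * e x.2) (fun x => D x.1 x.2)
  simp only [Fintype.sum_prod_type] at h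
  refine h.trans_eq ?_
  congr 1
  rw [sq (∑ a, e a ^ 2), Finset.sum_mul_sum]
  simp only [mul_pow]

/-- Here `g` is the sketched basis, `u` the sketched residual and `e` the error of the solution. By
orthogonality the energy `Q` of the fitted part equals its inner product with `u`, which is small
because `g` and `u` are almost orthogonal; near-orthonormality of `g` turns smallness of `Q` into
smallness of `e`. By Pythagoras, the computed squared residual is the squared norm of `u` minus `Q`.
-/
theorem least_squares_error {r m : ℕ} (g : Fin r → Fin m → ℝ) (u : Fin m → ℝ) (e : Fin r → ℝ)
    {θ W : ℝ} (hθ : 0 < θ) (hθ' : θ ≤ 1 / 2) (hW : 0 ≤ W)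
    (horth : ∀ l, ∑ h, g l h * (u h - ∑ l', e l' * g l' h) = 0)
    (hgg : ∑ a, ∑ b, (∑ h, g a h * g b h - if a = b then 1 else 0) ^ 2 ≤ θ ^ 2)
    (hgu : ∑ a, (∑ h, g a h * u h) ^ 2 ≤ (θ * W) ^ 2)
    (huu : |∑ h, u h ^ 2 - W ^ 2| ≤ θ * W ^ 2) :
    ∑ l, e l ^ 2 ≤ (2 * θ * W) ^ 2 ∧
      |Real.sqrt (∑ h, (u h - ∑ l, e l * g l h) ^ 2) - W| ≤ 2 * θ * W := by
  set E := ∑ l, e l ^ 2 with hE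
  set ge : Fin m → ℝ := fun h => ∑ l, e l * g l h with hge
  set Q := ∑ h, ge h ^ 2 with hQ
  have hE0 : 0 ≤ E := Finset.sum_nonneg fun _ _ => sq_nonneg _
  have hQ0 : 0 ≤ Q := Finset.sum_nonneg fun _ _ => sq_nonneg _
  have horth' : ∑ h, ge h * (u h - ge h) = 0 := by
    simp only [hge, Finset.sum_mul]
    rw [Finset.sum_comm]
    refine Finset.sum_eq_zero fun l _ => ?_
    have := horth l
    simp only [mul_assoc]
    rw [← Finset.mul_sum, this, mul_zero]
  have hQu : ∑ h, ge h * u h = Q := by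
    have : ∑ h, ge h * (u h - ge h) = ∑ h, ge h * u h - Q := by
      rw [hQ, ← Finset.sum_sub_distrib]
      exact Finset.sum_congr rfl fun _ _ => by ring
    linarith
  have hQle : Q ^ 2 ≤ E * (θ * W) ^ 2 := by
    have h1 : Q = ∑ l, e l * ∑ h, g l h * u h := by
      rw [← hQu]
      simp only [hge, Finset.sum_mul, Finset.mul_sum, mul_assoc]
      rw [Finset.sum_comm]
    rw [h1]
    exact (Finset.sum_mul_sq_le_sq_mul_sq _ _ _).trans (mul_le_mul_of_nonneg_left hgu hE0)
  have hQge : (1 - θ) * E ≤ Q := by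
    have h1 : Q = E + ∑ a, ∑ b, e a * e b * (∑ h, g a h * g b h - if a = b then 1 else 0) := by
      have h2 : Q = ∑ a, ∑ b, e a * e b * ∑ h, g a h * g b h := by
        simp only [hQ, hge, sq, Finset.sum_mul_sum]
        simp only [Finset.mul_sum]
        rw [Finset.sum_comm]
        refine Finset.sum_congr rfl fun a _ => ?_
        rw [Finset.sum_comm]
        exact Finset.sum_congr rfl fun b _ => Finset.sum_congr rfl fun h _ => by ring
      rw [h2]
      simp only [mul_sub, Finset.sum_sub_distrib, mul_ite, mul_one, mul_zero, Finset.sum_ite_eq,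
        Finset.mem_univ, if_true, hE, sq]
      ring
    have h3 := sq_sum_sum_mul_le e fun a b => ∑ h, g a h * g b h - if a = b then 1 else 0
    have h4 : (∑ a, ∑ b, e a * e b * (∑ h, g a h * g b h - if a = b then 1 else 0)) ^ 2 ≤
        (E * θ) ^ 2 := by
      refine h3.trans ?_
      rw [mul_pow]
      exact mul_le_mul_of_nonneg_left hgg (sq_nonneg _)
    have h5 := (abs_le_of_sq_le_sq' h4 (by positivity)).1
    rw [h1]; linarith
  have hEW : E ≤ (2 * θ * W) ^ 2 := by
    have h1 : E / 2 ≤ Q := by nlinarith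
    have h2 : (E / 2) ^ 2 ≤ E * (θ * W) ^ 2 :=
      (pow_le_pow_left₀ (by positivity) h1 2).trans hQle
    rcases hE0.eq_or_lt with h0 | hpos
    · rw [← h0]; positivity
    · refine le_of_mul_le_mul_left ?_ hpos
      nlinarith
  -- The two bounds combine to `Q ≤ 2θ²W²`, and `θ ≤ 1/2` absorbs the factor `2θ`.
  have hQW : Q ≤ θ * W ^ 2 := by
    have h1 : Q ^ 2 ≤ (2 * θ ^ 2 * W ^ 2) ^ 2 :=
      hQle.trans ((mul_le_mul_of_nonneg_right hEW (sq_nonneg _)).trans_eq (by ring))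
    have h2 := (abs_le_of_sq_le_sq' h1 (by positivity)).2
    nlinarith [sq_nonneg W, mul_nonneg hθ.le (sq_nonneg W)]
  refine ⟨hEW, ?_⟩
  have hres : ∑ h, (u h - ge h) ^ 2 = ∑ h, u h ^ 2 - Q := by
    have : ∑ h, (u h - ge h) ^ 2 = ∑ h, u h ^ 2 - 2 * ∑ h, ge h * u h + Q := by
      rw [hQ, Finset.mul_sum, ← Finset.sum_sub_distrib, ← Finset.sum_add_distrib]
      exact Finset.sum_congr rfl fun _ _ => by ring
    rw [this, hQu]; ring
  set R := Real.sqrt (∑ h, (u h - ge h) ^ 2) with hR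
  have hR0 : 0 ≤ R := Real.sqrt_nonneg _
  have hRsq : R ^ 2 = ∑ h, u h ^ 2 - Q := by
    rw [hR, Real.sq_sqrt (Finset.sum_nonneg fun _ _ => sq_nonneg _), hres]
  have h3 := abs_le.1 huu
  rcases hW.eq_or_lt with h0 | hpos
  · have : R ^ 2 ≤ 0 := by
      rw [hRsq]
      rw [← h0] at h3
      linarith [h3.2]
    have hR' : R = 0 := by nlinarith
    rw [hR', ← h0]; simp
  -- The difference of squares is at most `2θW²`: one `θW²` from the norm distortion of `u`, one
  -- from `Q`. Dividing by `R + W ≥ W` gives the claim.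
  · have h4 : |R - W| * (R + W) ≤ 2 * θ * W ^ 2 := by
      rw [← abs_of_nonneg (show 0 ≤ R + W by linarith), ← abs_mul, abs_le]
      constructor <;> nlinarith
    have h5 : |R - W| * W ≤ 2 * θ * W * W := by
      nlinarith [mul_nonneg (abs_nonneg (R - W)) hR0]
    exact le_of_mul_le_mul_right h5 hpos

/-! ## Medians -/

/-- The number of values that are smaller than the `t`-th value. -/
noncomputable def countBelow (T : ℕ) (y : ℕ → ℝ) (t : ℕ) : ℝ :=
  ∑ t' ∈ Finset.range T, if y t' < y t then 1 else 0

/-- The number of values that are larger than the `t`-th value. -/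
noncomputable def countAbove (T : ℕ) (y : ℕ → ℝ) (t : ℕ) : ℝ :=
  ∑ t' ∈ Finset.range T, if y t < y t' then 1 else 0

/-- The average of the medians of `y 0, …, y (T - 1)`. -/
noncomputable def median (T : ℕ) (y : ℕ → ℝ) : ℝ :=
  (∑ t ∈ Finset.range T, if 2 * countBelow T y t < T + 1 ∧ 2 * countAbove T y t < T + 1
    then y t else 0) /
  ∑ t ∈ Finset.range T, if 2 * countBelow T y t < T + 1 ∧ 2 * countAbove T y t < T + 1
    then 1 else 0

theorem countBelow_eq (T : ℕ) (y : ℕ → ℝ) (t : ℕ) :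
    countBelow T y t = ((Finset.range T).filter fun t' => y t' < y t).card := by
  simp [countBelow]

theorem countAbove_eq (T : ℕ) (y : ℕ → ℝ) (t : ℕ) :
    countAbove T y t = ((Finset.range T).filter fun t' => y t < y t').card := by
  simp [countAbove]

theorem median_nonneg {T : ℕ} {y : ℕ → ℝ} (hy : ∀ t < T, 0 ≤ y t) : 0 ≤ median T y := by
  refine div_nonneg (Finset.sum_nonneg fun t ht => ?_) (Finset.sum_nonneg fun t _ => ?_)
  · split_ifs
    · exact hy t (Finset.mem_range.1 ht)
    · exact le_rfl
  · split_ifs <;> norm_num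

theorem exists_median {T : ℕ} (hT : 0 < T) (y : ℕ → ℝ) :
    ∃ t < T, 2 * ((Finset.range T).filter fun t' => y t' < y t).card ≤ T ∧
      2 * ((Finset.range T).filter fun t' => y t < y t').card ≤ T := by
  set L := (Finset.range T).filter fun t =>
    2 * ((Finset.range T).filter fun t' => y t' < y t).card ≤ T with hL
  have hLne : L.Nonempty := by
    obtain ⟨t, ht, hmin⟩ := Finset.exists_min_image (Finset.range T) y
      ⟨0, Finset.mem_range.2 hT⟩
    refine ⟨t, Finset.mem_filter.2 ⟨ht, ?_⟩⟩
    rw [Finset.filter_false_of_mem fun t' ht' => not_lt.2 (hmin t' ht')]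
    simp
  obtain ⟨t, ht, hmax⟩ := Finset.exists_max_image L y hLne
  rw [hL, Finset.mem_filter] at ht
  refine ⟨t, Finset.mem_range.1 ht.1, ht.2, ?_⟩
  by_contra hcon
  push Not at hcon
  set G := (Finset.range T).filter fun t' => y t < y t' with hG
  have hGne : G.Nonempty := Finset.card_pos.1 (by omega)
  -- If more than half of the values exceeded the largest candidate, the smallest of them would be
  -- no candidate, so more than half would lie below it. These two sets are disjoint and too large
  -- together.
  obtain ⟨t₁, ht₁, hmin⟩ := Finset.exists_min_image G y hGne
  have ht₁' := Finset.mem_filter.1 ht₁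
  have hnot : t₁ ∉ L := fun h => absurd (hmax t₁ h) (not_le.2 ht₁'.2)
  have hcard : T < 2 * ((Finset.range T).filter fun t' => y t' < y t₁).card := by
    by_contra h
    exact hnot (Finset.mem_filter.2 ⟨ht₁'.1, not_lt.1 h⟩)
  have hdisj : Disjoint ((Finset.range T).filter fun t' => y t' < y t₁) G := by
    rw [Finset.disjoint_left]
    intro t' h1 h2
    exact absurd (hmin t' h2) (not_le.2 (Finset.mem_filter.1 h1).2)
  have := Finset.card_le_card (Finset.union_subset (Finset.filter_subset _ _)
    (Finset.filter_subset _ _) : ((Finset.range T).filter fun t' => y t' < y t₁) ∪ G ⊆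
      Finset.range T)
  rw [Finset.card_union_of_disjoint hdisj, Finset.card_range] at this
  omega

/-- A value outside the interval has all good values strictly on one side of it. They form more than
half, so it fails one of the two counting tests. The average is thus taken over values in the
interval, and over at least one by `exists_median`. -/
theorem median_mem {T : ℕ} {y : ℕ → ℝ} {lo hi : ℝ} (bad : Finset ℕ) (hbad : 2 * bad.card < T)
    (hy : ∀ t < T, t ∉ bad → lo ≤ y t ∧ y t ≤ hi) : lo ≤ median T y ∧ median T y ≤ hi := by
  have hvalid : ∀ t < T, 2 * countBelow T y t < T + 1 ∧ 2 * countAbove T y t < T + 1 →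
      lo ≤ y t ∧ y t ≤ hi := by
    rintro t ht ⟨h1, h2⟩
    rw [countBelow_eq] at h1
    rw [countAbove_eq] at h2
    norm_cast at h1 h2
    have hsub : ∀ F : Finset ℕ, F ⊆ Finset.range T → 2 * F.card ≤ T →
        (∀ t' < T, t' ∉ bad → t' ∈ F) → False := by
      intro F hF hF2 h
      have : (Finset.range T) ⊆ bad ∪ F := by
        intro t' ht'
        by_cases hb : t' ∈ bad
        · exact Finset.mem_union_left _ hb
        · exact Finset.mem_union_right _ (h t' (Finset.mem_range.1 ht') hb)
      have h3 := (Finset.card_le_card this).trans (Finset.card_union_le _ _)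
      rw [Finset.card_range] at h3
      omega
    constructor
    · by_contra hlt
      push Not at hlt
      exact hsub _ (Finset.filter_subset _ _) (by omega) fun t' ht' hb =>
        Finset.mem_filter.2 ⟨Finset.mem_range.2 ht', hlt.trans_le (hy t' ht' hb).1⟩
    · by_contra hlt
      push Not at hlt
      exact hsub ((Finset.range T).filter fun t' => y t' < y t) (Finset.filter_subset _ _)
        (by omega) fun t' ht' hb =>
        Finset.mem_filter.2 ⟨Finset.mem_range.2 ht', (hy t' ht' hb).2.trans_lt hlt⟩
  have hpos : 0 < ∑ t ∈ Finset.range T, if 2 * countBelow T y t < T + 1 ∧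
      2 * countAbove T y t < T + 1 then (1 : ℝ) else 0 := by
    obtain ⟨t, ht, h1, h2⟩ := exists_median (show 0 < T by omega) y
    refine Finset.sum_pos' (fun _ _ => by split_ifs <;> norm_num)
      ⟨t, Finset.mem_range.2 ht, ?_⟩
    rw [if_pos]
    · norm_num
    · rw [countBelow_eq, countAbove_eq]
      norm_cast
      omega
  unfold median
  constructor
  · rw [le_div_iff₀ hpos, Finset.mul_sum]
    refine Finset.sum_le_sum fun t ht => ?_
    split_ifs with h
    · simpa using (hvalid t (Finset.mem_range.1 ht) h).1
    · simp
  · rw [div_le_iff₀ hpos, Finset.mul_sum]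
    refine Finset.sum_le_sum fun t ht => ?_
    split_ifs with h
    · simpa using (hvalid t (Finset.mem_range.1 ht) h).2
    · simp

end SizeReduction

namespace SizeReduction

open CountSketch

/-! ## Sketched projections -/

theorem starProjection_eq_sum {d r : ℕ} {P : Submodule ℝ (EuclideanSpace ℝ (Fin d))}
    (B : OrthonormalBasis (Fin r) ℝ P) (a : EuclideanSpace ℝ (Fin d)) :
    P.starProjection a = ∑ l, inner ℝ (B l : EuclideanSpace ℝ (Fin d)) a •
      (B l : EuclideanSpace ℝ (Fin d)) := by
  rw [Submodule.starProjection_apply, B.orthogonalProjectionOnto_apply_eq_sum]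
  simp

theorem infDist_eq_norm_sub {d : ℕ} (P : Submodule ℝ (EuclideanSpace ℝ (Fin d)))
    (a : EuclideanSpace ℝ (Fin d)) :
    Metric.infDist a (P : Set (EuclideanSpace ℝ (Fin d))) = ‖a - P.starProjection a‖ := by
  rw [Submodule.starProjection_minimal, Metric.infDist_eq_iInf]
  simp only [dist_eq_norm]
  rfl

/-- The basis vectors together with the normalized residual of `a`. -/
noncomputable def frame {d r : ℕ} {P : Submodule ℝ (EuclideanSpace ℝ (Fin d))}
    (B : OrthonormalBasis (Fin r) ℝ P) (a : EuclideanSpace ℝ (Fin d)) :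
    Option (Fin r) → Fin d → ℝ
  | some l => fun j => (B l : EuclideanSpace ℝ (Fin d)) j
  | none => ‖a - P.starProjection a‖⁻¹ • fun j => (a - P.starProjection a) j

theorem sum_mul_eq_inner {d : ℕ} (u v : EuclideanSpace ℝ (Fin d)) :
    ∑ j, u j * v j = inner ℝ u v := by
  simp [PiLp.inner_apply, mul_comm]

theorem sum_sq_eq_norm {d : ℕ} (u : EuclideanSpace ℝ (Fin d)) : ∑ j, u j ^ 2 = ‖u‖ ^ 2 := by
  rw [EuclideanSpace.norm_sq_eq]; simp

theorem inner_basis {d r : ℕ} {P : Submodule ℝ (EuclideanSpace ℝ (Fin d))}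
    (B : OrthonormalBasis (Fin r) ℝ P) (l l' : Fin r) :
    inner ℝ (B l : EuclideanSpace ℝ (Fin d)) (B l' : EuclideanSpace ℝ (Fin d)) =
      if l = l' then 1 else 0 := by
  rw [← Submodule.coe_inner]
  exact orthonormal_iff_ite.1 B.orthonormal l l'

theorem inner_basis_residual {d r : ℕ} {P : Submodule ℝ (EuclideanSpace ℝ (Fin d))}
    (B : OrthonormalBasis (Fin r) ℝ P) (a : EuclideanSpace ℝ (Fin d)) (l : Fin r) :
    inner ℝ (B l : EuclideanSpace ℝ (Fin d)) (a - P.starProjection a) = 0 := by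
  rw [real_inner_comm]
  exact P.starProjection_inner_eq_zero a _ (B l).2

/-- Only an inequality, since the normalized residual is `0` when the row lies in `P`. -/
theorem frame_norm_le {d r : ℕ} {P : Submodule ℝ (EuclideanSpace ℝ (Fin d))}
    (B : OrthonormalBasis (Fin r) ℝ P) (a : EuclideanSpace ℝ (Fin d)) (o : Option (Fin r)) :
    ∑ j, frame B a o j ^ 2 ≤ 1 := by
  rcases o with _ | l
  · simp only [frame, Pi.smul_apply, smul_eq_mul, mul_pow, ← Finset.mul_sum]
    rw [sum_sq_eq_norm, ← mul_pow]
    exact pow_le_one₀ (by positivity) inv_mul_le_one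
  · simp only [frame]
    rw [sum_sq_eq_norm, show ‖(B l : EuclideanSpace ℝ (Fin d))‖ = 1 from B.norm_eq_one l]
    norm_num

/-- With `y` the exact coordinates, the sketch of `a` is the sketch of the residual plus the
combination of the sketched basis with coefficients `y`. The computed residual is therefore that of
the pure noise problem with solution `e`, to which `least_squares_error` applies. The sign is due to
Gram–Schmidt subtracting the fitted part. -/
theorem sketch_estimate {d r m : ℕ} {P : Submodule ℝ (EuclideanSpace ℝ (Fin d))}
    (B : OrthonormalBasis (Fin r) ℝ P) (a : EuclideanSpace ℝ (Fin d)) (H : Hash d m)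
    {θ : ℝ} (hθ : 0 < θ) (hθ' : θ ≤ 1 / 2) (hgood : gramError (frame B a) H ≤ θ ^ 2)
    {z : ℕ → ℕ → ℝ} {V : ℕ → ℕ → ℕ → ℝ} (hV : IsGramSchmidt m r z V)
    (hz : ∀ (l : Fin r) (h : Fin m),
      z l h = sketch H (fun j => (B l : EuclideanSpace ℝ (Fin d)) j) h)
    (hzr : ∀ h : Fin m, z r h = sketch H (fun j => a j) h) :
    ∑ l : Fin r, (-V r r (m + l) - inner ℝ (B l : EuclideanSpace ℝ (Fin d)) a) ^ 2 ≤
      (2 * θ * ‖a - P.starProjection a‖) ^ 2 ∧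
    |Real.sqrt (∑ x ∈ Finset.range m, V r r x * V r r x) - ‖a - P.starProjection a‖| ≤
      2 * θ * ‖a - P.starProjection a‖ := by
  set w := a - P.starProjection a with hw
  set W := ‖w‖ with hWdef
  set g : Fin r → Fin m → ℝ :=
    fun l => sketch H (fun j => (B l : EuclideanSpace ℝ (Fin d)) j) with hg
  set u : Fin m → ℝ := sketch H (fun j => w j) with hu
  set y : Fin r → ℝ := fun l => inner ℝ (B l : EuclideanSpace ℝ (Fin d)) a with hy
  set e : Fin r → ℝ := fun l => -V r r (m + l) - y l with he
  set f : Fin m → ℝ := sketch H (frame B a none) with hf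
  have hsa : ∀ h, sketch H (fun j => a j) h = u h + ∑ l, y l * g l h := by
    intro h
    have : (fun j => a j) = (fun j => w j) +
        ∑ l, y l • fun j => (B l : EuclideanSpace ℝ (Fin d)) j := by
      funext j
      have h1 : a = w + ∑ l, y l • (B l : EuclideanSpace ℝ (Fin d)) := by
        rw [hw, starProjection_eq_sum B]; simp [hy]
      conv_lhs => rw [h1]
      simp
    rw [this, sketch_add, sketch_sum]
    simp only [sketch_smul, hu, hg]
  have hres : ∀ h : Fin m, V r r h = u h - ∑ l, e l * g l h := by
    intro h
    rw [hV.residual_eq h.2, Finset.sum_range, hzr, hsa]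
    simp only [hz, he, hg]
    simp only [sub_mul, neg_mul, Finset.sum_sub_distrib, Finset.sum_neg_distrib]
    ring
  have hWf : ∀ h, u h = W * f h := by
    intro h
    rw [hu, hf, ← sketch_smul]
    congr 1
    simp only [frame]
    rw [smul_smul]
    -- If the residual vanishes, its normalization and its sketch are both zero.
    by_cases hW0 : W = 0
    · have : w = 0 := norm_eq_zero.1 hW0
      rw [← hw, this]
      funext j; simp
    · rw [← hw, ← hWdef, mul_inv_cancel₀ hW0, one_smul]
  have hgram : (∑ x, ∑ x', (∑ h, g x h * g x' h - if x = x' then 1 else 0) ^ 2) ≤ θ ^ 2 ∧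
      ∑ x, (∑ h, g x h * f h) ^ 2 ≤ θ ^ 2 ∧
      (∑ h, f h * f h - ∑ j, frame B a none j * frame B a none j) ^ 2 ≤ θ ^ 2 := by
    have h0 : ∀ l, ∑ j, (B l : EuclideanSpace ℝ (Fin d)) j * frame B a none j = 0 := by
      intro l
      have h1 := inner_basis_residual B a l
      rw [← sum_mul_eq_inner] at h1
      have h2 : ∑ j, (B l : EuclideanSpace ℝ (Fin d)) j * frame B a none j =
          ‖a - P.starProjection a‖⁻¹ * ∑ j, (B l : EuclideanSpace ℝ (Fin d)) j *
            (a - P.starProjection a) j := by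
        rw [Finset.mul_sum]
        refine Finset.sum_congr rfl fun j _ => ?_
        simp only [frame, Pi.smul_apply, smul_eq_mul]; ring
      rw [h2, h1, mul_zero]
    have hBB : ∀ l l' : Fin r, ∑ j, (B l : EuclideanSpace ℝ (Fin d)) j *
        (B l' : EuclideanSpace ℝ (Fin d)) j = if l = l' then 1 else 0 := by
      intro l l'
      rw [sum_mul_eq_inner, inner_basis]
    -- The total Gram error splits into the blocks residual–residual, residual–basis, basis–residual
    -- and basis–basis. All are nonnegative, so each inherits the bound.
    have h3 : gramError (frame B a) H =
        ((∑ h, f h * f h - ∑ j, frame B a none j * frame B a none j) ^ 2 +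
          ∑ x, (∑ h, f h * g x h - ∑ j, frame B a none j *
            (B x : EuclideanSpace ℝ (Fin d)) j) ^ 2) +
        ∑ x, ((∑ h, g x h * f h) ^ 2 +
          ∑ x', (∑ h, g x h * g x' h - if x = x' then 1 else 0) ^ 2) := by
      unfold gramError
      rw [Fintype.sum_option, Fintype.sum_option]
      congr 1
      refine Finset.sum_congr rfl fun x _ => ?_
      rw [Fintype.sum_option]
      simp only [← hBB]
      congr 1
      have := h0 x
      change (_ - ∑ j, (B x : EuclideanSpace ℝ (Fin d)) j * frame B a none j) ^ 2 = _
      rw [this, sub_zero]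
      rfl
    rw [h3, Finset.sum_add_distrib] at hgood
    have p1 : 0 ≤ (∑ h, f h * f h - ∑ j, frame B a none j * frame B a none j) ^ 2 := sq_nonneg _
    have p2 : 0 ≤ ∑ x, (∑ h, f h * g x h - ∑ j, frame B a none j *
            (B x : EuclideanSpace ℝ (Fin d)) j) ^ 2 := Finset.sum_nonneg fun _ _ => sq_nonneg _
    have p3 : 0 ≤ ∑ x, (∑ h, g x h * f h) ^ 2 := Finset.sum_nonneg fun _ _ => sq_nonneg _
    have p4 : 0 ≤ ∑ x, ∑ x', (∑ h, g x h * g x' h - if x = x' then 1 else 0) ^ 2 :=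
      Finset.sum_nonneg fun _ _ => Finset.sum_nonneg fun _ _ => sq_nonneg _
    exact ⟨by linarith, by linarith, by linarith⟩
  obtain ⟨h1, h2, h3⟩ := hgram
  have hW0 : 0 ≤ W := norm_nonneg _
  have key := least_squares_error g u e hθ hθ' hW0 ?_ h1 ?_ ?_
  · refine ⟨key.1, ?_⟩
    convert key.2 using 4
    rw [Finset.sum_range]
    refine Finset.sum_congr rfl fun h _ => ?_
    rw [hres h]; ring
  · intro l
    have := hV.residual_orthogonal l l.2
    rw [Finset.sum_range] at this
    simpa only [hres, hz] using this
  · simp only [hWf]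
    have : ∀ x, ∑ h, g x h * (W * f h) = W * ∑ h, g x h * f h := by
      intro x
      rw [Finset.mul_sum]
      exact Finset.sum_congr rfl fun _ _ => by ring
    simp only [this, mul_pow, ← Finset.mul_sum]
    rw [mul_comm (θ ^ 2)]
    exact mul_le_mul_of_nonneg_left h2 (sq_nonneg _)
  · have h4 : ∑ j, frame B a none j * frame B a none j = W⁻¹ ^ 2 * W ^ 2 := by
      simp only [frame, Pi.smul_apply, smul_eq_mul]
      rw [← hw, ← sum_sq_eq_norm, Finset.mul_sum]
      exact Finset.sum_congr rfl fun _ _ => by ring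
    have h5 : ∑ h, u h ^ 2 - W ^ 2 =
        W ^ 2 * (∑ h, f h * f h - ∑ j, frame B a none j * frame B a none j) := by
      rw [h4]
      have h6 : ∑ h, u h ^ 2 = W ^ 2 * ∑ h, f h * f h := by
        rw [Finset.mul_sum]
        exact Finset.sum_congr rfl fun h _ => by rw [hWf]; ring
      rw [h6]
      by_cases hW0 : W = 0
      · rw [hW0]; ring
      · field_simp
    rw [h5, abs_mul, abs_of_nonneg (sq_nonneg W), mul_comm]
    exact mul_le_mul_of_nonneg_right (abs_le_of_sq_le_sq h3 hθ.le) (sq_nonneg _)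

/-! ## From rows to shapes -/

/-- The reverse triangle inequality in the plane, with pairs read as complex numbers. -/
theorem abs_sqrt_sub_sqrt_le (a b a' b' : ℝ) :
    |Real.sqrt (a ^ 2 + b ^ 2) - Real.sqrt (a' ^ 2 + b' ^ 2)| ≤
      Real.sqrt ((a - a') ^ 2 + (b - b') ^ 2) := by
  have h := abs_norm_sub_norm_le ((a : ℂ) + b * Complex.I) ((a' : ℂ) + b' * Complex.I)
  have e : ((a : ℂ) + b * Complex.I) - ((a' : ℂ) + b' * Complex.I) =
      ((a - a' : ℝ) : ℂ) + ((b - b' : ℝ) : ℂ) * Complex.I := by push_cast; ring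
  rw [e] at h
  simpa only [Complex.norm_add_mul_I] using h

theorem norm_sum_basis_sub {d r : ℕ} {P : Submodule ℝ (EuclideanSpace ℝ (Fin d))}
    (B : OrthonormalBasis (Fin r) ℝ P) (x y : Fin r → ℝ) :
    ‖∑ l, x l • (B l : EuclideanSpace ℝ (Fin d)) -
      ∑ l, y l • (B l : EuclideanSpace ℝ (Fin d))‖ ^ 2 = ∑ l, (x l - y l) ^ 2 := by
  rw [← Finset.sum_sub_distrib]
  simp only [← sub_smul]
  rw [← real_inner_self_eq_norm_sq, inner_sum]
  simp only [sum_inner, inner_smul_left, inner_smul_right, inner_basis]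
  refine Finset.sum_congr rfl fun l _ => ?_
  simp [sq]

theorem reducedPreservesShapes_of_close {n d r k : ℕ} {c ε : ℝ} (hc0 : 0 < c) (hc1 : c < 1)
    (hε0 : 0 < ε) (hε1 : ε < 1) (A : Matrix (Fin n) (Fin d) ℝ)
    {P : Submodule ℝ (EuclideanSpace ℝ (Fin d))} (B : OrthonormalBasis (Fin r) ℝ P)
    (hP : PreservesShapes A P k (c * ε)) (x : Fin n → Fin r → ℝ) (v : Fin n → ℝ)
    (h : ∀ i, ∑ l, (x i l - inner ℝ (B l : EuclideanSpace ℝ (Fin d)) (row A i)) ^ 2 +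
      (v i - ‖row A i - P.starProjection (row A i)‖) ^ 2 ≤
        ((1 - c) * ε / 2 * ‖row A i - P.starProjection (row A i)‖) ^ 2) :
    ReducedPreservesShapes A B k ε x v := by
  intro S hS
  obtain ⟨h1, h2⟩ := hP S hS
  set δ := (1 - c) * ε / 2 with hδ
  have hδ0 : 0 ≤ δ := by have := mul_pos (sub_pos.2 hc1) hε0; rw [hδ]; linarith
  set X := ∑ i, Real.sqrt (Metric.infDist (∑ l, x i l • (B l : EuclideanSpace ℝ (Fin d))) S ^ 2 +
    v i ^ 2) with hX
  set Y := ∑ i, Real.sqrt (Metric.infDist (P.starProjection (row A i)) S ^ 2 +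
    Metric.infDist (row A i) (P : Set (EuclideanSpace ℝ (Fin d))) ^ 2) with hY
  set Z := ∑ i, Metric.infDist (row A i) S with hZ
  have hZ0 : 0 ≤ Z := Finset.sum_nonneg fun _ _ => Metric.infDist_nonneg
  have hXY : |X - Y| ≤ δ * Y := by
    rw [hX, hY, ← Finset.sum_sub_distrib, Finset.mul_sum]
    refine (Finset.abs_sum_le_sum_abs _ _).trans (Finset.sum_le_sum fun i _ => ?_)
    refine (abs_sqrt_sub_sqrt_le _ _ _ _).trans ?_
    set W := ‖row A i - P.starProjection (row A i)‖ with hW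
    rw [infDist_eq_norm_sub, ← hW]
    have hlip : |Metric.infDist (∑ l, x i l • (B l : EuclideanSpace ℝ (Fin d))) S -
        Metric.infDist (P.starProjection (row A i)) S| ≤
        ‖∑ l, x i l • (B l : EuclideanSpace ℝ (Fin d)) - P.starProjection (row A i)‖ := by
      rw [← dist_eq_norm, ← Real.dist_eq]
      exact (Metric.lipschitz_infDist_pt S).dist_le_mul _ _ |>.trans_eq (by simp)
    have hsq : (Metric.infDist (∑ l, x i l • (B l : EuclideanSpace ℝ (Fin d))) S -
        Metric.infDist (P.starProjection (row A i)) S) ^ 2 ≤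
        ∑ l, (x i l - inner ℝ (B l : EuclideanSpace ℝ (Fin d)) (row A i)) ^ 2 := by
      rw [← norm_sum_basis_sub B, ← starProjection_eq_sum, ← sq_abs]
      exact pow_le_pow_left₀ (abs_nonneg _) hlip 2
    have hW0 : 0 ≤ W := norm_nonneg _
    calc Real.sqrt _ ≤ Real.sqrt ((δ * W) ^ 2) := Real.sqrt_le_sqrt (by linarith [h i])
      _ = δ * W := Real.sqrt_sq (mul_nonneg hδ0 hW0)
      _ ≤ _ := by
        refine mul_le_mul_of_nonneg_left ?_ hδ0
        refine Real.le_sqrt_of_sq_le ?_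
        linarith [sq_nonneg (Metric.infDist (P.starProjection (row A i)) S)]
  obtain ⟨h3, h4⟩ := abs_le.1 hXY
  have hcε : 0 < c * ε := mul_pos hc0 hε0
  have hcε1 : c * ε < 1 := by nlinarith
  have hδ1 : δ ≤ 1 := by rw [hδ]; nlinarith
  -- One `δ` is spent on the linear error; in the upper bound the second absorbs the product `δ ·
  -- cε`.
  have hδε : c * ε + 2 * δ = ε := by rw [hδ]; ring
  constructor
  · have : (1 - δ) * ((1 - c * ε) * Z) ≤ (1 - δ) * Y :=
      mul_le_mul_of_nonneg_left h1 (by linarith)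
    nlinarith [mul_nonneg (mul_nonneg hδ0 hcε.le) hZ0, mul_nonneg hδ0 hZ0]
  · have : (1 + δ) * Y ≤ (1 + δ) * ((1 + c * ε) * Z) :=
      mul_le_mul_of_nonneg_left h2 (by linarith)
    have h5 : δ * (c * ε) * Z ≤ δ * Z := by
      have := mul_nonneg hδ0 hZ0
      nlinarith
    nlinarith

/-- The medians of estimates most of which are good. -/
theorem medians_close {d r T : ℕ} {P : Submodule ℝ (EuclideanSpace ℝ (Fin d))}
    (B : OrthonormalBasis (Fin r) ℝ P) (a : EuclideanSpace ℝ (Fin d)) {δ : ℝ} (hδ : 0 ≤ δ)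
    (x : ℕ → Fin r → ℝ) (v : ℕ → ℝ) (bad : Finset ℕ) (hbad : 2 * bad.card < T)
    (hx : ∀ t < T, t ∉ bad → ∑ l, (x t l - inner ℝ (B l : EuclideanSpace ℝ (Fin d)) a) ^ 2 ≤
      (δ / (r + 1) * ‖a - P.starProjection a‖) ^ 2)
    (hv : ∀ t < T, t ∉ bad → |v t - ‖a - P.starProjection a‖| ≤
      δ / (r + 1) * ‖a - P.starProjection a‖) :
    ∑ l, (median T (fun t => x t l) - inner ℝ (B l : EuclideanSpace ℝ (Fin d)) a) ^ 2 +
      (median T v - ‖a - P.starProjection a‖) ^ 2 ≤ (δ * ‖a - P.starProjection a‖) ^ 2 := by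
  set W := ‖a - P.starProjection a‖ with hW
  have hW0 : 0 ≤ W := norm_nonneg _
  set η := δ / (r + 1) * W with hη
  have hη0 : 0 ≤ η := by positivity
  have h1 : ∀ l, (median T (fun t => x t l) -
      inner ℝ (B l : EuclideanSpace ℝ (Fin d)) a) ^ 2 ≤ η ^ 2 := by
    intro l
    have := median_mem (T := T) (y := fun t => x t l)
      (lo := inner ℝ (B l : EuclideanSpace ℝ (Fin d)) a - η)
      (hi := inner ℝ (B l : EuclideanSpace ℝ (Fin d)) a + η) bad hbad ?_
    · exact sq_le_sq' (by linarith) (by linarith)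
    · intro t ht htb
      have h2 := (Finset.single_le_sum (f := fun l => (x t l -
        inner ℝ (B l : EuclideanSpace ℝ (Fin d)) a) ^ 2) (fun _ _ => sq_nonneg _)
        (Finset.mem_univ l)).trans (hx t ht htb)
      have h3 := abs_le_of_sq_le_sq' h2 hη0
      constructor <;> linarith
  have h2 : (median T v - W) ^ 2 ≤ η ^ 2 := by
    have := median_mem (T := T) (y := v) (lo := W - η) (hi := W + η) bad hbad ?_
    · exact sq_le_sq' (by linarith) (by linarith)
    · intro t ht htb
      have := abs_le.1 (hv t ht htb)
      constructor <;> linarith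
  calc _ ≤ ∑ _l : Fin r, η ^ 2 + η ^ 2 := add_le_add (Finset.sum_le_sum fun l _ => h1 l) h2
    _ = (r + 1) * η ^ 2 := by simp; ring
    _ ≤ ((r + 1) * η) ^ 2 := by
      have : (0 : ℝ) ≤ r := Nat.cast_nonneg r
      -- Medians are taken coordinate by coordinate, so `r + 1` errors add up; allotting `δ / (r +
      -- 1)` to each is more than enough.
      have h3 : (r : ℝ) + 1 ≤ (r + 1) ^ 2 := by nlinarith
      exact (mul_le_mul_of_nonneg_right h3 (sq_nonneg η)).trans_eq (mul_pow _ η 2).symm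
    _ = _ := by
      rw [hη]; congr 1; field_simp

end SizeReduction

namespace RealRAM

/-! ## Addresses -/

/-- An injective pairing function. -/
def pr (x y : ℕ) : ℕ := (x + y) * (x + y) + y

/-- The value lies between `(x + y)²` and the next square, which determines `x + y` and then `y`.
Only addition and multiplication are needed to compute it, and memory is sparse, so gaps between
addresses cost nothing. -/
theorem pr_inj {x y x' y' : ℕ} : pr x y = pr x' y' ↔ x = x' ∧ y = y' := by
  constructor
  · intro h
    simp only [pr] at h
    have hs : x + y = x' + y' := by
      rcases lt_trichotomy (x + y) (x' + y') with hlt | heq | hgt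
      · nlinarith
      · exact heq
      · nlinarith
    rw [hs] at h
    omega
  · rintro ⟨rfl, rfl⟩; rfl

/-- The pairing function as an expression. -/
def IExp.pair (e f : IExp) : IExp := .add (.mul (.add e f) (.add e f)) f

@[simp] theorem IExp.eval_pair (s : State) (e f : IExp) :
    (IExp.pair e f).eval s = pr (e.eval s) (f.eval s) := rfl

theorem sum_range_eq_ite {n i₀ : ℕ} {F : ℕ → ℝ} (hF : ∀ i, i ≠ i₀ → F i = 0) :
    ∑ i ∈ Finset.range n, F i = if i₀ < n then F i₀ else 0 := by
  split_ifs with h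
  · exact Finset.sum_eq_single_of_mem i₀ (Finset.mem_range.2 h) fun i _ hi => hF i hi
  · refine Finset.sum_eq_zero fun i hi => hF i ?_
    have := Finset.mem_range.1 hi
    omega

/-- When addresses determine the loop indices, at most one iteration contributes to a given cell.
The versions with more indices serve deeper nests. -/
theorem sum_single₁ {n i₀ a : ℕ} {addr : ℕ → ℕ} {g : ℕ → ℝ}
    (h : ∀ i, a = addr i ↔ i = i₀) :
    (∑ i ∈ Finset.range n, Pi.single (addr i) (g i) : ℕ → ℝ) a =
      if i₀ < n then g i₀ else 0 := by
  rw [Finset.sum_apply, sum_range_eq_ite (i₀ := i₀)]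
  · rw [← (h i₀).2 rfl, Pi.single_eq_same]
  · intro i hi
    exact Pi.single_eq_of_ne (fun h' => hi ((h i).1 h')) _

theorem sum_single₂ {n₁ n₂ i₁ i₂ a : ℕ} {addr : ℕ → ℕ → ℕ} {g : ℕ → ℕ → ℝ}
    (h : ∀ x y, a = addr x y ↔ x = i₁ ∧ y = i₂) :
    (∑ x ∈ Finset.range n₁, ∑ y ∈ Finset.range n₂, Pi.single (addr x y) (g x y) : ℕ → ℝ) a =
      if i₁ < n₁ ∧ i₂ < n₂ then g i₁ i₂ else 0 := by
  rw [Finset.sum_apply, sum_range_eq_ite (i₀ := i₁), ite_and]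
  · congr 1
    exact sum_single₁ fun y => by rw [h]; simp
  · intro x hx
    rw [Finset.sum_apply]
    exact Finset.sum_eq_zero fun y _ => Pi.single_eq_of_ne (fun h' => hx ((h x y).1 h').1) _

theorem sum_single₃ {n₁ n₂ n₃ i₁ i₂ i₃ a : ℕ} {addr : ℕ → ℕ → ℕ → ℕ} {g : ℕ → ℕ → ℕ → ℝ}
    (h : ∀ x y z, a = addr x y z ↔ x = i₁ ∧ y = i₂ ∧ z = i₃) :
    (∑ x ∈ Finset.range n₁, ∑ y ∈ Finset.range n₂, ∑ z ∈ Finset.range n₃,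
      Pi.single (addr x y z) (g x y z) : ℕ → ℝ) a =
      if i₁ < n₁ ∧ i₂ < n₂ ∧ i₃ < n₃ then g i₁ i₂ i₃ else 0 := by
  rw [Finset.sum_apply, sum_range_eq_ite (i₀ := i₁), ite_and]
  · congr 1
    exact sum_single₂ fun y z => by rw [h]; simp
  · intro x hx
    simp only [Finset.sum_apply]
    exact Finset.sum_eq_zero fun y _ => Finset.sum_eq_zero fun z _ =>
      Pi.single_eq_of_ne (fun h' => hx ((h x y z).1 h').1) _

theorem sum_single₄ {n₁ n₂ n₃ n₄ i₁ i₂ i₃ i₄ a : ℕ} {addr : ℕ → ℕ → ℕ → ℕ → ℕ}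
    {g : ℕ → ℕ → ℕ → ℕ → ℝ}
    (h : ∀ x y z w, a = addr x y z w ↔ x = i₁ ∧ y = i₂ ∧ z = i₃ ∧ w = i₄) :
    (∑ x ∈ Finset.range n₁, ∑ y ∈ Finset.range n₂, ∑ z ∈ Finset.range n₃,
      ∑ w ∈ Finset.range n₄, Pi.single (addr x y z w) (g x y z w) : ℕ → ℝ) a =
      if i₁ < n₁ ∧ i₂ < n₂ ∧ i₃ < n₃ ∧ i₄ < n₄ then g i₁ i₂ i₃ i₄ else 0 := by
  rw [Finset.sum_apply, sum_range_eq_ite (i₀ := i₁), ite_and]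
  · congr 1
    exact sum_single₃ fun y z w => by rw [h]; simp
  · intro x hx
    simp only [Finset.sum_apply]
    exact Finset.sum_eq_zero fun y _ => Finset.sum_eq_zero fun z _ =>
      Finset.sum_eq_zero fun w _ =>
      Pi.single_eq_of_ne (fun h' => hx ((h x y z w).1 h').1) _

theorem ite_single (c : Prop) [Decidable c] (a : ℕ) (v : ℝ) :
    (if c then (Pi.single a v : ℕ → ℝ) else 0) = Pi.single a (if c then v else 0) := by
  split_ifs <;> simp

theorem sum_single_same {ι : Type*} (S : Finset ι) (a : ℕ) (g : ι → ℝ) :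
    (∑ x ∈ S, Pi.single a (g x) : ℕ → ℝ) = Pi.single a (∑ x ∈ S, g x) := by
  ext y
  by_cases hy : y = a
  · subst hy; simp [Finset.sum_apply]
  · simp [Finset.sum_apply, hy]

/-! ## The loop nests of the algorithm -/

namespace Algorithm

/-- The integer variable stored in cell `0` of the array `a`. -/
def iv (a : ℕ) : IExp := .get a (.lit 0)

/-- The `x`-th number of the input. -/
def par (x : ℕ) : IExp := .get 0 (.lit x)

/-- The position of coordinate `j` of sketch `t` among all coordinates of sketches. -/
def posE (t j : IExp) : IExp := .add (.mul t (par 1)) j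

/-- The bucket of coordinate `j` in sketch `t`. -/
def bucketE (t j : IExp) : IExp := .get 9 (posE t j)

/-- The sign of coordinate `j` in sketch `t`. -/
def signE (t j : IExp) : RExp :=
  .sub (.ofInt (.lit 1)) (.mul (.ofInt (.lit 2))
    (.ofInt (.get 8 (.add (.mul (posE t j) (.add (iv 4) (.lit 1))) (iv 4)))))

/-- The address of entry `h` of column `l` for row `i` and sketch `t`. -/
def colE (t i l h : IExp) : IExp := .pair (.pair (.pair t i) l) h

/-- The address with the three indices `x, y, z`. -/
def tripleE (x y z : IExp) : IExp := .pair (.pair x y) z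

/-- The number of columns. -/
def widthE : IExp := .add (par 3) (.lit 1)

/-- The length of a column together with its coefficients. -/
def heightE : IExp := .add (iv 3) widthE

/-- Sketches of the basis vectors, to array `5`. -/
def sketchBasis : Nest :=
  .loop 10 (iv 5) (.loop 14 (par 1) (.loop 12 (par 3)
    (.add (tripleE (iv 10) (iv 12) (bucketE (iv 10) (iv 14)))
      (.mul (signE (iv 10) (iv 14)) (.get 2 (.add (.mul (iv 14) (par 3)) (iv 12)))))))

/-- Sketches of the rows, to array `6`. -/
def sketchRows : Nest :=
  .loop 15 (par 4) (.loop 10 (iv 5)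
    (.add (tripleE (iv 10) (.get 1 (iv 15)) (bucketE (iv 10) (.get 2 (iv 15))))
      (.mul (signE (iv 10) (.get 2 (iv 15))) (.get 1 (iv 15)))))

/-- The first columns, to array `7`. -/
def copyBasis : Nest :=
  .loop 10 (iv 5) (.loop 11 (par 0) (.loop 12 (par 3) (.loop 13 (iv 3)
    (.add (colE (iv 10) (iv 11) (iv 12) (iv 13)) (.get 5 (tripleE (iv 10) (iv 12) (iv 13)))))))

/-- The last column, to array `7`. -/
def copyRows : Nest :=
  .loop 10 (iv 5) (.loop 11 (par 0) (.loop 13 (iv 3)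
    (.add (colE (iv 10) (iv 11) (par 3) (iv 13)) (.get 6 (tripleE (iv 10) (iv 11) (iv 13))))))

/-- The initial coefficients, to array `7`. -/
def initCoeff : Nest :=
  .loop 10 (iv 5) (.loop 11 (par 0) (.loop 12 widthE
    (.add (colE (iv 10) (iv 11) (iv 12) (.add (iv 3) (iv 12))) (.ofInt (.lit 1)))))

/-- Inner products with the pivot column, to array `8`. -/
def dots : Nest :=
  .loop 10 (iv 5) (.loop 11 (par 0) (.loop 12 widthE (.loop 13 (iv 3)
    (.add (colE (iv 10) (iv 11) (iv 12) (iv 16))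
      (.mul (.get 7 (colE (iv 10) (iv 11) (iv 12) (iv 13)))
        (.get 7 (colE (iv 10) (iv 11) (iv 16) (iv 13))))))))

/-- Multiples of the pivot column, to array `9`. -/
def multiples : Nest :=
  .loop 10 (iv 5) (.loop 11 (par 0) (.loop 12 widthE (.loop 13 heightE
    (.guard (.ilt (iv 16) (iv 12))
      (.add (.pair (colE (iv 10) (iv 11) (iv 12) (iv 13)) (iv 16))
        (.mul (.div (.get 8 (colE (iv 10) (iv 11) (iv 12) (iv 16)))
          (.get 8 (colE (iv 10) (iv 11) (iv 16) (iv 16))))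
          (.get 7 (colE (iv 10) (iv 11) (iv 16) (iv 13)))))))))

/-- Subtraction of these multiples, to array `7`. -/
def subtract : Nest :=
  .loop 10 (iv 5) (.loop 11 (par 0) (.loop 12 widthE (.loop 13 heightE
    (.add (colE (iv 10) (iv 11) (iv 12) (iv 13))
      (.sub (.ofInt (.lit 0)) (.get 9 (.pair (colE (iv 10) (iv 11) (iv 12) (iv 13)) (iv 16))))))))

/-- The estimates of the coordinates, to array `10`. -/
def estimates : Nest :=
  .loop 10 (iv 5) (.loop 11 (par 0) (.loop 12 (par 3)
    (.add (tripleE (iv 11) (iv 12) (iv 10))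
      (.sub (.ofInt (.lit 0)) (.get 7 (colE (iv 10) (iv 11) (par 3) (.add (iv 3) (iv 12))))))))

/-- The squared norms of the residuals, to array `11`. -/
def squaredNorms : Nest :=
  .loop 10 (iv 5) (.loop 11 (par 0) (.loop 13 (iv 3)
    (.add (.pair (iv 10) (iv 11))
      (.mul (.get 7 (colE (iv 10) (iv 11) (par 3) (iv 13)))
        (.get 7 (colE (iv 10) (iv 11) (par 3) (iv 13)))))))

/-- The norms of the residuals, to array `10`. -/
def norms : Nest :=
  .loop 10 (iv 5) (.loop 11 (par 0)
    (.add (tripleE (iv 11) (par 3) (iv 10)) (.sqrt (.get 11 (.pair (iv 10) (iv 11))))))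

/-- The numbers of smaller estimates, to array `12`. -/
def smaller : Nest :=
  .loop 11 (par 0) (.loop 12 widthE (.loop 10 (iv 5) (.loop 18 (iv 5)
    (.guard (.rlt (.get 10 (tripleE (iv 11) (iv 12) (iv 18)))
        (.get 10 (tripleE (iv 11) (iv 12) (iv 10))))
      (.add (tripleE (iv 11) (iv 12) (iv 10)) (.ofInt (.lit 1)))))))

/-- The numbers of larger estimates, to array `13`. -/
def larger : Nest :=
  .loop 11 (par 0) (.loop 12 widthE (.loop 10 (iv 5) (.loop 18 (iv 5)
    (.guard (.rlt (.get 10 (tripleE (iv 11) (iv 12) (iv 10)))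
        (.get 10 (tripleE (iv 11) (iv 12) (iv 18))))
      (.add (tripleE (iv 11) (iv 12) (iv 10)) (.ofInt (.lit 1)))))))

/-- The test whether an estimate is a median. -/
def guardMedian (p : Nest) : Nest :=
  .guard (.rlt (.mul (.ofInt (.lit 2)) (.get 12 (tripleE (iv 11) (iv 12) (iv 10))))
      (.ofInt (.add (iv 5) (.lit 1))))
    (.guard (.rlt (.mul (.ofInt (.lit 2)) (.get 13 (tripleE (iv 11) (iv 12) (iv 10))))
      (.ofInt (.add (iv 5) (.lit 1)))) p)

/-- The sums of the medians, to array `14`. -/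
def medianSum : Nest :=
  .loop 11 (par 0) (.loop 12 widthE (.loop 10 (iv 5)
    (guardMedian (.add (.pair (iv 11) (iv 12)) (.get 10 (tripleE (iv 11) (iv 12) (iv 10)))))))

/-- The numbers of medians, to array `15`. -/
def medianCount : Nest :=
  .loop 11 (par 0) (.loop 12 widthE (.loop 10 (iv 5)
    (guardMedian (.add (.pair (iv 11) (iv 12)) (.ofInt (.lit 1))))))

/-- The output vectors, to array `3`. -/
def writeVec : Nest :=
  .loop 11 (par 0) (.loop 12 (par 3)
    (.add (.add (.mul (iv 11) (par 3)) (iv 12))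
      (.div (.get 14 (.pair (iv 11) (iv 12))) (.get 15 (.pair (iv 11) (iv 12))))))

/-- The output values, to array `4`. -/
def writeVal : Nest :=
  .loop 11 (par 0)
    (.add (iv 11) (.div (.get 14 (.pair (iv 11) (par 3))) (.get 15 (.pair (iv 11) (par 3)))))

/-- What the loop nests need to know about the integer memory. -/
structure Ready (ω : ℕ → Bool) (n d r b T : ℕ) (L : List (ℕ × ℕ)) (s : State) : Prop where
  numRows : s.ints 0 0 = n
  numCols : s.ints 0 1 = d
  rank : s.ints 0 3 = r
  length : s.ints 0 4 = L.length
  rows : ∀ e, s.ints 1 e = (L.map Prod.fst).getD e 0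
  cols : ∀ e, s.ints 2 e = (L.map Prod.snd).getD e 0
  buckets : s.ints 3 0 = 2 ^ b
  bits : s.ints 4 0 = b
  trials : s.ints 5 0 = T
  counters : ∀ c, 10 ≤ c → s.ints c 0 = 0
  bucket : ∀ t < T, ∀ j < d, s.ints 9 (t * d + j) = bitsValue ω ((t * d + j) * (b + 1)) b
  sign : ∀ t < T, ∀ j < d,
    s.ints 8 ((t * d + j) * (b + 1) + b) = (ω ((t * d + j) * (b + 1) + b)).toNat

theorem Ready.congr {ω : ℕ → Bool} {n d r b T : ℕ} {L : List (ℕ × ℕ)} {s s' : State}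
    (h : Ready ω n d r b T L s) (hs : s'.ints = s.ints) : Ready ω n d r b T L s' := by
  cases h
  constructor <;> rw [hs] <;> assumption

/-! ### What each loop nest adds to a given cell -/

section cells

variable {ω : ℕ → Bool} {n d r b T : ℕ} {L : List (ℕ × ℕ)} {s : State}

attribute [local simp] Nest.delta iv par posE bucketE signE colE tripleE widthE heightE
  IExp.eval RExp.eval Test.holds State.setInt_ints

theorem sketchBasis_cell (hs : Ready ω n d r b T L s) {t l : ℕ} (ht : t < T) (hl : l < r)
    (h : ℕ) : sketchBasis.delta s (pr (pr t l) h) = ∑ j ∈ Finset.range d,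
      if bitsValue ω ((t * d + j) * (b + 1)) b = h then
        CountSketch.sign (ω ((t * d + j) * (b + 1) + b)) * s.reals 2 (j * r + l) else 0 := by
  simp [sketchBasis, hs.numCols, hs.rank, hs.trials, hs.bits, -Finset.sum_apply]
  rw [Finset.sum_apply, sum_range_eq_ite (i₀ := t), if_pos ht, Finset.sum_apply]
  · refine Finset.sum_congr rfl fun j hj => ?_
    have hj' := Finset.mem_range.1 hj
    rw [Finset.sum_apply, sum_range_eq_ite (i₀ := l), if_pos hl, hs.bucket t ht j hj',
      hs.sign t ht j hj', Pi.single_apply, CountSketch.sign]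
    · simp [pr_inj, eq_comm]
    · intro l' hl'
      rw [Pi.single_apply, if_neg]
      simp [pr_inj, Ne.symm hl']
  · intro t' ht'
    simp [Finset.sum_apply, pr_inj, Ne.symm ht']

theorem sketchRows_cell (hs : Ready ω n d r b T L s) (hL : ∀ e ∈ L, e.2 < d) {t : ℕ} (ht : t < T)
    (i h : ℕ) : sketchRows.delta s (pr (pr t i) h) = ∑ e ∈ Finset.range L.length,
      if (L.map Prod.fst).getD e 0 = i ∧
        bitsValue ω ((t * d + (L.map Prod.snd).getD e 0) * (b + 1)) b = h then
        CountSketch.sign (ω ((t * d + (L.map Prod.snd).getD e 0) * (b + 1) + b)) * s.reals 1 e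
      else 0 := by
  simp [sketchRows, hs.numCols, hs.length, hs.trials, hs.bits, -Finset.sum_apply,
    hs.rows, hs.cols, -List.getD_eq_getElem?_getD]
  rw [Finset.sum_apply]
  refine Finset.sum_congr rfl fun e he => ?_
  have he' := Finset.mem_range.1 he
  have hd : (L.map Prod.snd).getD e 0 < d := by
    have : (L.map Prod.snd).getD e 0 = (L[e]).2 := by
      simp [he']
    rw [this]
    exact hL _ (List.getElem_mem he')
  rw [Finset.sum_apply, sum_range_eq_ite (i₀ := t), if_pos ht, hs.bucket t ht _ hd,
    hs.sign t ht _ hd, Pi.single_apply, CountSketch.sign]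
  · refine if_congr ?_ rfl rfl
    rw [pr_inj, pr_inj]
    constructor
    · rintro ⟨⟨-, h1⟩, h2⟩; exact ⟨h1.symm, h2.symm⟩
    · rintro ⟨h1, h2⟩; exact ⟨⟨rfl, h1.symm⟩, h2.symm⟩
  · intro t' ht'
    rw [Pi.single_apply, if_neg]
    rw [pr_inj, pr_inj]
    exact fun h => ht' h.1.1.symm

theorem copyBasis_cell (hs : Ready ω n d r b T L s) (t i l h : ℕ) :
    copyBasis.delta s (pr (pr (pr t i) l) h) =
      if t < T ∧ i < n ∧ l < r ∧ h < 2 ^ b then s.reals 5 (pr (pr t l) h) else 0 := by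
  simp [copyBasis, hs.numRows, hs.rank, hs.trials, hs.buckets, -Finset.sum_apply]
  refine sum_single₄ fun x y z w => ?_
  simp [pr_inj, and_assoc, eq_comm]

theorem copyRows_cell (hs : Ready ω n d r b T L s) (t i l h : ℕ) :
    copyRows.delta s (pr (pr (pr t i) l) h) =
      if (t < T ∧ i < n ∧ h < 2 ^ b) ∧ l = r then s.reals 6 (pr (pr t i) h) else 0 := by
  simp [copyRows, hs.numRows, hs.rank, hs.trials, hs.buckets, -Finset.sum_apply]
  by_cases hl : l = r
  · subst hl
    refine (sum_single₃ (i₁ := t) (i₂ := i) (i₃ := h) fun x y z => ?_).trans ?_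
    · simp [pr_inj, and_assoc, eq_comm]
    · simp
  · simp [Finset.sum_apply, pr_inj, hl]

theorem initCoeff_cell (hs : Ready ω n d r b T L s) (t i l h : ℕ) :
    initCoeff.delta s (pr (pr (pr t i) l) h) =
      if (t < T ∧ i < n ∧ l < r + 1) ∧ h = 2 ^ b + l then 1 else 0 := by
  simp [initCoeff, hs.numRows, hs.rank, hs.trials, hs.buckets, -Finset.sum_apply]
  by_cases hl : h = 2 ^ b + l
  · subst hl
    refine (sum_single₃ (i₁ := t) (i₂ := i) (i₃ := l) fun x y z => ?_).trans ?_
    · simp only [pr_inj, and_assoc, eq_comm (a := t), eq_comm (a := i), eq_comm (a := l)]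
      constructor
      · rintro ⟨h1, h2, h3, -⟩; exact ⟨h1, h2, h3⟩
      · rintro ⟨h1, h2, h3⟩; exact ⟨h1, h2, h3, by rw [h3]⟩
    · simp
  · rw [if_neg (fun h => hl h.2)]
    simp only [Finset.sum_apply, Pi.single_apply, pr_inj]
    refine Finset.sum_eq_zero fun x _ => Finset.sum_eq_zero fun y _ =>
      Finset.sum_eq_zero fun z _ => if_neg ?_
    rintro ⟨⟨-, h1⟩, h2⟩
    exact hl (by rw [h2, h1])

/-- The innermost index does not occur in the address, so its contributions accumulate to an inner
product. -/
theorem dots_cell (hs : Ready ω n d r b T L s) (t i l : ℕ) {p : ℕ} :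
    dots.delta (s.setInt 16 0 p) (pr (pr (pr t i) l) p) =
      if t < T ∧ i < n ∧ l < r + 1 then ∑ h ∈ Finset.range (2 ^ b),
        s.reals 7 (pr (pr (pr t i) l) h) * s.reals 7 (pr (pr (pr t i) p) h) else 0 := by
  simp [dots, hs.numRows, hs.rank, hs.trials, hs.buckets, -Finset.sum_apply, sum_single_same]
  refine (sum_single₃ (i₁ := t) (i₂ := i) (i₃ := l) fun x y z => ?_).trans ?_
  · simp [pr_inj, and_assoc, eq_comm]
  · simp

/-- The pivot index is the last component of the address, so different steps write to disjoint cells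
and scratch arrays never have to be cleared. -/
theorem dots_cell_of_ne (s : State) (y : ℕ) {p q : ℕ} (hpq : q ≠ p) :
    dots.delta (s.setInt 16 0 p) (pr y q) = 0 := by
  simp [dots, -Finset.sum_apply, sum_single_same]
  simp [Finset.sum_apply, pr_inj, hpq]

theorem multiples_cell (hs : Ready ω n d r b T L s) (t i l h : ℕ) {p : ℕ} :
    multiples.delta (s.setInt 16 0 p) (pr (pr (pr (pr t i) l) h) p) =
      if t < T ∧ i < n ∧ l < r + 1 ∧ h < 2 ^ b + (r + 1) then
        if p < l then s.reals 8 (pr (pr (pr t i) l) p) / s.reals 8 (pr (pr (pr t i) p) p) *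
          s.reals 7 (pr (pr (pr t i) p) h) else 0
      else 0 := by
  simp [multiples, hs.numRows, hs.rank, hs.trials, hs.buckets, -Finset.sum_apply, ite_single]
  refine (sum_single₄ (i₁ := t) (i₂ := i) (i₃ := l) (i₄ := h) fun x y z w => ?_).trans ?_
  · simp [pr_inj, and_assoc, eq_comm]
  · simp

theorem multiples_cell_of_ne (s : State) (y : ℕ) {p q : ℕ} (hpq : q ≠ p) :
    multiples.delta (s.setInt 16 0 p) (pr y q) = 0 := by
  simp [multiples, -Finset.sum_apply, ite_single]
  simp [Finset.sum_apply, pr_inj, hpq]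

theorem subtract_cell (hs : Ready ω n d r b T L s) (t i l h : ℕ) {p : ℕ} :
    subtract.delta (s.setInt 16 0 p) (pr (pr (pr t i) l) h) =
      if t < T ∧ i < n ∧ l < r + 1 ∧ h < 2 ^ b + (r + 1) then
        -s.reals 9 (pr (pr (pr (pr t i) l) h) p) else 0 := by
  simp [subtract, hs.numRows, hs.rank, hs.trials, hs.buckets, -Finset.sum_apply]
  refine (sum_single₄ (i₁ := t) (i₂ := i) (i₃ := l) (i₄ := h) fun x y z w => ?_).trans ?_
  · simp [pr_inj, and_assoc, eq_comm]
  · simp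

theorem estimates_cell (hs : Ready ω n d r b T L s) (t i l : ℕ) :
    estimates.delta s (pr (pr i l) t) =
      if t < T ∧ i < n ∧ l < r then -s.reals 7 (pr (pr (pr t i) r) (2 ^ b + l)) else 0 := by
  simp [estimates, hs.numRows, hs.rank, hs.trials, hs.buckets, -Finset.sum_apply]
  refine sum_single₃ fun x y z => ?_
  simp only [pr_inj, eq_comm (a := t), eq_comm (a := i), eq_comm (a := l)]
  tauto

theorem squaredNorms_cell (hs : Ready ω n d r b T L s) (t i : ℕ) :
    squaredNorms.delta s (pr t i) = if t < T ∧ i < n then ∑ h ∈ Finset.range (2 ^ b),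
      s.reals 7 (pr (pr (pr t i) r) h) * s.reals 7 (pr (pr (pr t i) r) h) else 0 := by
  simp [squaredNorms, hs.numRows, hs.rank, hs.trials, hs.buckets, -Finset.sum_apply,
    sum_single_same]
  refine sum_single₂ fun x y => ?_
  simp [pr_inj, eq_comm]

theorem norms_cell (hs : Ready ω n d r b T L s) (t i l : ℕ) :
    norms.delta s (pr (pr i l) t) =
      if (t < T ∧ i < n) ∧ l = r then Real.sqrt (s.reals 11 (pr t i)) else 0 := by
  simp [norms, hs.numRows, hs.rank, hs.trials, -Finset.sum_apply]
  by_cases hl : l = r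
  · subst hl
    refine (sum_single₂ (i₁ := t) (i₂ := i) fun x y => ?_).trans ?_
    · simp only [pr_inj, eq_comm (a := t), eq_comm (a := i)]
      tauto
    · simp
  · simp [Finset.sum_apply, pr_inj, hl]

theorem smaller_cell (hs : Ready ω n d r b T L s) (t i l : ℕ) :
    smaller.delta s (pr (pr i l) t) = if i < n ∧ l < r + 1 ∧ t < T then
      SizeReduction.countBelow T (fun t => s.reals 10 (pr (pr i l) t)) t else 0 := by
  unfold SizeReduction.countBelow
  simp [smaller, hs.numRows, hs.rank, hs.trials, -Finset.sum_apply, ite_single,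
    sum_single_same, -Finset.sum_boole]
  refine (sum_single₃ (i₁ := i) (i₂ := l) (i₃ := t) fun x y z => ?_).trans ?_
  · simp [pr_inj, and_assoc, eq_comm]
  · simp

theorem larger_cell (hs : Ready ω n d r b T L s) (t i l : ℕ) :
    larger.delta s (pr (pr i l) t) = if i < n ∧ l < r + 1 ∧ t < T then
      SizeReduction.countAbove T (fun t => s.reals 10 (pr (pr i l) t)) t else 0 := by
  unfold SizeReduction.countAbove
  simp [larger, hs.numRows, hs.rank, hs.trials, -Finset.sum_apply, ite_single,
    sum_single_same, -Finset.sum_boole]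
  refine (sum_single₃ (i₁ := i) (i₂ := l) (i₃ := t) fun x y z => ?_).trans ?_
  · simp [pr_inj, and_assoc, eq_comm]
  · simp

theorem medianSum_cell (hs : Ready ω n d r b T L s) (i l : ℕ) :
    medianSum.delta s (pr i l) = if i < n ∧ l < r + 1 then ∑ t ∈ Finset.range T,
      if 2 * s.reals 12 (pr (pr i l) t) < T + 1 ∧ 2 * s.reals 13 (pr (pr i l) t) < T + 1
        then s.reals 10 (pr (pr i l) t) else 0 else 0 := by
  simp [medianSum, guardMedian, hs.numRows, hs.rank, hs.trials, -Finset.sum_apply, ite_single,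
    sum_single_same, -Finset.sum_boole, ite_and]
  refine (sum_single₂ (i₁ := i) (i₂ := l) fun x y => ?_).trans ?_
  · simp [pr_inj, eq_comm]
  · simp [ite_and]

theorem medianCount_cell (hs : Ready ω n d r b T L s) (i l : ℕ) :
    medianCount.delta s (pr i l) = if i < n ∧ l < r + 1 then ∑ t ∈ Finset.range T,
      if 2 * s.reals 12 (pr (pr i l) t) < T + 1 ∧ 2 * s.reals 13 (pr (pr i l) t) < T + 1
        then 1 else 0 else 0 := by
  simp [medianCount, guardMedian, hs.numRows, hs.rank, hs.trials, -Finset.sum_apply, ite_single,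
    sum_single_same, -Finset.sum_boole, ite_and]
  refine (sum_single₂ (i₁ := i) (i₂ := l) fun x y => ?_).trans ?_
  · simp [pr_inj, eq_comm]
  · simp [ite_and]

/-- Row-major addresses are the only ones not built from `pr`; division with remainder by `r`
recovers the indices. -/
theorem writeVec_cell (hs : Ready ω n d r b T L s) {i l : ℕ} (hi : i < n) (hl : l < r) :
    writeVec.delta s (i * r + l) = s.reals 14 (pr i l) / s.reals 15 (pr i l) := by
  simp [writeVec, hs.numRows, hs.rank, -Finset.sum_apply]
  rw [Finset.sum_apply, sum_range_eq_ite (i₀ := i), if_pos hi, Finset.sum_apply,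
    sum_range_eq_ite (i₀ := l), if_pos hl, Pi.single_eq_same]
  · intro l' hl'
    rw [Pi.single_apply, if_neg (by omega)]
  · intro i' hi'
    rw [Finset.sum_apply]
    refine Finset.sum_eq_zero fun l' hl' => ?_
    rw [Pi.single_apply, if_neg]
    intro h
    have hl'' := Finset.mem_range.1 hl'
    have h1 : (i * r + l) / r = i := by
      rw [mul_comm, Nat.mul_add_div (by omega), Nat.div_eq_of_lt hl, add_zero]
    have h2 : (i' * r + l') / r = i' := by
      rw [mul_comm, Nat.mul_add_div (by omega), Nat.div_eq_of_lt hl'', add_zero]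
    rw [h, h2] at h1
    exact hi' h1

theorem writeVal_cell (hs : Ready ω n d r b T L s) {i : ℕ} (hi : i < n) :
    writeVal.delta s i = s.reals 14 (pr i r) / s.reals 15 (pr i r) := by
  simp [writeVal, hs.numRows, hs.rank, -Finset.sum_apply]
  refine (sum_single₁ (i₀ := i) fun x => ?_).trans ?_
  · exact eq_comm
  · simp [hi]

end cells

end Algorithm

end RealRAM

namespace SizeReduction

theorem median_congr {T : ℕ} {y y' : ℕ → ℝ} (h : ∀ t < T, y t = y' t) :
    median T y = median T y' := by
  have h1 : ∀ t < T, countBelow T y t = countBelow T y' t := by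
    intro t ht
    refine Finset.sum_congr rfl fun t' ht' => ?_
    rw [h t ht, h t' (Finset.mem_range.1 ht')]
  have h2 : ∀ t < T, countAbove T y t = countAbove T y' t := by
    intro t ht
    refine Finset.sum_congr rfl fun t' ht' => ?_
    rw [h t ht, h t' (Finset.mem_range.1 ht')]
  unfold median
  congr 1
  · refine Finset.sum_congr rfl fun t ht => ?_
    have ht' := Finset.mem_range.1 ht
    rw [h1 t ht', h2 t ht', h t ht']
  · refine Finset.sum_congr rfl fun t ht => ?_
    have ht' := Finset.mem_range.1 ht
    rw [h1 t ht', h2 t ht']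

end SizeReduction

namespace RealRAM

namespace Nest

/-- All loop counters are at least `k`. -/
def countersGe (k : ℕ) : Nest → Bool
  | .add _ _ => true
  | .guard _ p => p.countersGe k
  | .loop c _ p => k ≤ c && p.countersGe k

end Nest

namespace Algorithm

open Nest

/-! ### Running the orthogonalization within the time bound -/

section execution

variable {ω : ℕ → Bool} {n d r b T : ℕ} {L : List (ℕ × ℕ)} {s : State}

theorem Ready.zeroCounters (hs : Ready ω n d r b T L s) {p : Nest}
    (hp : p.countersGe 10 = true) : p.ZeroCounters s := by
  induction p with
  | add => trivial
  | guard b p ih => exact ih hp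
  | loop c N p ih =>
    simp only [countersGe, Bool.and_eq_true, decide_eq_true_eq] at hp
    exact ⟨hs.counters c hp.1, ih hp.2⟩

/-- Nests leave the integer memory unchanged, so the same hypotheses are available for the next nest
and such steps can be chained. -/
theorem Ready.exec (hs : Ready ω n d r b T L s) (p : Nest) (a : ℕ) (hp : p.countersGe 10 = true)
    (hok : p.ok a = true) {G : ℕ} (hG : p.dims s ≤ G) :
    ∃ s', Runs ω (p.toProg a) s s' (p.weight * G) ∧ Ready ω n d r b T L s' ∧
      s'.reals a = s.reals a + p.delta s ∧ ∀ c, c ≠ a → s'.reals c = s.reals c :=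
  ⟨_, (Nest.runs ω hok (hs.zeroCounters hp)).mono
      ((p.time_le s).trans (Nat.mul_le_mul_left _ hG)), hs.congr rfl,
    by rw [State.addReal_reals, if_pos rfl], fun c hc => by rw [State.addReal_reals, if_neg hc]⟩

/-- One step of the orthogonalization, with pivot column `p`. -/
noncomputable def pivotStep (s : State) (p : ℕ) : State :=
  let s₁ := s.addReal 8 (dots.delta (s.setInt 16 0 p))
  let s₂ := s₁.addReal 9 (multiples.delta (s₁.setInt 16 0 p))
  s₂.addReal 7 (subtract.delta (s₂.setInt 16 0 p))

/-- The state after `p` steps of the orthogonalization. -/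
noncomputable def pivotState (s : State) : ℕ → State
  | 0 => s
  | p + 1 => pivotStep (pivotState s p) p

/-- The program for one step of the orthogonalization. -/
def pivotProg : Prog :=
  .seq (dots.toProg 8) (.seq (multiples.toProg 9) (subtract.toProg 7))

theorem pivotState_ints (s : State) (p : ℕ) : (pivotState s p).ints = s.ints := by
  induction p with
  | zero => rfl
  | succ p ih => exact ih

theorem pivotState_reals (s : State) (p : ℕ) {c : ℕ} (h7 : c ≠ 7) (h8 : c ≠ 8) (h9 : c ≠ 9) :
    (pivotState s p).reals c = s.reals c := by
  induction p with
  | zero => rfl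
  | succ p ih =>
    rw [← ih]
    simp [pivotState, pivotStep, State.addReal_reals, h7, h8, h9]

/-- Nests can only add. This guarantees that the scratch cells of the current and all later pivots
are still zero, so that adding amounts to assigning. -/
theorem pivotState_unused (h8 : s.reals 8 = 0) (h9 : s.reals 9 = 0) (p : ℕ) :
    ∀ q, p ≤ q → ∀ y, (pivotState s p).reals 8 (pr y q) = 0 ∧
      (pivotState s p).reals 9 (pr y q) = 0 := by
  induction p with
  | zero => intro q _ y; simp [pivotState, h8, h9]
  | succ p ih =>
    intro q hq y
    have hne : q ≠ p := by omega
    have := ih q (by omega) y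
    simp [pivotState, pivotStep, State.addReal_reals, this, dots_cell_of_ne _ y hne,
      multiples_cell_of_ne _ y hne]

theorem pivotState_step (hs : Ready ω n d r b T L s) (h8 : s.reals 8 = 0) (h9 : s.reals 9 = 0)
    {t i : ℕ} (ht : t < T) (hi : i < n) {p : ℕ} (hp : p < r) {l : ℕ} (hl : l ≤ r) {h : ℕ}
    (hh : h < 2 ^ b + r + 1) :
    (pivotState s (p + 1)).reals 7 (pr (pr (pr t i) l) h) =
      (pivotState s p).reals 7 (pr (pr (pr t i) l) h) -
      if p < l then (∑ x ∈ Finset.range (2 ^ b),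
          (pivotState s p).reals 7 (pr (pr (pr t i) l) x) *
            (pivotState s p).reals 7 (pr (pr (pr t i) p) x)) /
        (∑ x ∈ Finset.range (2 ^ b), (pivotState s p).reals 7 (pr (pr (pr t i) p) x) *
          (pivotState s p).reals 7 (pr (pr (pr t i) p) x)) *
        (pivotState s p).reals 7 (pr (pr (pr t i) p) h) else 0 := by
  have hu := pivotState_unused h8 h9 p p le_rfl
  have h1 : Ready ω n d r b T L (pivotState s p) := hs.congr (pivotState_ints s p)
  set s' := pivotState s p with hs'
  set s₁ := s'.addReal 8 (dots.delta (s'.setInt 16 0 p)) with hs₁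
  set s₂ := s₁.addReal 9 (multiples.delta (s₁.setInt 16 0 p)) with hs₂
  have h2 : Ready ω n d r b T L s₁ := h1.congr rfl
  have h3 : Ready ω n d r b T L s₂ := h2.congr rfl
  have e : pivotState s (p + 1) = s₂.addReal 7 (subtract.delta (s₂.setInt 16 0 p)) := rfl
  have e7 : s₂.reals 7 = s'.reals 7 := by simp [hs₂, hs₁, State.addReal_reals]
  have e7' : s₁.reals 7 = s'.reals 7 := by simp [hs₁, State.addReal_reals]
  have e8 : ∀ l ≤ r, s₁.reals 8 (pr (pr (pr t i) l) p) = ∑ x ∈ Finset.range (2 ^ b),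
      s'.reals 7 (pr (pr (pr t i) l) x) * s'.reals 7 (pr (pr (pr t i) p) x) := by
    intro l hl
    rw [hs₁, State.addReal_reals, if_pos rfl, Pi.add_apply, (hu _).1, dots_cell h1, zero_add,
      if_pos ⟨ht, hi, by omega⟩]
  have e9 : s₂.reals 9 (pr (pr (pr (pr t i) l) h) p) =
      if p < l then s₁.reals 8 (pr (pr (pr t i) l) p) / s₁.reals 8 (pr (pr (pr t i) p) p) *
          s₁.reals 7 (pr (pr (pr t i) p) h) else 0 := by
    have : s₁.reals 9 = s'.reals 9 := by simp [hs₁, State.addReal_reals]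
    rw [hs₂, State.addReal_reals, if_pos rfl, Pi.add_apply, this, (hu _).2, multiples_cell h2,
      zero_add, if_pos ⟨ht, hi, by omega, by omega⟩]
  rw [e, State.addReal_reals, if_pos rfl, Pi.add_apply, subtract_cell h3,
    if_pos ⟨ht, hi, by omega, by omega⟩, e9, e7, e8 l hl, e8 p hp.le, e7']
  ring

/-- A bound for the product of the lengths of the loops in every nest. -/
def volume (n d r b T len : ℕ) : ℕ := (T + 1) ^ 2 * (len + (n + d) * (2 ^ b + r + 2) ^ 3)

/-- The two worst cases: orthogonalization, with four nested loops and one more over the pivots, and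
the pairwise comparison of trials for the medians. -/
theorem volume_bounds (n d r b T len : ℕ) :
    (T + 1) * (n + d) * ((2 ^ b + r + 2) * (2 ^ b + r + 2)) * (r + 1) ≤
      volume n d r b T len ∧
    (T + 1) * (T + 1) * (n + d) * (2 ^ b + r + 2) ≤ volume n d r b T len := by
  have hR : 1 ≤ 2 ^ b + r + 2 := Nat.le_add_left _ _
  have h1 : (T + 1) ^ 2 * (n + d) * (2 ^ b + r + 2) ^ 3 + (T + 1) * (T + 1) * len =
      volume n d r b T len := by unfold volume; ring
  refine ⟨le_trans ?_ (Nat.le_of_add_right_le h1.le), le_trans ?_ (Nat.le_of_add_right_le h1.le)⟩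
  · calc (T + 1) * (n + d) * ((2 ^ b + r + 2) * (2 ^ b + r + 2)) * (r + 1)
        ≤ (T + 1) ^ 2 * (n + d) * ((2 ^ b + r + 2) * (2 ^ b + r + 2)) *
          (2 ^ b + r + 2) :=
          Nat.mul_le_mul (Nat.mul_le_mul_right _ (Nat.mul_le_mul_right _
            (Nat.le_self_pow (by norm_num) _))) (by have := Nat.two_pow_pos b; omega)
      _ = _ := by ring
  · calc (T + 1) * (T + 1) * (n + d) * (2 ^ b + r + 2)
        = (T + 1) ^ 2 * (n + d) * (2 ^ b + r + 2) ^ 1 := by ring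
      _ ≤ _ := Nat.mul_le_mul_left _ (Nat.pow_le_pow_right hR (by norm_num))

theorem dims₄_le {x y z w A B C D : ℕ} (hx : x ≤ A) (hy : y ≤ B) (hz : z ≤ C) (hw : w ≤ D) :
    x * (y * (z * w)) ≤ A * B * (C * D) := by
  rw [← mul_assoc]
  exact Nat.mul_le_mul (Nat.mul_le_mul hx hy) (Nat.mul_le_mul hz hw)

theorem pivotProg_runs (hs : Ready ω n d r b T L s) (hd : 1 ≤ d) (p : ℕ) :
    Runs ω pivotProg (s.setInt 16 0 p) ((pivotStep s p).setInt 16 0 p)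
      ((dots.weight + (multiples.weight + subtract.weight)) *
        ((T + 1) * (n + d) * ((2 ^ b + r + 2) * (2 ^ b + r + 2)))) := by
  set G := (T + 1) * (n + d) * ((2 ^ b + r + 2) * (2 ^ b + r + 2)) with hG
  have hdots : ∀ s', Ready ω n d r b T L s' → dots.dims (s'.setInt 16 0 p) ≤ G := by
    intro s' hs'
    simp only [dots, dims, iv, par, widthE, IExp.eval, State.setInt_ints]
    simp [hs'.numRows, hs'.rank, hs'.trials, hs'.buckets]
    exact dims₄_le le_rfl (by omega) (by have := Nat.two_pow_pos b; omega)
      (by have := Nat.two_pow_pos b; omega)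
  have hmult : ∀ s', Ready ω n d r b T L s' → multiples.dims (s'.setInt 16 0 p) ≤ G := by
    intro s' hs'
    simp only [multiples, dims, iv, par, widthE, heightE, IExp.eval, State.setInt_ints]
    simp [hs'.numRows, hs'.rank, hs'.trials, hs'.buckets]
    exact dims₄_le le_rfl (by omega) (by have := Nat.two_pow_pos b; omega)
      (by have := Nat.two_pow_pos b; omega)
  have hsub : ∀ s', Ready ω n d r b T L s' → subtract.dims (s'.setInt 16 0 p) ≤ G := by
    intro s' hs'
    simp only [subtract, dims, iv, par, widthE, heightE, IExp.eval, State.setInt_ints]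
    simp [hs'.numRows, hs'.rank, hs'.trials, hs'.buckets]
    exact dims₄_le le_rfl (by omega) (by have := Nat.two_pow_pos b; omega)
      (by have := Nat.two_pow_pos b; omega)
  have hzero : ∀ (q : Nest) (s' : State), Ready ω n d r b T L s' → q.countersGe 10 = true →
      q.fresh 16 = true → q.ZeroCounters (s'.setInt 16 0 p) := fun q s' hs' h1 h2 =>
    zeroCounters_setInt h2 _ _ (hs'.zeroCounters h1)
  set s₁ := s.addReal 8 (dots.delta (s.setInt 16 0 p)) with hs₁
  set s₂ := s₁.addReal 9 (multiples.delta (s₁.setInt 16 0 p)) with hs₂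
  have h₁ : Ready ω n d r b T L s₁ := hs.congr rfl
  have h₂ : Ready ω n d r b T L s₂ := h₁.congr rfl
  have r₁ : Runs ω (dots.toProg 8) (s.setInt 16 0 p) (s₁.setInt 16 0 p) (dots.weight * G) :=
    (Nest.runs ω (a := 8) (p := dots) rfl (hzero _ s hs rfl rfl)).mono
      ((time_le _ _).trans (Nat.mul_le_mul_left _ (hdots s hs)))
  have r₂ : Runs ω (multiples.toProg 9) (s₁.setInt 16 0 p) (s₂.setInt 16 0 p)
      (multiples.weight * G) :=
    (Nest.runs ω (a := 9) (p := multiples) rfl (hzero _ s₁ h₁ rfl rfl)).mono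
      ((time_le _ _).trans (Nat.mul_le_mul_left _ (hmult s₁ h₁)))
  have r₃ : Runs ω (subtract.toProg 7) (s₂.setInt 16 0 p) ((pivotStep s p).setInt 16 0 p)
      (subtract.weight * G) :=
    (Nest.runs ω (a := 7) (p := subtract) rfl (hzero _ s₂ h₂ rfl rfl)).mono
      ((time_le _ _).trans (Nat.mul_le_mul_left _ (hsub s₂ h₂)))
  exact (r₁.seq (r₂.seq r₃)).mono (by ring_nf; exact le_rfl)

/-- The orthogonalization. -/
def orthogonalize : Prog := Prog.forLoop 16 (par 3) pivotProg

theorem orthogonalize_runs (hs : Ready ω n d r b T L s) (hd : 1 ≤ d) :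
    Runs ω orthogonalize s (pivotState s r)
      ((dots.weight + (multiples.weight + subtract.weight) + 11) *
        volume n d r b T L.length) := by
  set G := (T + 1) * (n + d) * ((2 ^ b + r + 2) * (2 ^ b + r + 2)) with hG
  have hR : ∀ p, Ready ω n d r b T L (pivotState s p) := fun p => hs.congr (pivotState_ints s p)
  have h := Runs.forLoop (ω := ω) (c := 16) (N := par 3) (p := pivotProg) (n := r)
    (pivotState s) (fun i _ => (hR i).counters 16 (by norm_num))
    (fun i _ => by simp [par, IExp.eval, State.setInt_ints, (hR i).rank])
    (fun i _ => pivotProg_runs (hR i) hd i)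
  refine h.mono ?_
  have hG1 : 1 ≤ G := by rw [hG]; exact Nat.succ_le_of_lt (by positivity)
  have h1 := (volume_bounds n d r b T L.length).1
  rw [← hG] at h1 ⊢
  set w := dots.weight + (multiples.weight + subtract.weight) with hw
  calc (r + 1) * (w * G + (par 3).cost + 9) ≤ (r + 1) * ((w + 11) * G) := by
        refine Nat.mul_le_mul_left _ ?_
        have : (par 3).cost = 2 := rfl
        rw [this]; nlinarith
    _ = (w + 11) * (G * (r + 1)) := by ring
    _ ≤ _ := Nat.mul_le_mul_left _ h1

end execution

end Algorithm

end RealRAM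

/-! ### Correctness and cost of the program once the hash functions are fixed -/

namespace RealRAM

theorem Runs.seq_mul {ω : ℕ → Bool} {p q : Prog} {s s₁ s₂ : State} {c₁ c₂ G : ℕ}
    (h₁ : Runs ω p s s₁ (c₁ * G)) (h₂ : Runs ω q s₁ s₂ (c₂ * G)) :
    Runs ω (.seq p q) s s₂ ((c₁ + c₂) * G) := by
  rw [add_mul]; exact h₁.seq h₂

namespace Algorithm

open Nest SizeReduction

/-- The part of the algorithm after the choice of the hash functions. -/
def mainProg : Prog :=
  .seq (sketchBasis.toProg 5) <| .seq (sketchRows.toProg 6) <| .seq (copyBasis.toProg 7) <|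
  .seq (copyRows.toProg 7) <| .seq (initCoeff.toProg 7) <| .seq orthogonalize <|
  .seq (estimates.toProg 10) <| .seq (squaredNorms.toProg 11) <| .seq (norms.toProg 10) <|
  .seq (smaller.toProg 12) <| .seq (larger.toProg 13) <| .seq (medianSum.toProg 14) <|
  .seq (medianCount.toProg 15) <| .seq (writeVec.toProg 3) (writeVal.toProg 4)

/-- The constant in the running time of `mainProg`. -/
def mainCost : ℕ :=
  sketchBasis.weight + (sketchRows.weight + (copyBasis.weight + (copyRows.weight +
  (initCoeff.weight + ((dots.weight + (multiples.weight + subtract.weight) + 11) +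
  (estimates.weight + (squaredNorms.weight + (norms.weight + (smaller.weight + (larger.weight +
  (medianSum.weight + (medianCount.weight + (writeVec.weight + writeVal.weight)))))))))))))

variable {ω : ℕ → Bool} {n d r b T : ℕ} {L : List (ℕ × ℕ)} {s : State}

theorem dims_le_volume {x y z w : ℕ} (hx : x ≤ T + 1) (hy : y ≤ n + d)
    (hz : z ≤ 2 ^ b + r + 2) (hw : w ≤ 2 ^ b + r + 2) :
    x * (y * (z * w)) ≤ volume n d r b T L.length :=
  (dims₄_le hx hy hz hw).trans ((Nat.le_mul_of_pos_right _ (Nat.succ_pos r)).trans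
    (volume_bounds n d r b T L.length).1)

theorem dims_le_volume' {x y z w : ℕ} (hx : x ≤ T + 1) (hy : y ≤ T + 1)
    (hz : z ≤ n + d) (hw : w ≤ 2 ^ b + r + 2) :
    x * (y * (z * w)) ≤ volume n d r b T L.length := by
  refine le_trans ?_ (volume_bounds n d r b T L.length).2
  rw [mul_assoc ((T + 1) * (T + 1))]
  exact dims₄_le hx hy hz hw

/-- The entries of the columns that are orthogonalized for row `i` in trial `t`. -/
noncomputable def column (ω : ℕ → Bool) (d r b : ℕ) (L : List (ℕ × ℕ)) (R : ℕ → ℕ → ℝ)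
    (t i l h : ℕ) : ℝ :=
  if l < r then ∑ j ∈ Finset.range d,
    if bitsValue ω ((t * d + j) * (b + 1)) b = h then
      CountSketch.sign (ω ((t * d + j) * (b + 1) + b)) * R 2 (j * r + l) else 0
  else ∑ e ∈ Finset.range L.length,
    if (L.map Prod.fst).getD e 0 = i ∧
      bitsValue ω ((t * d + (L.map Prod.snd).getD e 0) * (b + 1)) b = h then
      CountSketch.sign (ω ((t * d + (L.map Prod.snd).getD e 0) * (b + 1) + b)) * R 1 e else 0

/-- The first half: sketching and orthogonalization. -/
theorem orthogonalized (hs : Ready ω n d r b T L s) (hL : ∀ e ∈ L, e.2 < d) (hn : 1 ≤ n)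
    (hd : 1 ≤ d) (h0 : ∀ a, 3 ≤ a → s.reals a = 0) :
    ∃ s₁ s₂ s₃ s₄ s₅ s₆,
      Runs ω (sketchBasis.toProg 5) s s₁ (sketchBasis.weight * volume n d r b T L.length) ∧
      Runs ω (sketchRows.toProg 6) s₁ s₂ (sketchRows.weight * volume n d r b T L.length) ∧
      Runs ω (copyBasis.toProg 7) s₂ s₃ (copyBasis.weight * volume n d r b T L.length) ∧
      Runs ω (copyRows.toProg 7) s₃ s₄ (copyRows.weight * volume n d r b T L.length) ∧
      Runs ω (initCoeff.toProg 7) s₄ s₅ (initCoeff.weight * volume n d r b T L.length) ∧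
      Runs ω orthogonalize s₅ s₆ ((dots.weight + (multiples.weight + subtract.weight) + 11) *
        volume n d r b T L.length) ∧
      Ready ω n d r b T L s₆ ∧ (∀ a, 3 ≤ a → a < 5 ∨ 9 < a → s₆.reals a = 0) ∧
      ∀ t < T, ∀ i < n, ∃ V, IsGramSchmidt (2 ^ b) r (column ω d r b L s.reals t i) V ∧
        ∀ l h, s₆.reals 7 (pr (pr (pr t i) l) h) = V r l h := by
  have h2b := Nat.two_pow_pos b
  obtain ⟨s₁, run₁, R₁, a₁, o₁⟩ := hs.exec sketchBasis 5 rfl rfl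
    (G := volume n d r b T L.length) (by
      simp only [sketchBasis, dims, iv, par, IExp.eval, hs.trials, hs.numCols, hs.rank]
      exact dims_le_volume le_rfl (by omega) (by omega) (by omega))
  obtain ⟨s₂, run₂, R₂, a₂, o₂⟩ := R₁.exec sketchRows 6 rfl rfl
    (G := volume n d r b T L.length) (by
      simp only [sketchRows, dims, iv, par, IExp.eval, R₁.trials, R₁.length, mul_one]
      rw [volume, mul_comm]
      exact Nat.mul_le_mul (Nat.le_self_pow (by norm_num) _)
        (Nat.add_le_add_left (Nat.succ_le_of_lt (by positivity)) _))
  obtain ⟨s₃, run₃, R₃, a₃, o₃⟩ := R₂.exec copyBasis 7 rfl rfl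
    (G := volume n d r b T L.length) (by
      simp only [copyBasis, dims, iv, par, IExp.eval, R₂.trials, R₂.numRows, R₂.rank,
        R₂.buckets, mul_one]
      exact dims_le_volume le_rfl (by omega) (by omega) (by omega))
  obtain ⟨s₄, run₄, R₄, a₄, o₄⟩ := R₃.exec copyRows 7 rfl rfl
    (G := volume n d r b T L.length) (by
      simp only [copyRows, dims, iv, par, IExp.eval, R₃.trials, R₃.numRows, R₃.buckets]
      exact dims_le_volume le_rfl (by omega) (by omega) (by omega))
  obtain ⟨s₅, run₅, R₅, a₅, o₅⟩ := R₄.exec initCoeff 7 rfl rfl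
    (G := volume n d r b T L.length) (by
      simp only [initCoeff, dims, iv, par, widthE, IExp.eval, R₄.trials, R₄.numRows, R₄.rank]
      exact dims_le_volume le_rfl (by omega) (by omega) (by omega))
  have run₆ := orthogonalize_runs R₅ hd
  refine ⟨s₁, s₂, s₃, s₄, s₅, _, run₁, run₂, run₃, run₄, run₅, run₆,
    R₅.congr (pivotState_ints _ _), ?_, ?_⟩
  · intro a ha ha'
    rw [pivotState_reals _ _ (by omega) (by omega) (by omega), o₅ a (by omega), o₄ a (by omega),
      o₃ a (by omega), o₂ a (by omega), o₁ a (by omega), h0 a ha]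
  · have z8 : s₅.reals 8 = 0 := by
      rw [o₅ _ (by omega), o₄ _ (by omega), o₃ _ (by omega), o₂ _ (by omega), o₁ _ (by omega),
        h0 _ (by omega)]
    have z9 : s₅.reals 9 = 0 := by
      rw [o₅ _ (by omega), o₄ _ (by omega), o₃ _ (by omega), o₂ _ (by omega), o₁ _ (by omega),
        h0 _ (by omega)]
    intro t ht i hi
    refine ⟨fun p l h => (pivotState s₅ p).reals 7 (pr (pr (pr t i) l) h), ⟨?_, ?_, ?_⟩,
      fun l h => rfl⟩
    all_goals
      -- Three nests fill disjoint regions of array `7`: the sketched basis, the sketched row as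
      -- column `r`, and the unit coefficients below them.
      have e7 : ∀ x, s₅.reals 7 x =
          copyBasis.delta s₂ x + copyRows.delta s₃ x + initCoeff.delta s₄ x := by
        intro x
        rw [a₅, a₄, a₃, o₂ 7 (by omega), o₁ 7 (by omega), h0 7 (by omega)]
        simp
    · intro l hl h hh
      rw [pivotState, e7, copyBasis_cell R₂, copyRows_cell R₃, initCoeff_cell R₄, column]
      rw [if_neg (c := (t < T ∧ i < n ∧ l < r + 1) ∧ h = 2 ^ b + l) (by omega), add_zero]
      split_ifs with c1 c2 c3 c4 c5 c6
      any_goals omega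
      · have e1 : s₁.reals 5 (pr (pr t l) h) = sketchBasis.delta s (pr (pr t l) h) := by
          rw [a₁, h0 5 (by omega), zero_add]
        rw [o₂ 5 (by omega), e1, sketchBasis_cell hs ht (by omega), add_zero]
      · have e2 : s₂.reals 6 (pr (pr t i) h) = sketchRows.delta s₁ (pr (pr t i) h) := by
          rw [a₂, o₁ 6 (by omega), h0 6 (by omega), zero_add]
        rw [o₃ 6 (by omega), e2, sketchRows_cell R₁ hL ht, zero_add, o₁ 1 (by omega)]
    · intro l hl u hu
      rw [pivotState, e7, copyBasis_cell R₂, copyRows_cell R₃, initCoeff_cell R₄,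
        if_neg (by omega), if_neg (by omega), zero_add, zero_add]
      refine if_congr ?_ rfl rfl
      constructor
      · rintro ⟨-, h⟩; omega
      · rintro rfl; exact ⟨⟨ht, hi, by omega⟩, rfl⟩
    · intro p hp l hl h hh
      exact pivotState_step R₅ z8 z9 ht hi hp hl hh

theorem mainProg_runs (hs : Ready ω n d r b T L s) (hL : ∀ e ∈ L, e.2 < d) (hn : 1 ≤ n)
    (hd : 1 ≤ d) (h0 : ∀ a, 3 ≤ a → s.reals a = 0) :
    ∃ s', Runs ω mainProg s s' (mainCost * volume n d r b T L.length) ∧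
      ∀ i < n, ∃ V : ℕ → ℕ → ℕ → ℕ → ℝ,
        (∀ t < T, IsGramSchmidt (2 ^ b) r (column ω d r b L s.reals t i) (V t)) ∧
        (∀ l < r, s'.reals 3 (i * r + l) = median T fun t => -V t r r (2 ^ b + l)) ∧
        s'.reals 4 i = median T fun t =>
          Real.sqrt (∑ h ∈ Finset.range (2 ^ b), V t r r h * V t r r h) := by
  have h2b := Nat.two_pow_pos b
  obtain ⟨s₁, s₂, s₃, s₄, s₅, s₆, run₁, run₂, run₃, run₄, run₅, run₆, R₆, z₆, hV⟩ :=
    orthogonalized hs hL hn hd h0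
  obtain ⟨s₇, run₇, R₇, a₇, o₇⟩ := R₆.exec estimates 10 rfl rfl
    (G := volume n d r b T L.length) (by
      simp only [estimates, dims, iv, par, IExp.eval, R₆.trials, R₆.numRows, R₆.rank]
      exact dims_le_volume le_rfl (by omega) (by omega) (by omega))
  obtain ⟨s₈, run₈, R₈, a₈, o₈⟩ := R₇.exec squaredNorms 11 rfl rfl
    (G := volume n d r b T L.length) (by
      simp only [squaredNorms, dims, iv, par, IExp.eval, R₇.trials, R₇.numRows, R₇.buckets]
      exact dims_le_volume le_rfl (by omega) (by omega) (by omega))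
  obtain ⟨s₉, run₉, R₉, a₉, o₉⟩ := R₈.exec norms 10 rfl rfl
    (G := volume n d r b T L.length) (by
      simp only [norms, dims, iv, par, IExp.eval, R₈.trials, R₈.numRows]
      exact dims_le_volume (z := 1) (w := 1) le_rfl (by omega) (by omega) (by omega))
  obtain ⟨s₁₀, run₁₀, R₁₀, a₁₀, o₁₀⟩ := R₉.exec smaller 12 rfl rfl
    (G := volume n d r b T L.length) (by
      simp only [smaller, dims, iv, par, widthE, IExp.eval, R₉.trials, R₉.numRows, R₉.rank,
        mul_one]
      refine le_trans (le_of_eq ?_) (dims_le_volume' (x := T + 1) (y := T + 1) (z := n + 1)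
        (w := r + 1 + 1) le_rfl le_rfl (by omega) (by omega))
      ring)
  obtain ⟨s₁₁, run₁₁, R₁₁, a₁₁, o₁₁⟩ := R₁₀.exec larger 13 rfl rfl
    (G := volume n d r b T L.length) (by
      simp only [larger, dims, iv, par, widthE, IExp.eval, R₁₀.trials, R₁₀.numRows, R₁₀.rank,
        mul_one]
      refine le_trans (le_of_eq ?_) (dims_le_volume' (x := T + 1) (y := T + 1) (z := n + 1)
        (w := r + 1 + 1) le_rfl le_rfl (by omega) (by omega))
      ring)
  obtain ⟨s₁₂, run₁₂, R₁₂, a₁₂, o₁₂⟩ := R₁₁.exec medianSum 14 rfl rfl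
    (G := volume n d r b T L.length) (by
      simp only [medianSum, guardMedian, dims, iv, par, widthE, IExp.eval, R₁₁.trials,
        R₁₁.numRows, R₁₁.rank, mul_one]
      refine le_trans (le_of_eq ?_) (dims_le_volume' (x := 1) (y := T + 1) (z := n + 1)
        (w := r + 1 + 1) (by omega) le_rfl (by omega) (by omega))
      ring)
  obtain ⟨s₁₃, run₁₃, R₁₃, a₁₃, o₁₃⟩ := R₁₂.exec medianCount 15 rfl rfl
    (G := volume n d r b T L.length) (by
      simp only [medianCount, guardMedian, dims, iv, par, widthE, IExp.eval, R₁₂.trials,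
        R₁₂.numRows, R₁₂.rank, mul_one]
      refine le_trans (le_of_eq ?_) (dims_le_volume' (x := 1) (y := T + 1) (z := n + 1)
        (w := r + 1 + 1) (by omega) le_rfl (by omega) (by omega))
      ring)
  obtain ⟨s₁₄, run₁₄, R₁₄, a₁₄, o₁₄⟩ := R₁₃.exec writeVec 3 rfl rfl
    (G := volume n d r b T L.length) (by
      simp only [writeVec, dims, par, IExp.eval, R₁₃.numRows, R₁₃.rank, mul_one]
      refine le_trans (le_of_eq ?_) (dims_le_volume' (x := 1) (y := 1) (z := n + 1)
        (w := r + 1) (by omega) (by omega) (by omega) (by omega))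
      ring)
  obtain ⟨s₁₅, run₁₅, -, a₁₅, o₁₅⟩ := R₁₄.exec writeVal 4 rfl rfl
    (G := volume n d r b T L.length) (by
      simp only [writeVal, dims, par, IExp.eval, R₁₄.numRows, mul_one]
      refine le_trans (le_of_eq ?_) (dims_le_volume' (x := 1) (y := 1) (z := n + 1)
        (w := 1) (by omega) (by omega) (by omega) (by omega))
      ring)
  refine ⟨s₁₅, ?_, ?_⟩
  · exact run₁.seq_mul <| run₂.seq_mul <| run₃.seq_mul <| run₄.seq_mul <| run₅.seq_mul <|
      run₆.seq_mul <| run₇.seq_mul <| run₈.seq_mul <| run₉.seq_mul <| run₁₀.seq_mul <|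
      run₁₁.seq_mul <| run₁₂.seq_mul <| run₁₃.seq_mul <| run₁₄.seq_mul run₁₅
  · intro i hi
    -- The value `0` for `t ≥ T` only serves to make `choose` applicable.
    have hV' : ∀ t, ∃ V, t < T → IsGramSchmidt (2 ^ b) r (column ω d r b L s.reals t i) V ∧
        ∀ l h, s₆.reals 7 (pr (pr (pr t i) l) h) = V r l h := by
      intro t
      by_cases ht : t < T
      · obtain ⟨V, h⟩ := hV t ht i hi
        exact ⟨V, fun _ => h⟩
      · exact ⟨0, fun h => absurd h ht⟩
    choose V hV using hV'
    -- The residual norm occupies slot `r` next to the `r` coordinates, so the same code computes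
    -- all `r + 1` medians.
    have e10 : ∀ t < T, ∀ l, s₉.reals 10 (pr (pr i l) t) = if l < r then -V t r r (2 ^ b + l)
        else if l = r then Real.sqrt (∑ h ∈ Finset.range (2 ^ b), V t r r h * V t r r h)
        else 0 := by
      intro t ht l
      have e11 : s₈.reals 11 (pr t i) =
          ∑ h ∈ Finset.range (2 ^ b), V t r r h * V t r r h := by
        rw [a₈, Pi.add_apply, o₇ 11 (by omega), z₆ 11 (by omega) (by omega),
          squaredNorms_cell R₇, if_pos ⟨ht, hi⟩, o₇ 7 (by omega)]
        simp only [(hV t ht).2, Pi.zero_apply, zero_add]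
      rw [a₉, Pi.add_apply, o₈ 10 (by omega), a₇, Pi.add_apply, z₆ 10 (by omega) (by omega),
        estimates_cell R₆, norms_cell R₈, e11, (hV t ht).2]
      rcases lt_trichotomy l r with h | h | h
      · rw [if_pos ⟨ht, hi, h⟩, if_neg (by omega), if_pos h]; simp
      · rw [if_neg (by omega), if_pos ⟨⟨ht, hi⟩, h⟩, if_neg (by omega), if_pos h]; simp
      · rw [if_neg (by omega), if_neg (by omega), if_neg (by omega), if_neg (by omega)]; simp
    have emed : ∀ l ≤ r, s₁₃.reals 14 (pr i l) / s₁₃.reals 15 (pr i l) =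
        median T fun t => s₉.reals 10 (pr (pr i l) t) := by
      intro l hl
      have e12 : ∀ t < T, s₁₁.reals 12 (pr (pr i l) t) =
          countBelow T (fun t => s₉.reals 10 (pr (pr i l) t)) t := by
        intro t ht
        rw [o₁₁ 12 (by omega), a₁₀, Pi.add_apply, o₉ 12 (by omega), o₈ 12 (by omega),
          o₇ 12 (by omega), z₆ 12 (by omega) (by omega), smaller_cell R₉,
          if_pos ⟨hi, by omega, ht⟩]
        simp
      have e13 : ∀ t < T, s₁₁.reals 13 (pr (pr i l) t) =
          countAbove T (fun t => s₉.reals 10 (pr (pr i l) t)) t := by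
        intro t ht
        rw [a₁₁, Pi.add_apply, o₁₀ 13 (by omega), o₉ 13 (by omega), o₈ 13 (by omega),
          o₇ 13 (by omega), z₆ 13 (by omega) (by omega), larger_cell R₁₀,
          if_pos ⟨hi, by omega, ht⟩, o₁₀ 10 (by omega)]
        simp
      rw [o₁₃ 14 (by omega), a₁₂, a₁₃, Pi.add_apply, Pi.add_apply, o₁₁ 14 (by omega),
        o₁₀ 14 (by omega), o₉ 14 (by omega), o₈ 14 (by omega), o₇ 14 (by omega),
        z₆ 14 (by omega) (by omega), o₁₂ 15 (by omega), o₁₁ 15 (by omega),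
        o₁₀ 15 (by omega), o₉ 15 (by omega), o₈ 15 (by omega), o₇ 15 (by omega),
        z₆ 15 (by omega) (by omega), medianSum_cell R₁₁, medianCount_cell R₁₂,
        if_pos ⟨hi, by omega⟩, if_pos ⟨hi, by omega⟩, o₁₂ 12 (by omega), o₁₂ 13 (by omega),
        o₁₁ 10 (by omega), o₁₀ 10 (by omega)]
      unfold median
      simp only [Pi.zero_apply, zero_add]
      congr 1
      · refine Finset.sum_congr rfl fun t ht => ?_
        rw [e12 t (Finset.mem_range.1 ht), e13 t (Finset.mem_range.1 ht)]
      · refine Finset.sum_congr rfl fun t ht => ?_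
        rw [e12 t (Finset.mem_range.1 ht), e13 t (Finset.mem_range.1 ht)]
    refine ⟨V, fun t ht => (hV t ht).1, ?_, ?_⟩
    · intro l hl
      rw [o₁₅ 3 (by omega), a₁₄, Pi.add_apply, writeVec_cell R₁₃ hi hl, emed l hl.le,
        o₁₃ 3 (by omega), o₁₂ 3 (by omega), o₁₁ 3 (by omega), o₁₀ 3 (by omega),
        o₉ 3 (by omega), o₈ 3 (by omega), o₇ 3 (by omega), z₆ 3 (by omega) (by omega)]
      simp only [Pi.zero_apply, zero_add]
      refine median_congr fun t ht => ?_
      rw [e10 t ht, if_pos hl]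
    · rw [a₁₅, Pi.add_apply, writeVal_cell R₁₄ hi, o₁₄ 14 (by omega), o₁₄ 15 (by omega),
        emed r le_rfl, o₁₄ 4 (by omega), o₁₃ 4 (by omega), o₁₂ 4 (by omega), o₁₁ 4 (by omega),
        o₁₀ 4 (by omega), o₉ 4 (by omega), o₈ 4 (by omega), o₇ 4 (by omega),
        z₆ 4 (by omega) (by omega)]
      simp only [Pi.zero_apply, zero_add]
      refine median_congr fun t ht => ?_
      rw [e10 t ht, if_neg (lt_irrefl r), if_pos rfl]

end Algorithm

end RealRAM

/-! ### Choosing the parameters and building the hash functions -/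

namespace RealRAM

theorem Runs.while {ω : ℕ → Bool} {b : Test} {p : Prog} {N B : ℕ} (g : ℕ → State)
    (hb : ∀ x < N, b.holds (g x)) (hN : ¬ b.holds (g N))
    (hp : ∀ x < N, Runs ω p (g x) (g (x + 1)) B) :
    Runs ω (.while b p) (g 0) (g N) ((N + 1) * (B + b.cost)) := by
  have key : ∀ j ≤ N, Runs ω (.while b p) (g (N - j)) (g N) ((j + 1) * (B + b.cost)) := by
    intro j
    induction j with
    | zero => intro _; exact ⟨_, .while_false hN, by omega⟩
    | succ j ih =>
      intro hj
      obtain ⟨t₁, h₁, ht₁⟩ := hp (N - (j + 1)) (by omega)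
      obtain ⟨t₂, h₂, ht₂⟩ := ih (by omega)
      rw [show N - (j + 1) + 1 = N - j by omega] at h₁
      exact ⟨_, .while_true (hb _ (by omega)) h₁ h₂, by nlinarith⟩
  have := key N le_rfl
  rwa [Nat.sub_self] at this

theorem State.setInt_comm (s : State) {a b : ℕ} (h : a ≠ b) (i x j y : ℕ) :
    (s.setInt a i x).setInt b j y = (s.setInt b j y).setInt a i x := by
  simp only [State.setInt, Function.update_of_ne h, Function.update_of_ne h.symm]
  rw [Function.update_comm h]

namespace Algorithm

/-- The choice of the number `2 ^ b` of buckets. -/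
def chooseBuckets (K : ℕ) : Prog :=
  .seq (.iset 3 (.lit 0) (.lit 1))
    (.while (.rlt (.mul (.ofInt (iv 3)) (.mul (.get 0 (.lit 0)) (.get 0 (.lit 0))))
        (.ofInt (.mul (.lit K) (.mul (.mul widthE widthE) (.mul widthE widthE)))))
      (.seq (.iset 7 (iv 4) (iv 3)) (.seq (.iset 4 (.lit 0) (.add (iv 4) (.lit 1)))
        (.iset 3 (.lit 0) (.add (iv 3) (iv 3))))))

/-- The states during the choice of the number of buckets. -/
def bucketsState (s : State) : ℕ → State
  | 0 => s.setInt 3 0 1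
  | x + 1 => (((bucketsState s x).setInt 7 x (2 ^ x)).setInt 4 0 (x + 1)).setInt 3 0 (2 ^ (x + 1))

theorem bucketsState_spec (s : State) (h4 : s.ints 4 0 = 0) (x : ℕ) :
    (bucketsState s x).ints 3 0 = 2 ^ x ∧ (bucketsState s x).ints 4 0 = x ∧
      (∀ y < x, (bucketsState s x).ints 7 y = 2 ^ y) ∧
      (∀ a, a ≠ 3 → a ≠ 4 → a ≠ 7 → (bucketsState s x).ints a = s.ints a) ∧
      (bucketsState s x).reals = s.reals ∧ (bucketsState s x).flips = s.flips := by
  induction x with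
  | zero => simp +contextual [bucketsState, State.setInt_ints, h4]
  | succ x ih =>
    obtain ⟨-, -, h7, ha, hr, hf⟩ := ih
    refine ⟨by simp [bucketsState], by simp [bucketsState, State.setInt_ints], ?_, ?_, ?_, ?_⟩
    · intro y hy
      simp only [bucketsState, State.setInt_ints]
      rcases Nat.lt_succ_iff_lt_or_eq.1 hy with h | rfl
      · simp [h.ne, h7 y h]
      · simp
    · intro a h3 h4 h7
      simp [bucketsState, State.setInt_ints, h3, h4, h7, ha a h3 h4 h7]
    · simpa [bucketsState] using hr
    · simpa [bucketsState] using hf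

/-- The loop stops at the least `b` with enough buckets. Testing `2 ^ x · ε²` against an integer
avoids rounding and logarithms. The powers of two met on the way stay in integer array `7`, to be
used in `computeBuckets`. -/
theorem chooseBuckets_runs (ω : ℕ → Bool) (K : ℕ) (s : State) (h4 : s.ints 4 0 = 0) {b : ℕ}
    (hb : ∀ x < b, (2 : ℝ) ^ x * s.reals 0 0 ^ 2 < K * ((s.ints 0 3 : ℝ) + 1) ^ 4)
    (hb' : K * ((s.ints 0 3 : ℝ) + 1) ^ 4 ≤ (2 : ℝ) ^ b * s.reals 0 0 ^ 2) :
    Runs ω (chooseBuckets K) s (bucketsState s b) (100 * (b + 1)) := by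
  have hholds : ∀ x, Test.holds (bucketsState s x)
      (.rlt (.mul (.ofInt (iv 3)) (.mul (.get 0 (.lit 0)) (.get 0 (.lit 0))))
        (.ofInt (.mul (.lit K) (.mul (.mul widthE widthE) (.mul widthE widthE))))) ↔
      (2 : ℝ) ^ x * s.reals 0 0 ^ 2 < K * ((s.ints 0 3 : ℝ) + 1) ^ 4 := by
    intro x
    obtain ⟨h3, -, -, ha, hr, -⟩ := bucketsState_spec s h4 x
    simp only [Test.holds, RExp.eval, IExp.eval, iv, widthE, par, h3, hr,
      ha 0 (by norm_num) (by norm_num) (by norm_num)]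
    push_cast
    rw [show ((s.ints 0 3 : ℝ) + 1) * (s.ints 0 3 + 1) * ((s.ints 0 3 + 1) * (s.ints 0 3 + 1)) =
      (s.ints 0 3 + 1) ^ 4 by ring, sq]
  have h1 : Runs ω (.iset 3 (.lit 0) (.lit 1)) s (bucketsState s 0) 3 :=
    Runs.iset ω s 3 (.lit 0) (.lit 1)
  have h2 := Runs.while (ω := ω) (N := b) (B := 19) (bucketsState s)
    (fun x hx => (hholds x).2 (hb x hx)) (fun h => absurd ((hholds b).1 h) (not_lt.2 hb'))
    (p := .seq (.iset 7 (iv 4) (iv 3)) (.seq (.iset 4 (.lit 0) (.add (iv 4) (.lit 1)))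
        (.iset 3 (.lit 0) (.add (iv 3) (iv 3))))) ?_
  · refine (h1.seq h2).mono ?_
    simp only [Test.cost, RExp.cost, IExp.cost, iv, widthE, par]
    omega
  · intro x _
    obtain ⟨h3, h4, -⟩ := bucketsState_spec s h4 x
    have r₁ := Runs.iset ω (bucketsState s x) 7 (iv 4) (iv 3)
    simp only [iv, IExp.eval, h3, h4] at r₁
    have r₂ := Runs.iset ω ((bucketsState s x).setInt 7 x (2 ^ x)) 4 (.lit 0)
      (.add (iv 4) (.lit 1))
    simp only [iv, IExp.eval, State.setInt_ints_of_ne _ _ _ (show 4 ≠ 7 by norm_num), h4] at r₂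
    have r₃ := Runs.iset ω (((bucketsState s x).setInt 7 x (2 ^ x)).setInt 4 0 (x + 1)) 3 (.lit 0)
      (.add (iv 3) (iv 3))
    simp only [iv, IExp.eval, State.setInt_ints_of_ne _ _ _ (show 3 ≠ 7 by norm_num),
      State.setInt_ints_of_ne _ _ _ (show 3 ≠ 4 by norm_num), h3] at r₃
    rw [show 2 ^ x + 2 ^ x = 2 ^ (x + 1) by ring] at r₃
    exact (r₁.seq (r₂.seq r₃)).mono (by simp only [IExp.cost]; omega)

/-- The choice of the number of trials. -/
def chooseTrials : Prog :=
  .seq (.iset 6 (.lit 0) (.lit 1))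
    (.while (.ilt (iv 6) (.mul (.lit 10) (par 0)))
      (.seq (.iset 5 (.lit 0) (.add (iv 5) (.lit 1))) (.iset 6 (.lit 0) (.add (iv 6) (iv 6)))))

/-- The states during the choice of the number of trials. -/
def trialsState (s : State) : ℕ → State
  | 0 => s.setInt 6 0 1
  | x + 1 => ((trialsState s x).setInt 5 0 (x + 1)).setInt 6 0 (2 ^ (x + 1))

theorem trialsState_spec (s : State) (h5 : s.ints 5 0 = 0) (x : ℕ) :
    (trialsState s x).ints 6 0 = 2 ^ x ∧ (trialsState s x).ints 5 0 = x ∧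
      (∀ a, a ≠ 5 → a ≠ 6 → (trialsState s x).ints a = s.ints a) ∧
      (trialsState s x).reals = s.reals ∧ (trialsState s x).flips = s.flips := by
  induction x with
  | zero => simp +contextual [trialsState, State.setInt_ints, h5]
  | succ x ih =>
    obtain ⟨-, -, ha, hr, hf⟩ := ih
    refine ⟨by simp [trialsState], by simp [trialsState, State.setInt_ints], ?_, ?_, ?_⟩
    · intro a h5 h6
      simp [trialsState, State.setInt_ints, h5, h6, ha a h5 h6]
    · simpa [trialsState] using hr
    · simpa [trialsState] using hf

theorem chooseTrials_runs (ω : ℕ → Bool) (s : State) (h5 : s.ints 5 0 = 0) {T : ℕ}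
    (hT : ∀ x < T, 2 ^ x < 10 * s.ints 0 0) (hT' : 10 * s.ints 0 0 ≤ 2 ^ T) :
    Runs ω chooseTrials s (trialsState s T) (100 * (T + 1)) := by
  have hholds : ∀ x, Test.holds (trialsState s x) (.ilt (iv 6) (.mul (.lit 10) (par 0))) ↔
      2 ^ x < 10 * s.ints 0 0 := by
    intro x
    obtain ⟨h6, -, ha, -⟩ := trialsState_spec s h5 x
    simp only [Test.holds, IExp.eval, iv, par, h6, ha 0 (by norm_num) (by norm_num)]
  have h1 : Runs ω (.iset 6 (.lit 0) (.lit 1)) s (trialsState s 0) 3 :=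
    Runs.iset ω s 6 (.lit 0) (.lit 1)
  have h2 := Runs.while (ω := ω) (N := T) (B := 14) (trialsState s)
    (fun x hx => (hholds x).2 (hT x hx)) (fun h => absurd ((hholds T).1 h) (not_lt.2 hT'))
    (p := .seq (.iset 5 (.lit 0) (.add (iv 5) (.lit 1)))
      (.iset 6 (.lit 0) (.add (iv 6) (iv 6)))) ?_
  · refine (h1.seq h2).mono ?_
    simp only [Test.cost, IExp.cost, iv, par]
    omega
  · intro x _
    obtain ⟨h6, h5, -⟩ := trialsState_spec s h5 x
    have r₁ := Runs.iset ω (trialsState s x) 5 (.lit 0) (.add (iv 5) (.lit 1))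
    simp only [iv, IExp.eval, h5] at r₁
    have r₂ := Runs.iset ω ((trialsState s x).setInt 5 0 (x + 1)) 6 (.lit 0)
      (.add (iv 6) (iv 6))
    simp only [iv, IExp.eval, State.setInt_ints_of_ne _ _ _ (show 6 ≠ 5 by norm_num), h6] at r₂
    rw [show 2 ^ x + 2 ^ x = 2 ^ (x + 1) by ring] at r₂
    exact (r₁.seq r₂).mono (by simp only [IExp.cost]; omega)

/-- Flipping all coins. -/
def flipCoins : Prog :=
  Prog.forLoop 17 (.mul (.mul (iv 5) (par 1)) (.add (iv 4) (.lit 1))) (.flip 8 (iv 17))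

/-- The states while the coins are flipped. -/
def flipState (ω : ℕ → Bool) (s : State) : ℕ → State
  | 0 => s
  | q + 1 => { (flipState ω s q).setInt 8 q (ω q).toNat with flips := q + 1 }

theorem flipState_spec (ω : ℕ → Bool) (s : State) (hf : s.flips = 0) (q : ℕ) :
    (flipState ω s q).flips = q ∧ (∀ y < q, (flipState ω s q).ints 8 y = (ω y).toNat) ∧
      (∀ a, a ≠ 8 → (flipState ω s q).ints a = s.ints a) ∧
      (flipState ω s q).reals = s.reals := by
  induction q with
  | zero => exact ⟨hf, by simp, fun _ _ => rfl, rfl⟩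
  | succ q ih =>
    obtain ⟨-, h8, ha, hr⟩ := ih
    refine ⟨rfl, ?_, ?_, hr⟩
    · intro y hy
      change ((flipState ω s q).setInt 8 q (ω q).toNat).ints 8 y = _
      rw [State.setInt_ints, if_pos rfl]
      rcases Nat.lt_succ_iff_lt_or_eq.1 hy with h | rfl
      · simp [h.ne, h8 y h]
      · simp
    · intro a h
      change ((flipState ω s q).setInt 8 q (ω q).toNat).ints a = _
      rw [State.setInt_ints_of_ne _ _ _ h, ha a h]

theorem flipCoins_runs (ω : ℕ → Bool) (s : State) (hf : s.flips = 0) (h17 : s.ints 17 0 = 0) :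
    Runs ω flipCoins s (flipState ω s (s.ints 5 0 * s.ints 0 1 * (s.ints 4 0 + 1)))
      (100 * (s.ints 5 0 * s.ints 0 1 * (s.ints 4 0 + 1) + 1)) := by
  set N := s.ints 5 0 * s.ints 0 1 * (s.ints 4 0 + 1) with hN
  have h := Runs.forLoop (ω := ω) (c := 17)
    (N := .mul (.mul (iv 5) (par 1)) (.add (iv 4) (.lit 1))) (p := .flip 8 (iv 17)) (n := N)
    (B := 3) (flipState ω s) ?_ ?_ ?_
  · refine h.mono ?_
    simp only [IExp.cost, iv, par]
    omega
  · intro q _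
    rw [(flipState_spec ω s hf q).2.2.1 17 (by norm_num), h17]
  · intro q _
    have ha := (flipState_spec ω s hf q).2.2.1
    simp [IExp.eval, iv, par, State.setInt_ints, ha, hN]
  · intro q _
    have hq := (flipState_spec ω s hf q).1
    refine ⟨_, ?_, le_rfl⟩
    have := Exec.flip (ω := ω) ((flipState ω s q).setInt 17 0 q) 8 (iv 17)
    simp only [iv, IExp.eval, State.setInt_same, State.setInt_flips, hq] at this
    rw [State.setInt_comm _ (show 17 ≠ 8 by norm_num)] at this
    exact this

/-- Computing the buckets from the coins. -/
def computeBuckets : Prog :=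
  Prog.forLoop 14 (.mul (iv 5) (par 1)) (Prog.forLoop 17 (iv 4)
    (.iset 9 (iv 14) (.add (.get 9 (iv 14)) (.mul (.get 7 (iv 17))
      (.get 8 (.add (.mul (iv 14) (.add (iv 4) (.lit 1))) (iv 17)))))))

/-- The states while the buckets are computed. -/
def hashState (ω : ℕ → Bool) (b : ℕ) (s : State) : ℕ → State
  | 0 => s
  | y + 1 => (hashState ω b s y).setInt 9 y (bitsValue ω (y * (b + 1)) b)

theorem hashState_spec (ω : ℕ → Bool) (b : ℕ) (s : State) (y : ℕ) :
    (∀ x < y, (hashState ω b s y).ints 9 x = bitsValue ω (x * (b + 1)) b) ∧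
      (∀ x, y ≤ x → (hashState ω b s y).ints 9 x = s.ints 9 x) ∧
      (∀ a, a ≠ 9 → (hashState ω b s y).ints a = s.ints a) ∧
      (hashState ω b s y).reals = s.reals := by
  induction y with
  | zero => exact ⟨by simp, fun _ _ => rfl, fun _ _ => rfl, rfl⟩
  | succ y ih =>
    obtain ⟨h9, h9', ha, hr⟩ := ih
    refine ⟨?_, ?_, ?_, hr⟩
    · intro x hx
      rw [hashState, State.setInt_ints, if_pos rfl]
      rcases Nat.lt_succ_iff_lt_or_eq.1 hx with h | rfl
      · simp [h.ne, h9 x h]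
      · simp
    · intro x hx
      rw [hashState, State.setInt_ints, if_pos rfl,
        Function.update_of_ne (by omega), h9' x (by omega)]
    · intro a h
      rw [hashState, State.setInt_ints_of_ne _ _ _ h, ha a h]

theorem computeBuckets_runs (ω : ℕ → Bool) (s : State) {b N : ℕ} (hb : s.ints 4 0 = b)
    (hN : s.ints 5 0 * s.ints 0 1 = N) (h7 : ∀ x < b, s.ints 7 x = 2 ^ x)
    (h8 : ∀ q < N * (b + 1), s.ints 8 q = (ω q).toNat) (h9 : s.ints 9 = 0)
    (h14 : s.ints 14 0 = 0) (h17 : s.ints 17 0 = 0) :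
    Runs ω computeBuckets s (hashState ω b s N) ((N + 1) * (100 * (b + 1))) := by
  have h := Runs.forLoop (ω := ω) (c := 14) (N := .mul (iv 5) (par 1))
    (p := Prog.forLoop 17 (iv 4)
    (.iset 9 (iv 14) (.add (.get 9 (iv 14)) (.mul (.get 7 (iv 17))
      (.get 8 (.add (.mul (iv 14) (.add (iv 4) (.lit 1))) (iv 17))))))) (n := N)
    (B := (b + 1) * (25 + 2 + 9)) (hashState ω b s) ?_ ?_ ?_
  · refine h.mono (Nat.mul_le_mul_left _ ?_)
    simp only [IExp.cost, iv, par]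
    omega
  · intro y _
    rw [(hashState_spec ω b s y).2.2.1 14 (by norm_num), h14]
  · intro y _
    have ha := (hashState_spec ω b s y).2.2.1
    simp [IExp.eval, iv, par, State.setInt_ints, ha, hN]
  · intro y hy
    obtain ⟨-, h9', ha, -⟩ := hashState_spec ω b s y
    set s' := (hashState ω b s y).setInt 14 0 y with hs'
    have i14 : s'.ints 14 0 = y := State.setInt_same _ _ _ _
    have ia : ∀ a, a ≠ 9 → a ≠ 14 → s'.ints a = s.ints a := fun a h1 h2 => by
      rw [hs', State.setInt_ints_of_ne _ _ _ h2, ha a h1]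
    have i9 : s'.ints 9 y = 0 := by
      rw [hs', State.setInt_ints_of_ne _ _ _ (by norm_num), h9' y le_rfl, h9]; rfl
    have hin := Runs.forLoop (ω := ω) (c := 17) (N := iv 4)
      (p := (.iset 9 (iv 14) (.add (.get 9 (iv 14)) (.mul (.get 7 (iv 17))
        (.get 8 (.add (.mul (iv 14) (.add (iv 4) (.lit 1))) (iv 17)))))))
      (n := b) (B := 25) (fun x => s'.setInt 9 y (bitsValue ω (y * (b + 1)) x)) ?_ ?_ ?_
    -- Cell `y` is still zero, which is the value of the empty binary expansion.
    · have e0 : s'.setInt 9 y (bitsValue ω (y * (b + 1)) 0) = s' := by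
        rw [show bitsValue ω (y * (b + 1)) 0 = s'.ints 9 y by rw [i9]; rfl]
        exact State.setInt_self s' 9 y
      simp only [e0] at hin
      rw [hashState, State.setInt_comm _ (show 9 ≠ 14 by norm_num)]
      exact hin
    · intro x _
      rw [State.setInt_ints_of_ne _ _ _ (by norm_num), ia 17 (by norm_num) (by norm_num), h17]
    · intro x _
      simp only [iv, IExp.eval, State.setInt_ints_of_ne _ _ _ (show 4 ≠ 17 by norm_num),
        State.setInt_ints_of_ne _ _ _ (show 4 ≠ 9 by norm_num)]
      rw [ia 4 (by norm_num) (by norm_num), hb]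
    · intro x hx
      have hq : y * (b + 1) + x < N * (b + 1) := by nlinarith
      have r := Runs.iset ω ((s'.setInt 9 y (bitsValue ω (y * (b + 1)) x)).setInt 17 0 x) 9
        (iv 14) (.add (.get 9 (iv 14)) (.mul (.get 7 (iv 17))
        (.get 8 (.add (.mul (iv 14) (.add (iv 4) (.lit 1))) (iv 17)))))
      simp only [iv, IExp.eval, State.setInt_same,
        State.setInt_ints_of_ne _ _ _ (show 14 ≠ 17 by norm_num),
        State.setInt_ints_of_ne _ _ _ (show 14 ≠ 9 by norm_num), i14,
        State.setInt_ints_of_ne _ _ _ (show 9 ≠ 17 by norm_num),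
        State.setInt_ints_of_ne _ _ _ (show 7 ≠ 17 by norm_num),
        State.setInt_ints_of_ne _ _ _ (show 7 ≠ 9 by norm_num),
        State.setInt_ints_of_ne _ _ _ (show 8 ≠ 17 by norm_num),
        State.setInt_ints_of_ne _ _ _ (show 8 ≠ 9 by norm_num),
        State.setInt_ints_of_ne _ _ _ (show 4 ≠ 17 by norm_num),
        State.setInt_ints_of_ne _ _ _ (show 4 ≠ 9 by norm_num),
        ia 7 (by norm_num) (by norm_num), ia 8 (by norm_num) (by norm_num),
        ia 4 (by norm_num) (by norm_num), hb, h7 x hx, h8 _ hq] at r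
      rw [State.setInt_comm _ (show 17 ≠ 9 by norm_num), State.setInt_setInt] at r
      have e : bitsValue ω (y * (b + 1)) x + 2 ^ x * (ω (y * (b + 1) + x)).toNat =
          bitsValue ω (y * (b + 1)) (x + 1) := by
        rw [bitsValue, bitsValue, Finset.sum_range_succ]
      rw [e] at r
      exact r.mono (by simp only [IExp.cost]; omega)

/-- The part of the algorithm that chooses the hash functions. -/
def hashProg (K : ℕ) : Prog :=
  .seq (chooseBuckets K) (.seq chooseTrials (.seq flipCoins computeBuckets))

theorem hashProg_runs (ω : ℕ → Bool) (K : ℕ) (s : State) {n d r b T : ℕ} {L : List (ℕ × ℕ)}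
    (hn : s.ints 0 0 = n) (hd : s.ints 0 1 = d) (hr : s.ints 0 3 = r)
    (hl : s.ints 0 4 = L.length) (h1 : ∀ e, s.ints 1 e = (L.map Prod.fst).getD e 0)
    (h2 : ∀ e, s.ints 2 e = (L.map Prod.snd).getD e 0) (h3 : ∀ a, 3 ≤ a → s.ints a = 0)
    (hf : s.flips = 0)
    (hb : ∀ x < b, (2 : ℝ) ^ x * s.reals 0 0 ^ 2 < K * ((r : ℝ) + 1) ^ 4)
    (hb' : K * ((r : ℝ) + 1) ^ 4 ≤ (2 : ℝ) ^ b * s.reals 0 0 ^ 2)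
    (hT : ∀ x < T, 2 ^ x < 10 * n) (hT' : 10 * n ≤ 2 ^ T) :
    ∃ s', Runs ω (hashProg K) s s' (100 * (b + 1) + (100 * (T + 1) +
      (100 * (T * d * (b + 1) + 1) + (T * d + 1) * (100 * (b + 1))))) ∧
      Ready ω n d r b T L s' ∧ s'.reals = s.reals := by
  have z : ∀ a, 3 ≤ a → s.ints a 0 = 0 := fun a ha => by rw [h3 a ha]; rfl
  have run₁ := chooseBuckets_runs ω K s (z 4 (by norm_num)) (b := b) (by rwa [hr]) (by rwa [hr])
  obtain ⟨b3, b4, b7, ba, br, bf⟩ := bucketsState_spec s (z 4 (by norm_num)) b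
  set s₁ := bucketsState s b with hs₁
  have ba' : ∀ a, a ≠ 3 ∧ a ≠ 4 ∧ a ≠ 7 → s₁.ints a = s.ints a := fun a h => ba a h.1 h.2.1 h.2.2
  have z5 : s₁.ints 5 0 = 0 := by rw [ba' 5 (by norm_num), z 5 (by norm_num)]
  have run₂ := chooseTrials_runs ω s₁ z5 (T := T) (by rwa [ba' 0 (by norm_num), hn])
    (by rwa [ba' 0 (by norm_num), hn])
  obtain ⟨-, t5, ta, tr, tf⟩ := trialsState_spec s₁ z5 T
  set s₂ := trialsState s₁ T with hs₂
  have ta' : ∀ a, a ≠ 5 ∧ a ≠ 6 → s₂.ints a = s₁.ints a := fun a h => ta a h.1 h.2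
  have f2 : s₂.flips = 0 := by rw [tf, bf, hf]
  have run₃ := flipCoins_runs ω s₂ f2
    (by rw [ta' 17 (by norm_num), ba' 17 (by norm_num), z 17 (by norm_num)])
  rw [t5, ta' 0 (by norm_num), ba' 0 (by norm_num), hd, ta' 4 (by norm_num), b4] at run₃
  obtain ⟨-, f8, fa, fr⟩ := flipState_spec ω s₂ f2 (T * d * (b + 1))
  set s₃ := flipState ω s₂ (T * d * (b + 1)) with hs₃
  have i0 : s₃.ints 0 = s.ints 0 := by
    rw [fa 0 (by norm_num), ta' 0 (by norm_num), ba' 0 (by norm_num)]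
  have i5 : s₃.ints 5 0 = T := by rw [fa 5 (by norm_num), t5]
  have i4 : s₃.ints 4 0 = b := by rw [fa 4 (by norm_num), ta' 4 (by norm_num), b4]
  have i3 : s₃.ints 3 0 = 2 ^ b := by rw [fa 3 (by norm_num), ta' 3 (by norm_num), b3]
  have ige : ∀ a, 9 ≤ a → s₃.ints a = 0 := by
    intro a ha
    rw [fa a (by omega), ta' a (by omega), ba' a (by omega), h3 a (by omega)]
  have run₄ := computeBuckets_runs ω s₃ (b := b) (N := T * d) i4 (by rw [i5, i0, hd])
    (fun x hx => by rw [fa 7 (by norm_num), ta' 7 (by norm_num), b7 x hx]) f8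
    (ige 9 (by norm_num)) (by rw [ige 14 (by norm_num)]; rfl) (by rw [ige 17 (by norm_num)]; rfl)
  obtain ⟨c9, -, ca, cr⟩ := hashState_spec ω b s₃ (T * d)
  set s₄ := hashState ω b s₃ (T * d) with hs₄
  have c0 : s₄.ints 0 = s.ints 0 := by rw [ca 0 (by norm_num), i0]
  refine ⟨s₄, run₁.seq (run₂.seq (run₃.seq run₄)), ?_, by rw [cr, fr, tr, br]⟩
  constructor
  · rw [c0, hn]
  · rw [c0, hd]
  · rw [c0, hr]
  · rw [c0, hl]
  · intro e
    rw [ca 1 (by norm_num), fa 1 (by norm_num), ta' 1 (by norm_num), ba' 1 (by norm_num), h1]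
  · intro e
    rw [ca 2 (by norm_num), fa 2 (by norm_num), ta' 2 (by norm_num), ba' 2 (by norm_num), h2]
  · rw [ca 3 (by norm_num), i3]
  · rw [ca 4 (by norm_num), i4]
  · rw [ca 5 (by norm_num), i5]
  · intro c hc
    rw [ca c (by omega), ige c (by omega)]; rfl
  · intro t ht j hj
    exact c9 _ (by nlinarith)
  · intro t ht j hj
    rw [ca 8 (by norm_num)]
    exact f8 _ (hashIndex_lt ht hj (Nat.lt_succ_self b))

/-- The whole algorithm. -/
def sizeReduction (K : ℕ) : Prog := .seq (hashProg K) mainProg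

theorem hashProg_time_le {n d r b T len : ℕ} (hn : 1 ≤ n) (hd : 1 ≤ d) :
    100 * (b + 1) + (100 * (T + 1) + (100 * (T * d * (b + 1) + 1) +
      (T * d + 1) * (100 * (b + 1)))) ≤ 600 * volume n d r b T len := by
  have hb : b + 1 ≤ 2 ^ b := Nat.lt_two_pow_self
  have h1 : (T + 1) * ((n + d) * ((b + 1) * 1)) ≤ volume n d r b T len := by
    have h2 : (T + 1) * ((n + d) * ((b + 1) * 1)) ≤
        (T + 1) * (n + d) * ((2 ^ b + r + 2) * (2 ^ b + r + 2)) :=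
      dims₄_le le_rfl le_rfl (by omega) (by omega)
    exact h2.trans ((Nat.le_mul_of_pos_right _ (Nat.succ_pos r)).trans
      (volume_bounds n d r b T len).1)
  have h3 : (T + 1) * (d * (b + 1)) ≤ volume n d r b T len := by
    refine le_trans (Nat.mul_le_mul_left _ ?_) h1
    rw [mul_one]
    exact Nat.mul_le_mul_right _ (by omega)
  have h4 : b + 1 ≤ (T + 1) * (d * (b + 1)) := by
    calc b + 1 = 1 * (1 * (b + 1)) := by ring
      _ ≤ _ := Nat.mul_le_mul (by omega) (Nat.mul_le_mul_right _ hd)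
  have h5 : T + 1 ≤ (T + 1) * (d * (b + 1)) := Nat.le_mul_of_pos_right _ (by positivity)
  have h6 : T * d * (b + 1) + d * (b + 1) = (T + 1) * (d * (b + 1)) := by ring
  have h7 : (T * d + 1) * (100 * (b + 1)) = 100 * (T * d * (b + 1)) + 100 * (b + 1) := by ring
  rw [h7]
  omega

end Algorithm

end RealRAM

/-! ### From the input memory to sketches of basis vectors and rows -/

namespace SizeReduction

open RealRAM RealRAM.Algorithm CountSketch

section input

variable {n d r k : ℕ} {ε : ℝ} {A : Matrix (Fin n) (Fin d) ℝ} {L : List (Fin n × Fin d)}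
  {P : Submodule ℝ (EuclideanSpace ℝ (Fin d))} {B : OrthonormalBasis (Fin r) ℝ P}

theorem ListsSupport.length_eq (hL : ListsSupport A L) : L.length = nnz A := by
  classical
  have h : {p : Fin n × Fin d | A p.1 p.2 ≠ 0} = (L.toFinset : Set (Fin n × Fin d)) := by
    ext p; simp [hL.2 p]
  rw [nnz, h, Set.ncard_coe_finset, List.toFinset_card_of_nodup hL.1]

/-- The list of positions as natural numbers. -/
def positions (L : List (Fin n × Fin d)) : List (ℕ × ℕ) := L.map fun p => ((p.1 : ℕ), (p.2 : ℕ))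

theorem input_basis (j : Fin d) (l : Fin r) :
    (input k ε A L B).reals 2 (j * r + l) = (B l : EuclideanSpace ℝ (Fin d)) j := by
  have hlt : (j : ℕ) * r + l < d * r := by nlinarith [j.2, l.2]
  have hr : 0 < r := l.pos
  change (if h : (j : ℕ) * r + l < d * r then
    (B (Fin.modNat ⟨j * r + l, h⟩) : EuclideanSpace ℝ (Fin d)) (Fin.divNat ⟨j * r + l, h⟩)
    else 0) = _
  rw [dif_pos hlt]
  have h1 : Fin.modNat (⟨j * r + l, hlt⟩ : Fin (d * r)) = l := by
    ext
    simp [Fin.modNat, Nat.mod_eq_of_lt l.2]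
  have h2 : Fin.divNat (⟨j * r + l, hlt⟩ : Fin (d * r)) = j := by
    ext
    simp only [Fin.divNat]
    rw [mul_comm, Nat.mul_add_div hr, Nat.div_eq_of_lt l.2, add_zero]
  rw [h1, h2]

theorem column_basis (ω : ℕ → Bool) (b t i : ℕ) (l : Fin r) (h : Fin (2 ^ b)) :
    column ω d r b (positions L) (input k ε A L B).reals t i l h =
      sketch (hashOf ω b d t) (fun j => (B l : EuclideanSpace ℝ (Fin d)) j) h := by
  rw [column, if_pos l.2, Finset.sum_range, sketch]
  refine Finset.sum_congr rfl fun j _ => ?_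
  rw [input_basis]
  exact if_congr ⟨fun e => Fin.ext e, fun e => congrArg Fin.val e⟩ rfl rfl

theorem column_row (hL : ListsSupport A L) (ω : ℕ → Bool) (b t : ℕ) (i : Fin n)
    (h : Fin (2 ^ b)) :
    column ω d r b (positions L) (input k ε A L B).reals t i r h =
      sketch (hashOf ω b d t) (fun j => row A i j) h := by
  classical
  rw [column, if_neg (lt_irrefl r), Finset.sum_range]
  set F : Fin n × Fin d → ℝ := fun p =>
    if p.1 = i ∧ (hashOf ω b d t p.2).1 = h then sign (hashOf ω b d t p.2).2 * A p.1 p.2 else 0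
    with hF
  have hlen : (positions L).length = L.length := by simp [positions]
  have h1 : ∑ e : Fin (positions L).length,
      (if ((positions L).map Prod.fst).getD e 0 = i ∧
        bitsValue ω ((t * d + ((positions L).map Prod.snd).getD e 0) * (b + 1)) b = h then
        sign (ω ((t * d + ((positions L).map Prod.snd).getD e 0) * (b + 1) + b)) *
          (input k ε A L B).reals 1 e else 0) = ∑ e : Fin L.length, F L[(e : ℕ)] := by
    refine Fintype.sum_equiv (finCongr hlen) _ _ fun e => ?_
    have he : (e : ℕ) < L.length := hlen ▸ e.2
    have e1 : ((positions L).map Prod.fst).getD e 0 = (L[(e : ℕ)].1 : ℕ) := by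
      simp [positions, he]
    have e2 : ((positions L).map Prod.snd).getD e 0 = (L[(e : ℕ)].2 : ℕ) := by
      simp [positions, he]
    have e3 : (input k ε A L B).reals 1 e = A L[(e : ℕ)].1 L[(e : ℕ)].2 := by
      change (L.map fun p => A p.1 p.2).getD e 0 = _
      simp [he]
    rw [e1, e2, e3]
    simp only [hF]
    refine if_congr ?_ rfl rfl
    simp only [hashOf, Fin.ext_iff]
    rfl
  rw [h1, Fin.sum_univ_fun_getElem, ← List.sum_toFinset _ hL.1]
  -- Each nonzero entry is listed once and all others contribute zero, so the list sum is the sum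
  -- over all positions, of which only row `i` survives.
  have h2 : L.toFinset = Finset.univ.filter fun p : Fin n × Fin d => A p.1 p.2 ≠ 0 := by
    ext p; simp [hL.2 p]
  rw [h2, Finset.sum_filter_of_ne, Fintype.sum_prod_type, sketch]
  · rw [Finset.sum_eq_single i]
    · simp only [true_and]
      rfl
    · intro i' _ hi'
      simp [hi']
    · simp
  · intro p _ hp h0
    apply hp
    simp [h0]

/-- Holds for every outcome of the coin flips: halting, the time bound and the Gram–Schmidt
description of the output involve no probability. -/
theorem input_runs (hL : ListsSupport A L) (hn : 1 ≤ n) (hd : 1 ≤ d) (ω : ℕ → Bool) {K b T : ℕ}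
    (hb : ∀ x < b, (2 : ℝ) ^ x * ε ^ 2 < K * ((r : ℝ) + 1) ^ 4)
    (hb' : K * ((r : ℝ) + 1) ^ 4 ≤ (2 : ℝ) ^ b * ε ^ 2)
    (hT : ∀ x < T, 2 ^ x < 10 * n) (hT' : 10 * n ≤ 2 ^ T) :
    ∃ s', Runs ω (sizeReduction K) (input k ε A L B) s'
        ((600 + mainCost) * volume n d r b T (nnz A)) ∧
      ∀ i : Fin n, ∃ V : ℕ → ℕ → ℕ → ℕ → ℝ,
        (∀ t < T, IsGramSchmidt (2 ^ b) r
          (column ω d r b (positions L) (input k ε A L B).reals t i) (V t)) ∧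
        (∀ l : Fin r, outVec n r s' i l = median T fun t => -V t r r (2 ^ b + l)) ∧
        outVal n s' i = median T fun t =>
          Real.sqrt (∑ h ∈ Finset.range (2 ^ b), V t r r h * V t r r h) := by
  have hlen : (positions L).length = nnz A := by simp [positions, hL.length_eq]
  obtain ⟨s₁, run₁, R₁, e₁⟩ := hashProg_runs ω K (input k ε A L B) (n := n) (d := d) (r := r)
    (b := b) (T := T) (L := positions L) rfl rfl rfl (by simp [positions, input])
    (fun e => by simp only [input, positions, List.map_map]; rfl)
    (fun e => by simp only [input, positions, List.map_map]; rfl)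
    (fun a ha => by obtain ⟨a, rfl⟩ := Nat.exists_eq_add_of_le' ha; rfl) rfl
    (by exact hb) (by exact hb') hT hT'
  obtain ⟨s₂, run₂, h₂⟩ := mainProg_runs R₁ (fun e he => by
      obtain ⟨p, -, rfl⟩ := List.mem_map.1 he
      exact p.2.2) hn hd
    (fun a ha => by rw [e₁]; obtain ⟨a, rfl⟩ := Nat.exists_eq_add_of_le' ha; rfl)
  rw [hlen] at run₂
  refine ⟨s₂, (run₁.mono (hashProg_time_le hn hd)).seq_mul run₂, fun i => ?_⟩
  obtain ⟨V, hV, h3, h4⟩ := h₂ i i.2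
  rw [e₁] at hV
  exact ⟨V, hV, fun l => h3 l l.2, h4⟩

end input

end SizeReduction

/-! ### Asymptotic estimates and the approximation guarantee -/

namespace SizeReduction

open RealRAM RealRAM.Algorithm CountSketch

theorem one_le_log_add_two {f : ℝ} (hf : 1 ≤ f) : 1 ≤ Real.log (f + 2) := by
  rw [Real.le_log_iff_exp_le (by linarith)]
  linarith [Real.exp_one_lt_three]

theorem softO_le_pow {C : ℝ} {q : ℕ} {f κ : ℝ} (hf : 1 ≤ f) {a : ℕ} (hκ : f ≤ κ ^ a) :
    softO C q f ≤ |C| * 2 ^ q * κ ^ (a * (q + 1)) := by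
  have hf0 : 0 < f := by linarith
  have h1 : Real.log (f + 2) ≤ 2 * f := by
    have := Real.log_le_sub_one_of_pos (show 0 < f + 2 by linarith)
    linarith
  have h0 : 0 ≤ Real.log (f + 2) := zero_le_one.trans (one_le_log_add_two hf)
  calc softO C q f ≤ |C| * f * (2 * f) ^ q := by
        unfold softO
        exact mul_le_mul (mul_le_mul_of_nonneg_right (le_abs_self C) hf0.le)
          (pow_le_pow_left₀ h0 h1 q) (by positivity) (by positivity)
    _ = |C| * 2 ^ q * f ^ (q + 1) := by ring
    _ ≤ |C| * 2 ^ q * (κ ^ a) ^ (q + 1) :=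
        mul_le_mul_of_nonneg_left (pow_le_pow_left₀ hf0.le hκ _) (by positivity)
    _ = _ := by rw [pow_mul]

/-- Minimality of `T` gives `2 ^ (T - 1) < 10 n ≤ 2⁴ n` for `T ≥ 1`; additive constants are absorbed
since the logarithm is at least `1`. -/
theorem trials_le {n T : ℕ} (hn : 1 ≤ n) (hT : ∀ x < T, 2 ^ x < 10 * n) {f : ℝ} (hf : 1 ≤ f)
    (hnf : (n : ℝ) ≤ f) : (T : ℝ) + 1 ≤ 8 * Real.log (f + 2) := by
  have hl := one_le_log_add_two hf
  rcases T with _ | T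
  · simp only [Nat.cast_zero]; linarith
  · have h1 : (2 : ℝ) ^ T ≤ 2 ^ 4 * n := by
      have h2 : 2 ^ T ≤ 2 ^ 4 * n := by have := hT T (Nat.lt_succ_self T); omega
      exact_mod_cast h2
    have hn0 : (0 : ℝ) < n := by exact_mod_cast hn
    have h2 := Real.log_le_log (by positivity) h1
    rw [Real.log_mul (by norm_num) hn0.ne', Real.log_pow, Real.log_pow] at h2
    have h3 : Real.log n ≤ Real.log (f + 2) := Real.log_le_log hn0 (by linarith)
    have h4 := Real.log_two_gt_d9
    push_cast at h2 ⊢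
    by_contra! h
    nlinarith

/-- By minimality of `b`, half the number of buckets was too small, so there are at most about `2K(r
+ 1)⁴/ε²` of them. This produces the exponent `4a + 2`. -/
theorem buckets_le {K r b a : ℕ} {ε κ c₁ : ℝ} (hε : 0 < ε) (hκ : 1 ≤ κ) (hκε : 1 / ε ≤ κ)
    (hc₁ : 0 ≤ c₁) (hr : (r : ℝ) ≤ c₁ * κ ^ a)
    (hb : ∀ x < b, (2 : ℝ) ^ x * ε ^ 2 < K * ((r : ℝ) + 1) ^ 4) :
    (2 : ℝ) ^ b + r + 2 ≤ (2 * K * (c₁ + 1) ^ 4 + c₁ + 3) * κ ^ (4 * a + 2) := by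
  have hp : ∀ m, 1 ≤ κ ^ m := fun m => one_le_pow₀ hκ
  have h1 : (r : ℝ) + 1 ≤ (c₁ + 1) * κ ^ a := by linarith [hp a]
  have h2 : (r : ℝ) ≤ c₁ * κ ^ (4 * a + 2) := hr.trans
    (mul_le_mul_of_nonneg_left (pow_le_pow_right₀ hκ (by omega)) hc₁)
  have h3 : (2 : ℝ) ^ b ≤ (2 * K * (c₁ + 1) ^ 4 + 1) * κ ^ (4 * a + 2) := by
    rcases b with _ | b
    · have : 0 ≤ 2 * K * (c₁ + 1) ^ 4 * κ ^ (4 * a + 2) := by positivity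
      rw [pow_zero]
      linarith [hp (4 * a + 2)]
    · have h4 : (2 : ℝ) ^ b ≤ K * ((r : ℝ) + 1) ^ 4 * (1 / ε) ^ 2 := by
        rw [one_div, inv_pow, ← div_eq_mul_inv, le_div_iff₀ (by positivity)]
        exact (hb b (Nat.lt_succ_self b)).le
      have h5 : K * ((r : ℝ) + 1) ^ 4 * (1 / ε) ^ 2 ≤ K * ((c₁ + 1) * κ ^ a) ^ 4 * κ ^ 2 := by
        gcongr
      have h6 : K * ((c₁ + 1) * κ ^ a) ^ 4 * κ ^ 2 = K * (c₁ + 1) ^ 4 * κ ^ (4 * a + 2) := by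
        ring
      rw [pow_succ]
      linarith [hp (4 * a + 2)]
  linarith [hp (4 * a + 2)]

/-- The number of nonzero entries is multiplied by `(T + 1)²` only, which is polylogarithmic; powers
of `k/ε` multiply `n + d` alone. The free `q` is slack that lets time and storage share one
exponent. -/
theorem volume_le {n d r b T len e : ℕ} {κ c₂ : ℝ} (hn : 1 ≤ n) (hκ : 1 ≤ κ)
    (hc₂ : 1 ≤ c₂) (hT : ∀ x < T, 2 ^ x < 10 * n)
    (hR : (2 : ℝ) ^ b + r + 2 ≤ c₂ * κ ^ e) (q : ℕ) :
    (Algorithm.volume n d r b T len : ℝ) ≤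
      softO (64 * c₂ ^ 3) (q + 2) ((len : ℝ) + ((n : ℝ) + d) * κ ^ (e * 3)) := by
  set f : ℝ := (len : ℝ) + ((n : ℝ) + d) * κ ^ (e * 3) with hf
  have hp : 1 ≤ κ ^ (e * 3) := one_le_pow₀ hκ
  have hn1 : (1 : ℝ) ≤ n := by exact_mod_cast hn
  have hnf : (n : ℝ) ≤ f := by
    have h1 : (0 : ℝ) ≤ len := Nat.cast_nonneg _
    have h2 : (0 : ℝ) ≤ d := Nat.cast_nonneg _
    nlinarith
  have hl := one_le_log_add_two (hn1.trans hnf)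
  have ht := trials_le hn hT (hn1.trans hnf) hnf
  have h3 : 1 ≤ c₂ ^ 3 := one_le_pow₀ hc₂
  have h4 : (len : ℝ) + ((n : ℝ) + d) * ((2 : ℝ) ^ b + r + 2) ^ 3 ≤ c₂ ^ 3 * f := by
    have h5 : ((2 : ℝ) ^ b + r + 2) ^ 3 ≤ c₂ ^ 3 * κ ^ (e * 3) := by
      rw [pow_mul, ← mul_pow]
      exact pow_le_pow_left₀ (by positivity) hR 3
    calc _ ≤ c₂ ^ 3 * len + ((n : ℝ) + d) * (c₂ ^ 3 * κ ^ (e * 3)) :=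
          add_le_add (le_mul_of_one_le_left (Nat.cast_nonneg _) h3)
            (mul_le_mul_of_nonneg_left h5 (by positivity))
      _ = _ := by rw [hf]; ring
  have hf0 : 0 ≤ f := by linarith
  calc (Algorithm.volume n d r b T len : ℝ)
      = ((T : ℝ) + 1) ^ 2 * (len + ((n : ℝ) + d) * ((2 : ℝ) ^ b + r + 2) ^ 3) := by
        simp only [Algorithm.volume]; push_cast; ring
    _ ≤ (8 * Real.log (f + 2)) ^ 2 * (c₂ ^ 3 * f) :=
        mul_le_mul (pow_le_pow_left₀ (by positivity) ht 2) h4 (by positivity) (by positivity)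
    _ = 64 * c₂ ^ 3 * f * Real.log (f + 2) ^ 2 := by ring
    _ ≤ _ := mul_le_mul_of_nonneg_left (pow_le_pow_right₀ hl (by omega)) (by positivity)

theorem storage_le {n d r q : ℕ} {C f : ℝ} (hf : 1 ≤ f) (hr : (r : ℝ) ≤ softO C q f) :
    ((n * (r + 1) + d * r : ℕ) : ℝ) ≤ ((n : ℝ) + d) * softO (|C| + 1) (q + 2) f := by
  have hl := one_le_log_add_two hf
  have h1 : (r : ℝ) + 1 ≤ softO (|C| + 1) (q + 2) f := by
    have h2 : softO C q f ≤ |C| * f * Real.log (f + 2) ^ (q + 2) := by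
      unfold softO
      exact mul_le_mul (mul_le_mul_of_nonneg_right (le_abs_self C) (by linarith))
        (pow_le_pow_right₀ hl (by omega)) (by positivity) (by positivity)
    have h3 : 1 ≤ f * Real.log (f + 2) ^ (q + 2) := one_le_mul_of_one_le_of_one_le hf
      (one_le_pow₀ hl)
    have h4 : softO (|C| + 1) (q + 2) f = |C| * f * Real.log (f + 2) ^ (q + 2) +
        f * Real.log (f + 2) ^ (q + 2) := by unfold softO; ring
    linarith
  calc ((n * (r + 1) + d * r : ℕ) : ℝ) ≤ ((n : ℝ) + d) * (r + 1) := by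
        push_cast
        nlinarith [(Nat.cast_nonneg d : (0 : ℝ) ≤ d)]
    _ ≤ _ := mul_le_mul_of_nonneg_left h1 (by positivity)

theorem softO_mono {C C' f : ℝ} {q : ℕ} (h : C ≤ C') (hf : 1 ≤ f) :
    softO C q f ≤ softO C' q f := by
  have hl := one_le_log_add_two hf
  unfold softO
  gcongr

section guarantee

variable {n d r k : ℕ} {c ε : ℝ} {A : Matrix (Fin n) (Fin d) ℝ} {L : List (Fin n × Fin d)}
  {P : Submodule ℝ (EuclideanSpace ℝ (Fin d))} {B : OrthonormalBasis (Fin r) ℝ P}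

/-- If most sketches are good for every row, the output of the algorithm preserves all shapes. -/
theorem reducedPreservesShapes_of_sketches (hc0 : 0 < c) (hc1 : c < 1) (hε0 : 0 < ε)
    (hε1 : ε < 1) (hL : ListsSupport A L) (hP : PreservesShapes A P k (c * ε))
    {ω : ℕ → Bool} {b T : ℕ} {x : Fin n → Fin r → ℝ} {v : Fin n → ℝ}
    (hω : ∀ i, 2 * Set.ncard {t : Fin T | ((1 - c) * ε / (4 * (r + 1))) ^ 2 <
      gramError (frame B (row A i)) (hashOf ω b d t)} < T)
    (hV : ∀ i : Fin n, ∃ V : ℕ → ℕ → ℕ → ℕ → ℝ,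
      (∀ t < T, IsGramSchmidt (2 ^ b) r
        (column ω d r b (positions L) (input k ε A L B).reals t i) (V t)) ∧
      (∀ l : Fin r, x i l = median T fun t => -V t r r (2 ^ b + l)) ∧
      v i = median T fun t =>
        Real.sqrt (∑ h ∈ Finset.range (2 ^ b), V t r r h * V t r r h)) :
    ReducedPreservesShapes A B k ε x v := by
  classical
  set θ : ℝ := (1 - c) * ε / (4 * (r + 1)) with hθd
  have hc : 0 < 1 - c := sub_pos.2 hc1
  have hθ : 0 < θ := by positivity
  have hθ' : θ ≤ 1 / 2 := by
    rw [hθd, div_le_iff₀ (by positivity)]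
    have : (1 - c) * ε ≤ 1 := mul_le_one₀ (by linarith) hε0.le hε1.le
    linarith [(Nat.cast_nonneg r : (0 : ℝ) ≤ r)]
  -- `θ` is chosen so that the factor `2θ` of `sketch_estimate` becomes the accuracy `δ / (r + 1)`
  -- required by `medians_close`.
  have hδ : 2 * θ = (1 - c) * ε / 2 / (r + 1) := by
    rw [hθd]; field_simp; ring
  refine reducedPreservesShapes_of_close hc0 hc1 hε0 hε1 A B hP x v fun i => ?_
  obtain ⟨V, hV, hx, hv⟩ := hV i
  set good : ℕ → Prop := fun t => gramError (frame B (row A i)) (hashOf ω b d t) ≤ θ ^ 2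
  have key : ∀ t < T, t ∉ (Finset.range T).filter (fun t => ¬ good t) → _ :=
    fun t ht hg => sketch_estimate B (row A i) (hashOf ω b d t) hθ hθ'
      (by simpa [ht, good] using hg) (hV t ht)
      (fun l h => column_basis ω b t i l h) (fun h => column_row hL ω b t i h)
  simp only [hx, hv]
  refine medians_close B (row A i) (by positivity) (fun t l => -V t r r (2 ^ b + l)) _
    ((Finset.range T).filter fun t => ¬ good t) ?_ ?_ ?_
  · refine lt_of_le_of_lt (Nat.mul_le_mul_left 2 (le_of_eq ?_)) (hω i)
    rw [← Set.ncard_coe_finset, ← Set.ncard_image_of_injective _ Fin.val_injective]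
    congr 1
    ext t
    simp only [Finset.coe_filter, Finset.mem_range, Set.mem_ofPred_eq, Set.mem_image, good, not_le]
    exact ⟨fun h => ⟨⟨t, h.1⟩, h.2, rfl⟩, fun ⟨t', h, e⟩ => e ▸ ⟨t'.2, h⟩⟩
  · intro t ht hg
    rw [← hδ]
    exact (key t ht hg).1
  · intro t ht hg
    rw [← hδ]
    exact (key t ht hg).2

end guarantee

end SizeReduction

/-! ### Assembly -/

open RealRAM SizeReduction in
theorem theorem3 (c : ℝ) (hc0 : 0 < c) (hc1 : c < 1) :
    ∃ prog : Prog, ∀ (C₀ : ℝ) (q₀ : ℕ), ∃ (C : ℝ) (p q : ℕ),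
      ∀ (n d k r : ℕ) (ε : ℝ), 1 ≤ n → 1 ≤ d → 1 ≤ k → 0 < ε → ε < 1 →
      (r : ℝ) ≤ softO C₀ q₀ ((k : ℝ) ^ 3 / ε ^ 6) →
      ∀ (A : Matrix (Fin n) (Fin d) ℝ) (L : List (Fin n × Fin d)), ListsSupport A L →
      ∀ (P : Submodule ℝ (EuclideanSpace ℝ (Fin d))) (B : OrthonormalBasis (Fin r) ℝ P),
      PreservesShapes A P k (c * ε) →
        -- running time and nonnegativity, for every outcome of the coin flips
        (∀ ω : ℕ → Bool, ∃ (t : ℕ) (s : State), Exec ω prog (input k ε A L B) t s ∧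
          (t : ℝ) ≤ softO C q ((nnz A : ℝ) + ((n : ℝ) + d) * ((k : ℝ) / ε) ^ p) ∧
          ∀ i, 0 ≤ outVal n s i) ∧
        -- approximation guarantee, simultaneously for all shapes
        9 / 10 ≤ coinMeasure {ω | ∃ (t : ℕ) (s : State), Exec ω prog (input k ε A L B) t s ∧
          ReducedPreservesShapes A B k ε (outVec n r s) (outVal n s)} ∧
        -- storage for the output together with the basis
        ((n * (r + 1) + d * r : ℕ) : ℝ) ≤ ((n : ℝ) + d) * softO C q ((k : ℝ) ^ 3 / ε ^ 6) := by
  classical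
  have hc : 0 < 1 - c := sub_pos.2 hc1
  -- Here `480 = 30 · 16`: the factor `30` comes from `card_gramError_gt` and `16` from the `4` in
  -- the denominator of `θ`. `K` is a natural number because it is a literal of the program.
  obtain ⟨K, hK⟩ := exists_nat_ge (480 / (1 - c) ^ 2)
  rw [div_le_iff₀ (by positivity)] at hK
  refine ⟨Algorithm.sizeReduction K, fun C₀ q₀ => ?_⟩
  set c₁ : ℝ := |C₀| * 2 ^ q₀ with hc₁
  set a : ℕ := 6 * (q₀ + 1) with ha
  set c₂ : ℝ := 2 * K * (c₁ + 1) ^ 4 + c₁ + 3 with hc₂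
  have hc₁0 : 0 ≤ c₁ := by positivity
  have hc₂1 : 1 ≤ c₂ := by
    have : 0 ≤ 2 * K * (c₁ + 1) ^ 4 := by positivity
    linarith
  set C₁ : ℝ := ((600 + Algorithm.mainCost : ℕ) : ℝ) * (64 * c₂ ^ 3) with hC₁
  have hC₁0 : 0 ≤ C₁ := by positivity
  -- The factor `3` comes from the cube in `volume`; the two summands of the constant serve time and
  -- storage.
  refine ⟨C₁ + (|C₀| + 1), (4 * a + 2) * 3, q₀ + 2, ?_⟩
  intro n d k r ε hn hd hk hε0 hε1 hr A L hL P B hP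
  have hk1 : (1 : ℝ) ≤ k := by exact_mod_cast hk
  have hκ : 1 ≤ (k : ℝ) / ε := by rw [le_div_iff₀ hε0]; linarith
  have hκε : 1 / ε ≤ (k : ℝ) / ε := by gcongr
  have hF : 1 ≤ (k : ℝ) ^ 3 / ε ^ 6 := by
    rw [le_div_iff₀ (by positivity), one_mul]
    exact (pow_le_one₀ hε0.le hε1.le).trans (one_le_pow₀ hk1)
  have hFκ : (k : ℝ) ^ 3 / ε ^ 6 ≤ ((k : ℝ) / ε) ^ 6 := by
    rw [div_pow]
    exact div_le_div_of_nonneg_right (pow_le_pow_right₀ hk1 (by norm_num)) (by positivity)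
  have hr' : (r : ℝ) ≤ c₁ * ((k : ℝ) / ε) ^ a := hr.trans (softO_le_pow hF hFκ)
  have hbex : ∃ b : ℕ, K * ((r : ℝ) + 1) ^ 4 ≤ (2 : ℝ) ^ b * ε ^ 2 := by
    obtain ⟨b, hb⟩ := pow_unbounded_of_one_lt (K * ((r : ℝ) + 1) ^ 4 / ε ^ 2) one_lt_two
    exact ⟨b, by rw [div_lt_iff₀ (by positivity)] at hb; exact hb.le⟩
  have hTex : ∃ T : ℕ, 10 * n ≤ 2 ^ T := ⟨10 * n, Nat.lt_two_pow_self.le⟩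
  obtain ⟨b, hb', hb⟩ : ∃ b : ℕ, K * ((r : ℝ) + 1) ^ 4 ≤ (2 : ℝ) ^ b * ε ^ 2 ∧
      ∀ x < b, (2 : ℝ) ^ x * ε ^ 2 < K * ((r : ℝ) + 1) ^ 4 :=
    ⟨Nat.find hbex, Nat.find_spec hbex, fun x hx => not_le.1 (Nat.find_min hbex hx)⟩
  obtain ⟨T, hT', hT⟩ : ∃ T : ℕ, 10 * n ≤ 2 ^ T ∧ ∀ x < T, 2 ^ x < 10 * n :=
    ⟨Nat.find hTex, Nat.find_spec hTex, fun x hx => not_le.1 (Nat.find_min hTex hx)⟩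
  have run := fun ω => input_runs (k := k) (ε := ε) (P := P) (B := B) hL hn hd ω hb hb' hT hT'
  refine ⟨fun ω => ?_, ?_, ?_⟩
  · obtain ⟨s, ⟨t, ht, hle⟩, hs⟩ := run ω
    refine ⟨t, s, ht, ?_, fun i => ?_⟩
    · have h1 := volume_le (d := d) (len := nnz A) hn hκ hc₂1 hT
        (buckets_le hε0 hκ hκε hc₁0 hr' hb) q₀
      set f : ℝ := (nnz A : ℝ) + ((n : ℝ) + d) * ((k : ℝ) / ε) ^ ((4 * a + 2) * 3) with hf
      have hf1 : 1 ≤ f := by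
        have h2 : (1 : ℝ) ≤ n := by exact_mod_cast hn
        have h3 : (1 : ℝ) ≤ ((k : ℝ) / ε) ^ ((4 * a + 2) * 3) := one_le_pow₀ hκ
        have h4 : (0 : ℝ) ≤ d := Nat.cast_nonneg d
        have h5 : (0 : ℝ) ≤ nnz A := Nat.cast_nonneg _
        nlinarith
      calc (t : ℝ) ≤ ((600 + Algorithm.mainCost : ℕ) : ℝ) *
            (Algorithm.volume n d r b T (nnz A) : ℝ) := by exact_mod_cast hle
        _ ≤ ((600 + Algorithm.mainCost : ℕ) : ℝ) * softO (64 * c₂ ^ 3) (q₀ + 2) f :=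
            mul_le_mul_of_nonneg_left h1 (by positivity)
        _ = softO C₁ (q₀ + 2) f := by unfold softO; rw [hC₁]; ring
        _ ≤ _ := softO_mono (by linarith [abs_nonneg C₀]) hf1
    · obtain ⟨V, -, -, hv⟩ := hs i
      rw [hv]
      exact median_nonneg fun t _ => Real.sqrt_nonneg _
  -- The success event only has to contain the event of `most_sketches_good`; its own measurability
  -- is not needed.
  · refine (most_sketches_good (b := b) (fun i => frame B (row A i))
      (fun i o => frame_norm_le B (row A i) o)
      (θ := (1 - c) * ε / (4 * (r + 1))) (by positivity) ?_ hT').trans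
      (measure_mono fun ω hω => ?_)
    · rw [Fintype.card_option, Fintype.card_fin, div_pow, mul_div_assoc', le_div_iff₀
        (by positivity)]
      push_cast
      have h1 : 480 * ((r : ℝ) + 1) ^ 4 ≤ K * (1 - c) ^ 2 * ((r : ℝ) + 1) ^ 4 := by gcongr
      have h2 := mul_le_mul_of_nonneg_right hb' (sq_nonneg (1 - c))
      linarith
    · obtain ⟨s, ⟨t, ht, -⟩, hs⟩ := run ω
      exact ⟨t, s, ht, reducedPreservesShapes_of_sketches hc0 hc1 hε0 hε1 hL hP hω hs⟩
  · exact (storage_le hF hr).trans (mul_le_mul_of_nonneg_left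
      (softO_mono (by linarith) hF) (by positivity))
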